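/- **Theorem (exact Fourier inversion formula).** Let $(X,g)$ be a smooth (Hausdorff, finite-dimensional, boundaryless) Riemannian manifold with Levi-Civita connection $\nabla_g$. Let $E$ be the complexification of $S^{\lambda}T_X\otimes_{\mathbb R}S^{\mu}T_X^*$, where $S^\lambda,S^\mu$ are the Schur powers attached to two Young diagrams $\lambda,\mu$ (images of Young symmetrizers in tensor powers), and let $(F,h_F)$ be a smooth Hermitian vector bundle over $X$. Write $\nabla_g$ also for the induced connection on the bundles $(T_X^*)^{\otimes k}\otimes_{\mathbb R}E$. Let $p\le 2$ and let $A=\sum_{r=0}^{p}A_r\nabla_g^{p-r}$ be a differential operator of order $p$ from $E$ to $F$, where $A_r\in C^\infty(X,S^{p-r}T_X\otimes_{\mathbb R}\mathrm{Hom}_{\mathbb R}(E,F))$ is regarded as a symmetric real-linear map $(T_X^*)^{\otimes(p-r)}\otimes_{\mathbb R} E\to F$. Its total symbol is given, for $\eta\in T^*_{X,x}$ and $e\in E_x$, by $$a(\eta)\,e=\sum_{r=0}^{p}A_r\bigl(\eta^{\otimes(p-r)}\otimes(2\pi i)^{p-r}e\bigr)\in F_x .$$ (If the $A_r$ are complex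 linear in $E$, this is $\sum_r(2\pi i)^{p-r}A_r(\eta^{\otimes(p-r)}\otimes e)$.) For $x\in X$, let $\mathrm{Cut}(x)$ be the cut locus of $x$, i.e. the set of points $\exp_x\xi$, $\xi\ne0$, such that the geodesic $t\mapsto\exp_x(t\xi)$ is minimizing on $[0,1]$ but on no $[0,t]$ with $t>1$. Let $D_x\subset T_{X,x}$ be the connected component of $0$ in the set of all $\xi$ in the domain of $\exp_x$ with $\exp_x\xi\notin\mathrm{Cut}(x)$ (if $X$ is complete and connected, this is the domain which $\exp_x$ maps diffeomorphically onto $X\smallsetminus\mathrm{Cut}(x)$). For $\xi\in D_x$ let $\tau_x^E:E_{\exp_x\xi}\to E_x$ be the parallel transport along the geodesic $t\mapsto\exp_x(t\xi)$. Let $\chi:[0,\infty)\to[0,1]$ be a smooth function with $\chi=1$ on $[0,1]$ and $\chi=0$ on $[2,\infty)$, let $\varepsilon_x>0$ be such that $\{|\xi|_{g_x}\le2\varepsilon_x\}\subset D_x$, and set $\chi_x(\xi)=\chi(|\xi|_{g_x}/\varepsilon_x)$. Then for every $u\in C^\infty(X,E)$ and every $x\in X$ the following integrals converge absolutely (the inner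 one for every $\eta$) and $$Au(x)=\int_{\eta\in T^*_{X,x}}a(\eta)\left(\int_{\xi\in D_x}\tau_x^E\bigl(u(\exp_x\xi)\bigr)\,e^{-2\pi i\,\eta\cdot\xi}\,\chi_x(\xi)\,dV_{g_x}(\xi)\right)dV_{g_x^*}(\eta),$$ where $dV_{g_x}$ and $dV_{g_x^*}$ are the Euclidean volumes on $T_{X,x}$ and $T^*_{X,x}$. -/

import Mathlib

open scoped Manifold ContDiff
open MeasureTheory

noncomputable section

namespace FourierInversion

/-! ### Tensors, Young symmetrizers and Schur powers of a vector space -/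

section Algebra

/-- The cells of a Young diagram; they index the tensor slots of the corresponding Schur power. -/
abbrev Cells (d : YoungDiagram) : Type := {c : ℕ × ℕ // c ∈ d.cells}

/-- Permutations of the cells preserving every row. -/
def rowGroup (d : YoungDiagram) : Finset (Equiv.Perm (Cells d)) :=
  Finset.univ.filter fun s => ∀ c, (s c).1.1 = c.1.1

/-- Permutations of the cells preserving every column. -/
def colGroup (d : YoungDiagram) : Finset (Equiv.Perm (Cells d)) :=
  Finset.univ.filter fun s => ∀ c, (s c).1.2 = c.1.2

variable (lam mu : YoungDiagram)
variable (V : Type*) [NormedAddCommGroup V] [NormedSpace ℝ V]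
variable {W : Type*} [NormedAddCommGroup W] [NormedSpace ℝ W]

/-- Complex valued multilinear forms in `|mu|` vectors. -/
abbrev Cov : Type _ := ContinuousMultilinearMap ℝ (fun _ : Cells mu => V) ℂ

/-- The complexification of `V^{⊗|lam|} ⊗ (V*)^{⊗|mu|}`: complex valued multilinear forms in
`|lam|` covectors and `|mu|` vectors, the slots being indexed by the cells of the diagrams. -/
abbrev Tens : Type _ :=
  ContinuousMultilinearMap ℝ (fun _ : Cells lam => StrongDual ℝ V) (Cov mu V)

/-! Shortcut instances, all of them the standard ones. -/

instance : NormedAddCommGroup (Cov mu V) := inferInstance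
instance : AddCommGroup (Cov mu V) := inferInstance
instance : NormedSpace ℝ (Cov mu V) := inferInstance
instance : NormedSpace ℂ (Cov mu V) := inferInstance
instance : Module ℝ (Cov mu V) := inferInstance
instance : Module ℂ (Cov mu V) := inferInstance
instance : SMulCommClass ℝ ℂ (Cov mu V) := inferInstance
instance : IsScalarTower ℝ ℂ (Cov mu V) := inferInstance
instance : ContinuousConstSMul ℂ (Cov mu V) := inferInstance
instance : NormedAddCommGroup (Tens lam mu V) := inferInstance
instance : AddCommGroup (Tens lam mu V) := inferInstance
instance : NormedSpace ℝ (Tens lam mu V) := inferInstance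
instance : NormedSpace ℂ (Tens lam mu V) := inferInstance
instance : Module ℝ (Tens lam mu V) := inferInstance
instance : Module ℂ (Tens lam mu V) := inferInstance
instance : SMulCommClass ℝ ℂ (Tens lam mu V) := inferInstance
instance : IsScalarTower ℝ ℂ (Tens lam mu V) := inferInstance

variable {lam mu V}

/-- The value at `(θ, v)` of the tensor obtained from `w` by applying the Young symmetrizer
`∑_{p ∈ rows} ∑_{q ∈ columns} sign(q) p q` of `lam` in the contravariant slots and that of `mu` in
the covariant slots. -/
def youngSum (w : Tens lam mu V) (θ : Cells lam → StrongDual ℝ V) (v : Cells mu → V) : ℂ :=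
  ∑ p ∈ rowGroup lam, ∑ q ∈ colGroup lam, ∑ p' ∈ rowGroup mu, ∑ q' ∈ colGroup mu,
    ((Equiv.Perm.sign q : ℤ) : ℂ) * ((Equiv.Perm.sign q' : ℤ) : ℂ) *
      w (fun c => θ ((p * q) c)) (fun c => v ((p' * q') c))

theorem youngSum_add (a b : Tens lam mu V) (θ : Cells lam → StrongDual ℝ V) (v : Cells mu → V) :
    youngSum (a + b) θ v = youngSum a θ v + youngSum b θ v := by
  simp only [youngSum, ← Finset.sum_add_distrib, ← mul_add]
  rfl

theorem youngSum_zero (θ : Cells lam → StrongDual ℝ V) (v : Cells mu → V) :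
    youngSum (0 : Tens lam mu V) θ v = 0 :=
  Finset.sum_eq_zero fun _ _ => Finset.sum_eq_zero fun _ _ => Finset.sum_eq_zero fun _ _ =>
    Finset.sum_eq_zero fun _ _ => mul_zero _

theorem youngSum_smul (c : ℂ) (a : Tens lam mu V) (θ : Cells lam → StrongDual ℝ V)
    (v : Cells mu → V) : youngSum (c • a) θ v = c * youngSum a θ v := by
  simp only [youngSum, Finset.mul_sum, mul_left_comm c]
  rfl

variable (lam mu V)

/-- The complexification of `S^lam V ⊗ S^mu V*`: the image of the Young symmetrizers. -/
def schur : Submodule ℂ (Tens lam mu V) where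
  carrier := {w | ∃ w₀ : Tens lam mu V, ∀ θ v, w θ v = youngSum w₀ θ v}
  add_mem' := by
    rintro a b ⟨a₀, ha⟩ ⟨b₀, hb⟩
    exact ⟨a₀ + b₀, fun θ v =>
      (congrArg₂ (· + ·) (ha θ v) (hb θ v)).trans (youngSum_add a₀ b₀ θ v).symm⟩
  zero_mem' := ⟨0, fun θ v => (youngSum_zero θ v).symm⟩
  smul_mem' := by
    rintro c a ⟨a₀, ha⟩
    exact ⟨c • a₀, fun θ v => (congrArg (c * ·) (ha θ v)).trans (youngSum_smul c a₀ θ v).symm⟩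

/-- The complex vector space `(S^lam V ⊗ S^mu V*) ⊗ ℂ`. -/
abbrev Schur : Type _ := schur lam mu V

/-- The space `(V*)^{⊗k} ⊗ (S^lam V ⊗ S^mu V*) ⊗ ℂ`. -/
abbrev KSchur (k : ℕ) : Type _ :=
  ContinuousMultilinearMap ℝ (fun _ : Fin k => V) (Schur lam mu V)

instance : NormedAddCommGroup (Schur lam mu V) := inferInstance
instance : AddCommGroup (Schur lam mu V) := inferInstance
instance : AddMonoid (Schur lam mu V) := inferInstance
instance : AddCommMonoid (Schur lam mu V) := inferInstance
instance : AddGroup (Schur lam mu V) := inferInstance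
instance : NormedSpace ℝ (Schur lam mu V) := Submodule.normedSpace _
instance : NormedSpace ℂ (Schur lam mu V) := Submodule.normedSpace _
instance : Module ℝ (Schur lam mu V) := Submodule.module' _
instance : Module ℂ (Schur lam mu V) := inferInstance
instance (k : ℕ) : NormedAddCommGroup (KSchur lam mu V k) := inferInstance
instance (k : ℕ) : AddCommGroup (KSchur lam mu V k) := inferInstance
instance (k : ℕ) : AddMonoid (KSchur lam mu V k) := inferInstance
instance (k : ℕ) : AddCommMonoid (KSchur lam mu V k) := inferInstance
instance (k : ℕ) : AddGroup (KSchur lam mu V k) := inferInstance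
instance (k : ℕ) : NormedSpace ℝ (KSchur lam mu V k) := inferInstance
instance (k : ℕ) : Module ℝ (KSchur lam mu V k) := inferInstance

variable {lam mu V}

/-- Transport of tensors along an isomorphism `P : V → W` with inverse `Q`. -/
def tensMap (P : V →L[ℝ] W) (Q : W →L[ℝ] V) : Tens lam mu V →L[ℝ] Tens lam mu W :=
  (ContinuousLinearMap.compContinuousMultilinearMapL ℝ (fun _ : Cells lam => StrongDual ℝ W)
      (ContinuousMultilinearMap ℝ (fun _ : Cells mu => V) ℂ)
      (ContinuousMultilinearMap ℝ (fun _ : Cells mu => W) ℂ)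
      (ContinuousMultilinearMap.compContinuousLinearMapL fun _ : Cells mu => Q)).comp
    (ContinuousMultilinearMap.compContinuousLinearMapL
      fun _ : Cells lam => (ContinuousLinearMap.compL ℝ V W ℝ).flip P)

theorem tensMap_apply (P : V →L[ℝ] W) (Q : W →L[ℝ] V) (w : Tens lam mu V)
    (θ : Cells lam → StrongDual ℝ W) (v : Cells mu → W) :
    tensMap P Q w θ v = w (fun c => (θ c).comp P) (fun c => Q (v c)) := rfl

/-- The derivation `(slotSum a M)(v₁, …, vₖ) = ∑ i, M(v₁, …, a vᵢ, …, vₖ)`. -/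
def slotSum {ι : Type*} [Fintype ι] [DecidableEq ι] {G : Type*} [NormedAddCommGroup G]
    [NormedSpace ℝ G] (a : V →L[ℝ] V) :
    ContinuousMultilinearMap ℝ (fun _ : ι => V) G →L[ℝ]
      ContinuousMultilinearMap ℝ (fun _ : ι => V) G :=
  ∑ i, ContinuousMultilinearMap.compContinuousLinearMapL
    (Function.update (fun _ : ι => ContinuousLinearMap.id ℝ V) i a)

theorem slotSum_apply {ι : Type*} [Fintype ι] [DecidableEq ι] {G : Type*} [NormedAddCommGroup G]
    [NormedSpace ℝ G] (a : V →L[ℝ] V) (M : ContinuousMultilinearMap ℝ (fun _ : ι => V) G)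
    (v : ι → V) : slotSum a M v = ∑ i, M (Function.update v i (a (v i))) := by
  simp only [slotSum, _root_.sum_apply]
  refine Finset.sum_congr rfl fun i _ => ?_
  simp only [ContinuousMultilinearMap.compContinuousLinearMapL_apply,
    ContinuousMultilinearMap.compContinuousLinearMap_apply]
  congr 1
  funext j
  by_cases h : j = i
  · subst h; simp
  · simp [h]

/-- The action of an endomorphism of `V` on tensors, as a derivation: `a` acts on the contravariant
slots and minus its transpose on the covariant ones. -/
def tensAct (a : V →L[ℝ] V) : Tens lam mu V →L[ℝ] Tens lam mu V :=
  slotSum ((ContinuousLinearMap.compL ℝ V V ℝ).flip a) -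
    ContinuousLinearMap.compContinuousMultilinearMapL ℝ (fun _ : Cells lam => StrongDual ℝ V)
      (ContinuousMultilinearMap ℝ (fun _ : Cells mu => V) ℂ)
      (ContinuousMultilinearMap ℝ (fun _ : Cells mu => V) ℂ) (slotSum a)

theorem tensAct_apply (a : V →L[ℝ] V) (w : Tens lam mu V) (θ : Cells lam → StrongDual ℝ V)
    (v : Cells mu → V) :
    tensAct a w θ v = ∑ c, w (Function.update θ c ((θ c).comp a)) v -
      ∑ c, w θ (Function.update v c (a (v c))) := by
  simp only [tensAct, _root_.sub_apply, _root_.sub_apply,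
    slotSum_apply, _root_.sum_apply]
  congr 1
  change slotSum a (w θ) v = _
  rw [slotSum_apply]

theorem tensMap_mem (P : V →L[ℝ] W) (Q : W →L[ℝ] V) {w : Tens lam mu V}
    (hw : w ∈ schur lam mu V) : tensMap P Q w ∈ schur lam mu W := by
  obtain ⟨w₀, hw₀⟩ := hw
  refine ⟨tensMap P Q w₀, fun θ v => ?_⟩
  rw [tensMap_apply, hw₀]
  rfl

theorem update_comp_perm {ι A : Type*} [DecidableEq ι] (s : Equiv.Perm ι) (θ : ι → A) (c : ι)
    (y : A) : Function.update (fun i => θ (s i)) c y = fun i => Function.update θ (s c) y (s i) := by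
  funext i
  by_cases h : i = c
  · subst h; simp
  · simp [h]

theorem tensAct_perm (a : V →L[ℝ] V) (w : Tens lam mu V) (θ : Cells lam → StrongDual ℝ V)
    (v : Cells mu → V) (s : Equiv.Perm (Cells lam)) (s' : Equiv.Perm (Cells mu)) :
    tensAct a w (fun c => θ (s c)) (fun c => v (s' c)) =
      ∑ c, w (fun i => Function.update θ c ((θ c).comp a) (s i)) (fun i => v (s' i)) -
      ∑ c, w (fun i => θ (s i)) (fun i => Function.update v c (a (v c)) (s' i)) := by
  rw [tensAct_apply]
  simp only [update_comp_perm]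
  congr 1
  · exact Equiv.sum_comp s fun c =>
      w (fun i => Function.update θ c ((θ c).comp a) (s i)) (fun i => v (s' i))
  · exact Equiv.sum_comp s' fun c =>
      w (fun i => θ (s i)) (fun i => Function.update v c (a (v c)) (s' i))

theorem tensAct_mem (a : V →L[ℝ] V) {w : Tens lam mu V}
    (hw : w ∈ schur lam mu V) : tensAct a w ∈ schur lam mu V := by
  obtain ⟨w₀, hw₀⟩ := hw
  refine ⟨tensAct a w₀, fun θ v => ?_⟩
  rw [tensAct_apply]
  simp only [hw₀, youngSum, tensAct_perm, mul_sub, Finset.mul_sum, Finset.sum_sub_distrib]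
  congr 1
  · rw [Finset.sum_comm]
    refine Finset.sum_congr rfl fun p _ => ?_
    rw [Finset.sum_comm]
    refine Finset.sum_congr rfl fun q _ => ?_
    rw [Finset.sum_comm]
    refine Finset.sum_congr rfl fun p' _ => ?_
    rw [Finset.sum_comm]
  · rw [Finset.sum_comm]
    refine Finset.sum_congr rfl fun p _ => ?_
    rw [Finset.sum_comm]
    refine Finset.sum_congr rfl fun q _ => ?_
    rw [Finset.sum_comm]
    refine Finset.sum_congr rfl fun p' _ => ?_
    rw [Finset.sum_comm]

/-- Transport of elements of `(S^lam V ⊗ S^mu V*) ⊗ ℂ` along an isomorphism `P` with inverse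
`Q`. -/
def schurMap (P : V →L[ℝ] W) (Q : W →L[ℝ] V) : Schur lam mu V →L[ℝ] Schur lam mu W where
  toFun w := ⟨tensMap P Q w.1, tensMap_mem P Q w.2⟩
  map_add' w w' := Subtype.ext (map_add (tensMap P Q) w.1 w'.1)
  map_smul' c w := Subtype.ext (map_smul (tensMap P Q) c w.1)
  cont := ((tensMap P Q).continuous.comp continuous_subtype_val).subtype_mk _

/-- The action of an endomorphism of `V` on `(S^lam V ⊗ S^mu V*) ⊗ ℂ` as a derivation. -/
def schurAct (a : V →L[ℝ] V) : Schur lam mu V →L[ℝ] Schur lam mu V where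
  toFun w := ⟨tensAct a w.1, tensAct_mem a w.2⟩
  map_add' w w' := Subtype.ext (map_add (tensAct a) w.1 w'.1)
  map_smul' c w := Subtype.ext (map_smul (tensAct a) c w.1)
  cont := ((tensAct a).continuous.comp continuous_subtype_val).subtype_mk _

/-- Transport of elements of `(V*)^{⊗k} ⊗ (S^lam V ⊗ S^mu V*) ⊗ ℂ` along an isomorphism `P` with
inverse `Q`. -/
def kMap {k : ℕ} (P : V →L[ℝ] W) (Q : W →L[ℝ] V) (M : KSchur lam mu V k) : KSchur lam mu W k :=
  (schurMap P Q).compContinuousMultilinearMap (M.compContinuousLinearMap fun _ => Q)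

/-- The action of an endomorphism of `V` on `(V*)^{⊗k} ⊗ (S^lam V ⊗ S^mu V*) ⊗ ℂ`. -/
def kAct {k : ℕ} (a : V →L[ℝ] V) (M : KSchur lam mu V k) : KSchur lam mu V k :=
  (schurAct a).compContinuousMultilinearMap M - slotSum a M

/-- The element `η^{⊗k} ⊗ e` of `(V*)^{⊗k} ⊗ (S^lam V ⊗ S^mu V*) ⊗ ℂ`. -/
def powTensor (k : ℕ) (η : StrongDual ℝ V) (e : Schur lam mu V) : KSchur lam mu V k :=
  ((ContinuousMultilinearMap.mkPiAlgebra ℝ (Fin k) ℝ).compContinuousLinearMap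
    fun _ => η).smulRight e

theorem kMap_add {k : ℕ} (P : V →L[ℝ] W) (Q : W →L[ℝ] V) (M N : KSchur lam mu V k) :
    kMap P Q (M + N) = kMap P Q M + kMap P Q N := by
  ext1 v
  exact map_add (schurMap P Q) (M fun i => Q (v i)) (N fun i => Q (v i))

theorem kMap_smul {k : ℕ} (P : V →L[ℝ] W) (Q : W →L[ℝ] V) (r : ℝ) (M : KSchur lam mu V k) :
    kMap P Q (r • M) = r • kMap P Q M := by
  ext1 v
  exact map_smul (schurMap P Q) r (M fun i => Q (v i))

theorem tensAct_add (a b : V →L[ℝ] V) (w : Tens lam mu V) :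
    tensAct (a + b) w = tensAct a w + tensAct b w := by
  ext θ v
  simp only [_root_.add_apply, tensAct_apply, ContinuousLinearMap.comp_add,
    ContinuousMultilinearMap.map_update_add, _root_.add_apply,
    Finset.sum_add_distrib]
  ring

theorem tensAct_smul (r : ℝ) (a : V →L[ℝ] V) (w : Tens lam mu V) :
    tensAct (r • a) w = r • tensAct a w := by
  ext θ v
  simp only [_root_.smul_apply, tensAct_apply, ContinuousLinearMap.comp_smul,
    ContinuousMultilinearMap.map_update_smul, _root_.smul_apply,
    Finset.smul_sum, smul_sub]

theorem kAct_add {k : ℕ} (a b : V →L[ℝ] V) (M : KSchur lam mu V k) :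
    kAct (a + b) M = kAct a M + kAct b M := by
  ext1 v
  have h : schurAct (a + b) (M v) = schurAct a (M v) + schurAct b (M v) :=
    Subtype.ext (tensAct_add a b (M v).1)
  simp only [kAct, _root_.sub_apply, _root_.add_apply,
    ContinuousLinearMap.compContinuousMultilinearMap_coe, Function.comp_apply, slotSum_apply,
    h, _root_.add_apply, ContinuousMultilinearMap.map_update_add,
    Finset.sum_add_distrib]
  abel

theorem kAct_smul {k : ℕ} (r : ℝ) (a : V →L[ℝ] V) (M : KSchur lam mu V k) :
    kAct (r • a) M = r • kAct a M := by
  ext1 v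
  have h : schurAct (r • a) (M v) = r • schurAct a (M v) :=
    Subtype.ext (tensAct_smul r a (M v).1)
  simp only [kAct, _root_.sub_apply, _root_.smul_apply,
    ContinuousLinearMap.compContinuousMultilinearMap_coe, Function.comp_apply, slotSum_apply,
    h, _root_.smul_apply, ContinuousMultilinearMap.map_update_smul,
    Finset.smul_sum, smul_sub]

end Algebra

/-! ### Riemannian geometry -/

/-- The Christoffel symbols of the first kind at `z` of a field `G` of bilinear forms on a vector
space: `(v, w, y) ↦ (∂_v G(w, y) + ∂_w G(v, y) - ∂_y G(v, w)) / 2`. -/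
def christoffelLower {H : Type*} [NormedAddCommGroup H] [NormedSpace ℝ H]
    (G : H → H →L[ℝ] H →L[ℝ] ℝ) (z v : H) : H →L[ℝ] H →L[ℝ] ℝ :=
  let dG : H →L[ℝ] H →L[ℝ] H →L[ℝ] ℝ := fderiv ℝ G z
  (1 / 2 : ℝ) • (dG v + dG.flip v - (dG.flip v).flip)

theorem christoffelLower_add {H : Type*} [NormedAddCommGroup H] [NormedSpace ℝ H]
    (G : H → H →L[ℝ] H →L[ℝ] ℝ) (z v w : H) :
    christoffelLower G z (v + w) = christoffelLower G z v + christoffelLower G z w := by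
  ext a b
  simp [christoffelLower]
  ring

theorem christoffelLower_smul {H : Type*} [NormedAddCommGroup H] [NormedSpace ℝ H]
    (G : H → H →L[ℝ] H →L[ℝ] ℝ) (z : H) (r : ℝ) (v : H) :
    christoffelLower G z (r • v) = r • christoffelLower G z v := by
  ext a b
  simp [christoffelLower]
  ring

/-- The isomorphism `V* → V` given by the inner product. -/
def sharp (V : Type*) [NormedAddCommGroup V] [InnerProductSpace ℝ V] [CompleteSpace V] :
    StrongDual ℝ V →L[ℝ] V where
  toFun := (InnerProductSpace.toDual ℝ V).symm
  map_add' := map_add _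
  map_smul' c η := map_smulₛₗ _ c η
  cont := (InnerProductSpace.toDual ℝ V).symm.continuous

/-- The endomorphism `L` of `V` with `⟨L w, y⟩ = B(P w, P y)`. -/
def raiseIndex (V : Type*) [NormedAddCommGroup V] [InnerProductSpace ℝ V] [CompleteSpace V]
    {H : Type*} [NormedAddCommGroup H] [NormedSpace ℝ H] (P : V →L[ℝ] H)
    (B : H →L[ℝ] H →L[ℝ] ℝ) : V →L[ℝ] V :=
  (sharp V).comp (B.bilinearComp P P)

theorem raiseIndex_add (V : Type*) [NormedAddCommGroup V] [InnerProductSpace ℝ V]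
    [CompleteSpace V] {H : Type*} [NormedAddCommGroup H] [NormedSpace ℝ H] (P : V →L[ℝ] H)
    (B C : H →L[ℝ] H →L[ℝ] ℝ) :
    raiseIndex V P (B + C) = raiseIndex V P B + raiseIndex V P C := by
  ext1 w
  exact map_add (sharp V) (B.bilinearComp P P w) (C.bilinearComp P P w)

theorem raiseIndex_smul (V : Type*) [NormedAddCommGroup V] [InnerProductSpace ℝ V]
    [CompleteSpace V] {H : Type*} [NormedAddCommGroup H] [NormedSpace ℝ H] (P : V →L[ℝ] H)
    (r : ℝ) (B : H →L[ℝ] H →L[ℝ] ℝ) : raiseIndex V P (r • B) = r • raiseIndex V P B := by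
  ext1 w
  exact map_smul (sharp V) r (B.bilinearComp P P w)

section Geometry

open Bundle

variable {H : Type*} [NormedAddCommGroup H] [NormedSpace ℝ H]
variable {X : Type*} [TopologicalSpace X] [ChartedSpace H X] [IsManifold 𝓘(ℝ, H) ∞ X]

/-- The identification `T_y X → H` given by the preferred chart at `c` (for `y` in its domain). -/
def toModel (c y : X) : TangentSpace 𝓘(ℝ, H) y →L[ℝ] H :=
  (trivializationAt H (TangentSpace 𝓘(ℝ, H)) c).continuousLinearMapAt ℝ y

/-- The inverse identification `H → T_y X` given by the preferred chart at `c`. -/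
def fromModel (c y : X) : H →L[ℝ] TangentSpace 𝓘(ℝ, H) y :=
  (trivializationAt H (TangentSpace 𝓘(ℝ, H)) c).symmL ℝ y

variable [RiemannianBundle (fun x : X => TangentSpace 𝓘(ℝ, H) x)]

instance instFiniteDimensionalTangent [FiniteDimensional ℝ H] (x : X) :
    FiniteDimensional ℝ (TangentSpace 𝓘(ℝ, H) x) :=
  inferInstanceAs (FiniteDimensional ℝ H)

instance instCompleteTangent [FiniteDimensional ℝ H] (x : X) :
    CompleteSpace (TangentSpace 𝓘(ℝ, H) x) :=
  FiniteDimensional.complete ℝ _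

instance instMeasurableTangent (x : X) : MeasurableSpace (TangentSpace 𝓘(ℝ, H) x) := borel _

instance instBorelTangent (x : X) : BorelSpace (TangentSpace 𝓘(ℝ, H) x) := ⟨rfl⟩

/-- The metric read in the preferred chart at `c`, as a function on the model space with values in
bilinear forms. -/
def metricInChart (c : X) (z : H) : H →L[ℝ] H →L[ℝ] ℝ :=
  (innerSL ℝ : TangentSpace 𝓘(ℝ, H) ((extChartAt 𝓘(ℝ, H) c).symm z) →L[ℝ]
      TangentSpace 𝓘(ℝ, H) ((extChartAt 𝓘(ℝ, H) c).symm z) →L[ℝ] ℝ).bilinearComp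
    (fromModel c _) (fromModel c _)

variable [FiniteDimensional ℝ H]

/-- The Christoffel symbols of the Levi-Civita connection at `x`, in the preferred chart at `x`:
`christoffel x v w = Γ(v, w)`, so that `∇_v W = D_v W + Γ(v, W)` in this chart. -/
def christoffel (x : X) (v : TangentSpace 𝓘(ℝ, H) x) :
    TangentSpace 𝓘(ℝ, H) x →L[ℝ] TangentSpace 𝓘(ℝ, H) x :=
  raiseIndex (TangentSpace 𝓘(ℝ, H) x) (by exact toModel x x)
    (christoffelLower (metricInChart x) (extChartAt 𝓘(ℝ, H) x x) (toModel x x v))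

theorem christoffel_add (x : X) (v w : TangentSpace 𝓘(ℝ, H) x) :
    christoffel x (v + w) = christoffel x v + christoffel x w := by
  rw [christoffel, map_add, christoffelLower_add, raiseIndex_add]
  rfl

theorem christoffel_smul (x : X) (r : ℝ) (v : TangentSpace 𝓘(ℝ, H) x) :
    christoffel x (r • v) = r • christoffel x v := by
  rw [christoffel, map_smul, christoffelLower_smul, raiseIndex_smul]
  rfl

/-! #### Geodesics, exponential map, cut locus -/

/-- The velocity of a curve. -/
def velocity (H : Type*) [NormedAddCommGroup H] [NormedSpace ℝ H] {X : Type*} [TopologicalSpace X]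
    [ChartedSpace H X] (γ : ℝ → X) (t : ℝ) : TangentSpace 𝓘(ℝ, H) (γ t) :=
  mfderiv 𝓘(ℝ, ℝ) 𝓘(ℝ, H) γ t (1 : ℝ)

variable (H) in
/-- `γ` is a smooth solution on `J` of the geodesic equation `∇_{γ'} γ' = 0`, the equation at time
`t` being written in the preferred chart at `γ t`. -/
def IsGeodesicOn (γ : ℝ → X) (J : Set ℝ) : Prop :=
  ∀ t ∈ J, ContMDiffAt 𝓘(ℝ, ℝ) 𝓘(ℝ, H) ∞ γ t ∧
    iteratedDeriv 2 (fun s => extChartAt 𝓘(ℝ, H) (γ t) (γ s)) t +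
      toModel (γ t) (γ t) (christoffel (γ t) (velocity H γ t) (velocity H γ t)) = 0

/-- `γ` is a geodesic with `γ 0 = x` and `γ' 0 = ξ`, defined on an open interval
containing `[0, 1]`. -/
def IsGeodesicFrom (x : X) (ξ : TangentSpace 𝓘(ℝ, H) x) (γ : ℝ → X) : Prop :=
  (∃ a b : ℝ, a < 0 ∧ 1 < b ∧ IsGeodesicOn H γ (Set.Ioo a b)) ∧
    (⟨γ 0, velocity H γ 0⟩ : TangentBundle 𝓘(ℝ, H) X) = ⟨x, ξ⟩

/-- The domain of the exponential map at `x`. -/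
def expDomain (x : X) : Set (TangentSpace 𝓘(ℝ, H) x) :=
  {ξ | ∃ γ : ℝ → X, IsGeodesicFrom x ξ γ}

open Classical in
/-- The geodesic `t ↦ exp_x(t ξ)`, for `t ∈ [0, 1]`, if `ξ` is in the domain of `exp_x`. -/
def geodesic (x : X) (ξ : TangentSpace 𝓘(ℝ, H) x) : ℝ → X :=
  if h : ∃ γ : ℝ → X, IsGeodesicFrom x ξ γ then h.choose else fun _ => x

/-- The Riemannian exponential map at `x` (meaningful on `expDomain x`). -/
def expMap (x : X) (ξ : TangentSpace 𝓘(ℝ, H) x) : X := geodesic x ξ 1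

/-- The geodesic `t ↦ exp_x(t ξ)` is defined and minimizing on `[0, 1]`. -/
def IsMinimizing (x : X) (ξ : TangentSpace 𝓘(ℝ, H) x) : Prop :=
  ξ ∈ expDomain x ∧ Manifold.riemannianEDist 𝓘(ℝ, H) x (expMap x ξ) = ‖ξ‖ₑ

variable (H) in
/-- The cut locus of `x`: the points `exp_x ξ` such that `t ↦ exp_x(t ξ)` is minimizing on `[0, 1]`
but on no larger interval `[0, t]`. -/
def cutLocus (x : X) : Set X :=
  {y | ∃ ξ : TangentSpace 𝓘(ℝ, H) x, ξ ≠ 0 ∧ IsMinimizing x ξ ∧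
    (∀ t : ℝ, 1 < t → ¬ IsMinimizing x (t • ξ)) ∧ expMap x ξ = y}

/-- The domain `D_x`: the connected component of `0` in the set of all `ξ` in the domain of `exp_x`
such that `exp_x ξ` is not in the cut locus of `x`. -/
def injDomain (x : X) : Set (TangentSpace 𝓘(ℝ, H) x) :=
  connectedComponentIn {ξ | ξ ∈ expDomain x ∧ expMap x ξ ∉ cutLocus H x} 0

/-! #### The bundle `E = (S^lam T_X ⊗ S^mu T_X^*) ⊗ ℂ` -/

variable (H) in
/-- The fibre `E_x` of the complexification of `S^lam T_X ⊗ S^mu T_X^*`. -/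
abbrev EFib (lam mu : YoungDiagram) (x : X) : Type _ := Schur lam mu (TangentSpace 𝓘(ℝ, H) x)

variable (H) in
/-- The fibre at `x` of `(T_X^*)^{⊗k} ⊗ E`. -/
abbrev KFib (lam mu : YoungDiagram) (k : ℕ) (x : X) : Type _ :=
  KSchur lam mu (TangentSpace 𝓘(ℝ, H) x) k

variable {lam mu : YoungDiagram}

variable (lam mu) in
/-- The identification `E_y → (S^lam H ⊗ S^mu H^*) ⊗ ℂ` given by the preferred chart at `c`. -/
def eToModel (c y : X) : EFib H lam mu y →L[ℝ] Schur lam mu H :=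
  schurMap (V := TangentSpace 𝓘(ℝ, H) y) (by exact toModel c y) (by exact fromModel c y)

/-- The components, in the preferred chart at `c`, of an element of the fibre at `y` of
`(T_X^*)^{⊗k} ⊗ E`. -/
def kToModel {k : ℕ} (c y : X) (M : KFib H lam mu k y) : KSchur lam mu H k :=
  kMap (V := TangentSpace 𝓘(ℝ, H) y) (by exact toModel c y) (by exact fromModel c y) M

/-- The element of the fibre at `y` of `(T_X^*)^{⊗k} ⊗ E` with given components in the preferred
chart at `c`. -/
def kFromModel {k : ℕ} (c y : X) (M : KSchur lam mu H k) : KFib H lam mu k y :=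
  kMap (W := TangentSpace 𝓘(ℝ, H) y) (by exact fromModel c y) (by exact toModel c y) M

/-- The action on `E_x` of the endomorphism `Γ(v)` of `T_x X`. -/
def eGamma (x : X) (v : TangentSpace 𝓘(ℝ, H) x) : EFib H lam mu x →L[ℝ] EFib H lam mu x :=
  schurAct (V := TangentSpace 𝓘(ℝ, H) x) (by exact christoffel x v)

/-- The action of the endomorphism `Γ(v)` of `T_x X` on the fibre at `x` of
`(T_X^*)^{⊗k} ⊗ E`. -/
def kGamma {k : ℕ} (x : X) (v : TangentSpace 𝓘(ℝ, H) x) (M : KFib H lam mu k x) :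
    KFib H lam mu k x :=
  kAct (V := TangentSpace 𝓘(ℝ, H) x) (by exact christoffel x v) M

theorem kGamma_add {k : ℕ} (x : X) (v w : TangentSpace 𝓘(ℝ, H) x) (M : KFib H lam mu k x) :
    kGamma x (v + w) M = kGamma x v M + kGamma x w M := by
  rw [kGamma, christoffel_add]
  exact kAct_add _ _ M

theorem kGamma_smul {k : ℕ} (x : X) (r : ℝ) (v : TangentSpace 𝓘(ℝ, H) x)
    (M : KFib H lam mu k x) : kGamma x (r • v) M = r • kGamma x v M := by
  rw [kGamma, christoffel_smul]
  exact kAct_smul _ _ M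

theorem kFromModel_add {k : ℕ} (c y : X) (M N : KSchur lam mu H k) :
    (kFromModel c y (M + N) : KFib H lam mu k y) = kFromModel c y M + kFromModel c y N :=
  kMap_add _ _ M N

theorem kFromModel_smul {k : ℕ} (c y : X) (r : ℝ) (M : KSchur lam mu H k) :
    (kFromModel c y (r • M) : KFib H lam mu k y) = r • kFromModel c y M :=
  kMap_smul _ _ r M

/-- Smoothness of a section of `E`: its components in every preferred chart are smooth. -/
def IsSmoothSection (u : ∀ x : X, EFib H lam mu x) : Prop :=
  ∀ c : X, ContMDiffOn 𝓘(ℝ, H) 𝓘(ℝ, Schur lam mu H) ∞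
    (fun y => eToModel lam mu c y (u y)) (chartAt H c).source

/-- The section `s` of `(T_X^*)^{⊗k} ⊗ E` read in the preferred chart at `c`. -/
def sectionInChart {k : ℕ} (s : ∀ x : X, KFib H lam mu k x) (c : X) (z : H) :
    KSchur lam mu H k :=
  kToModel c ((extChartAt 𝓘(ℝ, H) c).symm z) (s ((extChartAt 𝓘(ℝ, H) c).symm z))

/-- `∇_v s` at `x`: in the preferred chart at `x` it is `D_v s + Γ(v) · s`. -/
def nablaAt {k : ℕ} (s : ∀ x : X, KFib H lam mu k x) (x : X) :
    TangentSpace 𝓘(ℝ, H) x →L[ℝ] KFib H lam mu k x :=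
  LinearMap.toContinuousLinearMap
    { toFun := fun v =>
        kFromModel x x (fderiv ℝ (sectionInChart s x) (extChartAt 𝓘(ℝ, H) x x) (toModel x x v)) +
          kGamma x v (s x)
      map_add' := fun v w => by
        rw [map_add, map_add, kGamma_add, kFromModel_add]
        abel
      map_smul' := fun r v => by
        rw [map_smul, map_smul, kGamma_smul, kFromModel_smul, smul_add]
        rfl }

/-- The covariant derivative `∇_g` from sections of `(T_X^*)^{⊗k} ⊗ E` to sections of
`(T_X^*)^{⊗(k+1)} ⊗ E`, the new slot being the first one. -/
def nabla {k : ℕ} (s : ∀ x : X, KFib H lam mu k x) (x : X) : KFib H lam mu (k + 1) x :=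
  ContinuousLinearMap.uncurryLeft (nablaAt s x)

/-- The iterated covariant derivative `∇_g^k u`, a section of `(T_X^*)^{⊗k} ⊗ E`. -/
def nablaIter (u : ∀ x : X, EFib H lam mu x) : (k : ℕ) → ∀ x : X, KFib H lam mu k x
  | 0 => fun x => ContinuousMultilinearMap.constOfIsEmpty ℝ (fun _ : Fin 0 => _) (u x)
  | k + 1 => nabla (nablaIter u k)

/-! #### Parallel transport along radial geodesics -/

/-- `s` is a parallel section of `E` along the restriction of `γ` to `[0, 1]`: the equation
`∇_{γ'} s = 0` at time `t` is written in the preferred chart at `γ t`. -/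
def IsParallel (γ : ℝ → X) (s : ∀ t : ℝ, EFib H lam mu (γ t)) : Prop :=
  ∀ t ∈ Set.Icc (0 : ℝ) 1,
    HasDerivWithinAt (fun r => eToModel lam mu (γ t) (γ r) (s r))
      (- eToModel lam mu (γ t) (γ t) (eGamma (γ t) (velocity H γ t) (s t)))
      (Set.Icc 0 1) t

/-- `w ∈ E_x` is obtained from `e ∈ E_{exp_x ξ}` by parallel transport along the geodesic
`t ↦ exp_x(t ξ)`, from time `1` to time `0`. -/
def IsTransported (x : X) (ξ : TangentSpace 𝓘(ℝ, H) x) (e : EFib H lam mu (expMap x ξ))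
    (w : EFib H lam mu x) : Prop :=
  ∃ s : ∀ t : ℝ, EFib H lam mu (geodesic x ξ t), IsParallel (geodesic x ξ) s ∧
    s 1 = e ∧ (⟨geodesic x ξ 0, s 0⟩ : Σ y : X, EFib H lam mu y) = ⟨x, w⟩

open Classical in
/-- The parallel transport `τ_x^E : E_{exp_x ξ} → E_x` along the geodesic `t ↦ exp_x(t ξ)`. -/
def transport (x : X) (ξ : TangentSpace 𝓘(ℝ, H) x) (e : EFib H lam mu (expMap x ξ)) :
    EFib H lam mu x :=
  if h : ∃ w, IsTransported x ξ e w then h.choose else 0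

/-! #### Differential operators and their symbols -/

/-- The Hermitian inner products on the fibres of the complex vector bundle `F` depend smoothly on
the base point, that is, so do their real parts. -/
def IsSmoothHermitian (H : Type*) [NormedAddCommGroup H] [NormedSpace ℝ H]
    {X : Type*} [TopologicalSpace X] [ChartedSpace H X]
    (FF : Type*) [NormedAddCommGroup FF] [NormedSpace ℂ FF]
    (F : X → Type*) [TopologicalSpace (TotalSpace FF F)] [∀ x, NormedAddCommGroup (F x)]
    [∀ x, InnerProductSpace ℂ (F x)] [FiberBundle FF F] [VectorBundle ℝ FF F] : Prop :=
  letI : ∀ x, InnerProductSpace ℝ (F x) := fun _ => InnerProductSpace.complexToReal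
  IsContMDiffRiemannianBundle 𝓘(ℝ, H) ∞ FF F

/-- A differential operator of order `p` from `E` to the vector bundle `F` (with model fibre `FF`),
given by its coefficients `A_r`, which are smooth sections of
`S^{p-r} T_X ⊗ Hom_ℝ(E, F) ⊆ Hom_ℝ((T_X^*)^{⊗(p-r)} ⊗ E, F)`. -/
structure DiffOp (H : Type*) [NormedAddCommGroup H] [NormedSpace ℝ H] [FiniteDimensional ℝ H]
    {X : Type*} [TopologicalSpace X] [ChartedSpace H X] [IsManifold 𝓘(ℝ, H) ∞ X]
    [RiemannianBundle (fun x : X => TangentSpace 𝓘(ℝ, H) x)] (lam mu : YoungDiagram)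
    (FF : Type*) [NormedAddCommGroup FF] [NormedSpace ℝ FF]
    (F : X → Type*) [TopologicalSpace (TotalSpace FF F)] [∀ x, NormedAddCommGroup (F x)]
    [∀ x, NormedSpace ℝ (F x)] [FiberBundle FF F] [VectorBundle ℝ FF F] (p : ℕ) where
  /-- The value of `A_r` at `x`. -/
  coeff (r : Fin (p + 1)) (x : X) : KFib H lam mu (p - r) x →L[ℝ] F x
  /-- `A_r` is symmetric in its `p - r` contravariant slots. -/
  symm (r : Fin (p + 1)) (x : X) (σ : Equiv.Perm (Fin (p - r))) (M : KFib H lam mu (p - r) x) :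
    coeff r x (M.domDomCongr σ) = coeff r x M
  /-- The components of `A_r` in the preferred charts are smooth. -/
  smooth (r : Fin (p + 1)) (c : X) (M : KSchur lam mu H (p - r)) :
    ContMDiffOn 𝓘(ℝ, H) (𝓘(ℝ, H).prod 𝓘(ℝ, FF)) ∞
      (fun y => (⟨y, coeff r y (kFromModel c y M)⟩ : TotalSpace FF F)) (chartAt H c).source

namespace DiffOp

variable {FF : Type*} [NormedAddCommGroup FF] [NormedSpace ℝ FF]
  {F : X → Type*} [TopologicalSpace (TotalSpace FF F)] [∀ x, NormedAddCommGroup (F x)]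
  [∀ x, NormedSpace ℝ (F x)] [FiberBundle FF F] [VectorBundle ℝ FF F] {p : ℕ}

/-- The operator itself: `A u = ∑_{r=0}^p A_r ∇_g^{p-r} u`. -/
def apply (A : DiffOp H lam mu FF F p) (u : ∀ x : X, EFib H lam mu x) (x : X) : F x :=
  ∑ r : Fin (p + 1), A.coeff r x (nablaIter u (p - r) x)

/-- The total symbol of `A`, as a real-linear map `a(η) : E_x → F_x` for `η ∈ T_x^* X`:
`a(η) e = ∑_{r=0}^p A_r ((2 π i η)^{⊗(p-r)} ⊗ e)`. -/
def symbol (A : DiffOp H lam mu FF F p) (x : X) (η : StrongDual ℝ (TangentSpace 𝓘(ℝ, H) x))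
    (e : EFib H lam mu x) : F x :=
  ∑ r : Fin (p + 1), A.coeff r x
    (powTensor (p - r) η ((2 * Real.pi * Complex.I) ^ (p - r : ℕ) • e))

/-- If the coefficients of `A` are complex linear in `E`, then
`a(η) e = ∑_{r=0}^p (2 π i)^{p-r} A_r (η^{⊗(p-r)} ⊗ e)`. -/
theorem symbol_eq_of_complexLinear [∀ x, Module ℂ (F x)] (A : DiffOp H lam mu FF F p) (x : X)
    (h : ∀ (r : Fin (p + 1)) (η : StrongDual ℝ (TangentSpace 𝓘(ℝ, H) x)) (z : ℂ)
      (e : EFib H lam mu x), A.coeff r x (powTensor (p - r) η (z • e)) =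
        z • A.coeff r x (powTensor (p - r) η e))
    (η : StrongDual ℝ (TangentSpace 𝓘(ℝ, H) x)) (e : EFib H lam mu x) :
    A.symbol x η e = ∑ r : Fin (p + 1),
      (2 * Real.pi * Complex.I) ^ (p - r : ℕ) • A.coeff r x (powTensor (p - r) η e) :=
  Finset.sum_congr rfl fun r _ => h r η _ e

end DiffOp

/-! #### The Fourier transform -/

/-- The measure `dV_{g_x^*}` on `T_x^* X`, image of the Euclidean volume of `T_x X` under the
isometry `T_x X → T_x^* X` given by the metric. -/
def dualVolume (x : X) : Measure (StrongDual ℝ (TangentSpace 𝓘(ℝ, H) x)) :=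
  (volume : Measure (TangentSpace 𝓘(ℝ, H) x)).map
    (InnerProductSpace.toDual ℝ (TangentSpace 𝓘(ℝ, H) x))

/-- The integrand `τ_x^E · u(exp_x ξ) e^{-2πi η·ξ} χ(|ξ| / ε)`. -/
def fourierIntegrand (χ : ℝ → ℝ) (ε : ℝ) (u : ∀ x : X, EFib H lam mu x) (x : X)
    (η : StrongDual ℝ (TangentSpace 𝓘(ℝ, H) x)) (ξ : TangentSpace 𝓘(ℝ, H) x) :
    EFib H lam mu x :=
  (Complex.exp (-2 * Real.pi * Complex.I * (η ξ : ℝ)) * (χ (‖ξ‖ / ε) : ℂ)) •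
    transport x ξ (u (expMap x ξ))

/-- `∫_{D_x} τ_x^E · u(exp_x ξ) e^{-2πi η·ξ} χ(|ξ| / ε) dV_{g_x}(ξ)`. -/
def fourierTransform (χ : ℝ → ℝ) (ε : ℝ) (u : ∀ x : X, EFib H lam mu x) (x : X)
    (η : StrongDual ℝ (TangentSpace 𝓘(ℝ, H) x)) : EFib H lam mu x :=
  ∫ ξ in injDomain x, fourierIntegrand χ ε u x η ξ

end Geometry

end FourierInversion

end

open scoped Manifold ContDiff Bundle

open scoped Manifold ContDiff Bundle

namespace FourierInversion

section Geometry

set_option linter.unusedSectionVars false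
set_option maxSynthPendingDepth 3

/-! Fix `x` and put `f(ξ) = χ_x(ξ) τ_x^E(u(exp_x ξ))`, a function on `T_x` with values in the fixed
vector space `E_x` (`cutoffTransport`). Once `f` is known to be smooth with compact support, the
analysis is Euclidean: the Fourier transform of `D^k f` at `η` is `η^{⊗k} ⊗ (2πi)^k f̂(η)`, it is a
Schwartz function, and inversion at the origin gives `∫ B(η^{⊗k} ⊗ (2πi)^k f̂(η)) dη = B(D^k f(0))`
for every continuous real-linear `B` (`fourier_inversion_coeff`). The factor `(2πi)^k` stays inside
`B`, so complex linearity plays no role. As the cut-off is supported in a ball contained in `D_x`,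
the integral over `D_x` is an integral over `T_x`.

It remains to compare `D^k f(0)` with `∇^k u(x)` for `k ≤ 2`. For small `t`, `f(tv)` is `u`
transported back to `x` along the geodesic with initial velocity `v`. Parallel transport turns
`d/dt` into `∇_{γ'}`, and `∇_{γ'} γ' = 0`, so the first two derivatives at `t = 0` are `∇_v u` and
`∇²u(v, v)` (`exists_radial_expansion`). Because of curvature `∇²u` need not be symmetric, and
`D²f(0)` is only its symmetrization; the coefficients `A_r` are symmetric and do not see the
difference (`eq_of_diagonal_eq`).

Most of the work is the smoothness of `f` (`exists_contDiffAt_transport`). In a chart, geodesics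
together with the matrices of parallel transport solve one smooth autonomous equation
(`frameField`), whose local solutions are `C^n` in the initial value (`exists_local_flow`, by the
inverse function theorem in a space of continuous curves). Compactness of `[0, 1]` chains finitely
many local flows through changing charts (`hasSmoothTransport_one`). The property propagated
concerns whichever geodesics with nearby initial velocity do exist up to time 1, so openness of the
domain of `exp_x` is never needed: outside the ball of radius `2ε` the cut-off vanishes. Since the
definitions write each equation at a point in the preferred chart at that point, the transformation
law of the Christoffel symbols (`jac_chr`) is what allows everything to be read in one fixed chart.
-/

/-- The norm on a tangent space given by the Riemannian metric. -/
noncomputable abbrev tangentNormedAddCommGroup {H : Type*} [NormedAddCommGroup H]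
    [NormedSpace ℝ H] {X : Type*} [TopologicalSpace X] [ChartedSpace H X]
    [Bundle.RiemannianBundle (fun x : X => TangentSpace 𝓘(ℝ, H) x)] (x : X) :
    NormedAddCommGroup (TangentSpace 𝓘(ℝ, H) x) :=
  Bundle.instNormedAddCommGroupOfRiemannianBundleOfIsTopologicalAddGroupOfContinuousConstSMulReal
    (E := fun x : X => TangentSpace 𝓘(ℝ, H) x) x

/-- The inner product on a tangent space given by the Riemannian metric. -/
noncomputable abbrev tangentInnerProductSpace {H : Type*} [NormedAddCommGroup H]
    [NormedSpace ℝ H] {X : Type*} [TopologicalSpace X] [ChartedSpace H X]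
    [Bundle.RiemannianBundle (fun x : X => TangentSpace 𝓘(ℝ, H) x)] (x : X) :
    InnerProductSpace ℝ (TangentSpace 𝓘(ℝ, H) x) :=
  Bundle.instInnerProductSpaceReal (E := fun x : X => TangentSpace 𝓘(ℝ, H) x) x

attribute [-instance]
  Bundle.instNormedAddCommGroupOfRiemannianBundleOfIsTopologicalAddGroupOfContinuousConstSMulReal
attribute [-instance] Bundle.instInnerProductSpaceReal
attribute [local instance] tangentNormedAddCommGroup tangentInnerProductSpace

/-! ### Smooth dependence of solutions of an ODE on the initial value -/

section SmoothFlow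

open Set Filter Topology

universe u

section Postcomp

variable {K : Type*} [TopologicalSpace K] [CompactSpace K] {E F G : Type u}
  [NormedAddCommGroup E] [NormedSpace ℝ E] [NormedAddCommGroup F] [NormedSpace ℝ F]
  [NormedAddCommGroup G] [NormedSpace ℝ G]

variable (K) in
/-- The pointwise application of a continuous family of linear maps to a continuous function. -/
noncomputable def familyApply (ev : G →L[ℝ] E →L[ℝ] F) :
    C(K, G) →L[ℝ] C(K, E) →L[ℝ] C(K, F) :=
  LinearMap.mkContinuous₂
    (LinearMap.mk₂ ℝ (fun (a : C(K, G)) (h : C(K, E)) =>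
      (⟨fun t => ev (a t) (h t), by fun_prop⟩ : C(K, F)))
      (fun a b h => by ext t; simp) (fun r a h => by ext t; simp)
      (fun a h k => by ext t; simp) (fun r a h => by ext t; simp)) ‖ev‖
    (fun a h => by
      refine (ContinuousMap.norm_le _ (by positivity)).2 fun t => ?_
      refine (ev.le_opNorm₂ (a t) (h t)).trans ?_
      gcongr
      · exact a.norm_coe_le_norm t
      · exact h.norm_coe_le_norm t)

theorem familyApply_apply (ev : G →L[ℝ] E →L[ℝ] F) (a : C(K, G)) (h : C(K, E)) (t : K) :
    familyApply K ev a h t = ev (a t) (h t) := rfl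

/-- The first order expansion of `f` at `γ t` is made uniform in `t`: continuity of composition with
`f'` on the space of curves controls the oscillation of `f'` along the whole curve at once, and the
mean value inequality concludes. -/
theorem hasFDerivAt_postcomp (ev : G →L[ℝ] E →L[ℝ] F)
    (f : C(E, F)) (f' : C(E, G)) (hf : ∀ x, HasFDerivAt f (ev (f' x)) x) (γ : C(K, E)) :
    HasFDerivAt (fun γ : C(K, E) => f.comp γ) (familyApply K ev (f'.comp γ)) γ := by
  rw [hasFDerivAt_iff_isLittleO_nhds_zero, Asymptotics.isLittleO_iff]
  intro ε hε
  have hc : Continuous fun γ : C(K, E) => f'.comp γ := ContinuousMap.continuous_postcomp f'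
  obtain ⟨δ, hδ, hδ'⟩ := Metric.continuousAt_iff.1 (hc.continuousAt (x := γ)) (ε / (‖ev‖ + 1))
    (by positivity)
  filter_upwards [Metric.ball_mem_nhds (0 : C(K, E)) hδ] with h hh
  rw [mem_ball_zero_iff] at hh
  refine (ContinuousMap.norm_le _ (by positivity)).2 fun t => ?_
  have key : ∀ y ∈ Metric.ball (γ t) δ, ‖ev (f' y) - ev (f' (γ t))‖ ≤ ε := by
    intro y hy
    -- Translating the whole curve by `y - γ t` makes it pass through `y` at time `t` while staying
    -- uniformly `δ`-close to `γ`.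
    have h1 : dist (γ + ContinuousMap.const K (y - γ t)) γ < δ := by
      rw [dist_eq_norm, add_sub_cancel_left]
      refine (ContinuousMap.norm_lt_iff _ hδ).2 fun s => ?_
      simpa using mem_ball_iff_norm.1 hy
    have h2 := hδ' h1
    rw [dist_eq_norm] at h2
    have h3 := (ContinuousMap.norm_coe_le_norm
      (f'.comp (γ + ContinuousMap.const K (y - γ t)) - f'.comp γ) t).trans h2.le
    have h5 : ‖f' y - f' (γ t)‖ ≤ ε / (‖ev‖ + 1) := by simpa using h3
    rw [← map_sub]
    refine (ev.le_opNorm _).trans ?_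
    calc ‖ev‖ * ‖f' y - f' (γ t)‖ ≤ (‖ev‖ + 1) * (ε / (‖ev‖ + 1)) := by gcongr; linarith
      _ = ε := by field_simp
  have hmv := (convex_ball (γ t) δ).norm_image_sub_le_of_norm_hasFDerivWithin_le'
    (f := f) (f' := fun y => ev (f' y)) (φ := ev (f' (γ t))) (C := ε)
    (fun y _ => (hf y).hasFDerivWithinAt) key (x := γ t) (y := γ t + h t)
    (Metric.mem_ball_self hδ) (by
      simpa [mem_ball_iff_norm] using (h.norm_coe_le_norm t).trans_lt hh)
  have h4 : ‖f (γ t + h t) - f (γ t) - ev (f' (γ t)) (h t)‖ ≤ ε * ‖h t‖ := by simpa using hmv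
  refine le_trans ?_ (h4.trans (mul_le_mul_of_nonneg_left (h.norm_coe_le_norm t) hε.le))
  simp [familyApply_apply]

theorem contDiff_succ_postcomp {n : ℕ} (ev : G →L[ℝ] E →L[ℝ] F)
    (f : C(E, F)) (f' : C(E, G)) (hf : ∀ x, HasFDerivAt f (ev (f' x)) x)
    (hf' : ContDiff ℝ n (fun γ : C(K, E) => f'.comp γ)) :
    ContDiff ℝ (n + 1 : ℕ) (fun γ : C(K, E) => f.comp γ) := by
  push_cast
  rw [contDiff_succ_iff_hasFDerivAt]
  exact ⟨fun γ => familyApply K ev (f'.comp γ), (familyApply K ev).contDiff.comp hf',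
    fun γ => hasFDerivAt_postcomp ev f f' hf γ⟩

/-- Induction on `n`: the derivative of composition with `f` is composition with `fderiv ℝ f`
followed by a bounded linear map. The target must vary in the induction, since `fderiv ℝ f` takes
values in `E →L[ℝ] F`. -/
theorem contDiff_postcomp (n : ℕ) : ∀ {F : Type u}
    [NormedAddCommGroup F] [NormedSpace ℝ F] (f : C(E, F)), ContDiff ℝ n f →
      ContDiff ℝ n (fun γ : C(K, E) => f.comp γ) := by
  induction n with
  | zero =>
    intro F _ _ f _
    exact contDiff_zero.2 (ContinuousMap.continuous_postcomp f)
  | succ n ih =>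
    intro F _ _ f hf
    have hf1 : ContDiff ℝ n (fderiv ℝ f) := hf.fderiv_right (by norm_cast)
    have hd : Differentiable ℝ f := hf.differentiable (by norm_cast)
    exact contDiff_succ_postcomp (ContinuousLinearMap.id ℝ (E →L[ℝ] F)) f
      ⟨fderiv ℝ f, hf1.continuous⟩ (fun x => (hd x).hasFDerivAt) (ih _ hf1)

end Postcomp

/-- The primitive vanishing at `0` of a continuous function on `[-1, 1]`. -/
noncomputable def primitive (E : Type*) [NormedAddCommGroup E] [NormedSpace ℝ E] :
    C(Icc (-1 : ℝ) 1, E) →L[ℝ] C(Icc (-1 : ℝ) 1, E) :=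
  LinearMap.mkContinuous
    { toFun := fun γ => ⟨fun s => ∫ r in (0 : ℝ)..s,
          IccExtend (by norm_num : (-1 : ℝ) ≤ 1) γ r, by
        have : Continuous fun s : ℝ => ∫ r in (0 : ℝ)..s,
            IccExtend (by norm_num : (-1 : ℝ) ≤ 1) γ r :=
          intervalIntegral.continuous_primitive
            (fun a b => (γ.continuous.Icc_extend').intervalIntegrable a b) 0
        exact this.comp continuous_subtype_val⟩
      map_add' := fun a b => by
        ext s
        exact intervalIntegral.integral_add (a.continuous.Icc_extend'.intervalIntegrable _ _)
          (b.continuous.Icc_extend'.intervalIntegrable _ _)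
      map_smul' := fun r a => by
        ext s
        exact intervalIntegral.integral_smul r _ }
    1 (fun γ => by
      rw [one_mul]
      refine (ContinuousMap.norm_le _ (norm_nonneg _)).2 fun s => ?_
      refine (intervalIntegral.norm_integral_le_of_norm_le_const (C := ‖γ‖)
        fun r _ => γ.norm_coe_le_norm _).trans ?_
      have : |(s : ℝ) - 0| ≤ 1 := by
        rw [sub_zero]; exact abs_le.2 s.2
      exact mul_le_of_le_one_right (norm_nonneg _) this)

theorem hasDerivAt_primitive {E : Type*} [NormedAddCommGroup E] [NormedSpace ℝ E]
    [CompleteSpace E] (γ : C(Icc (-1 : ℝ) 1, E)) (s : ℝ) (hs : s ∈ Ioo (-1 : ℝ) 1) :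
    HasDerivAt (IccExtend (by norm_num : (-1 : ℝ) ≤ 1) (primitive E γ))
      (γ ⟨s, Ioo_subset_Icc_self hs⟩) s := by
  have h1 : HasDerivAt (fun s : ℝ => ∫ r in (0 : ℝ)..s,
      IccExtend (by norm_num : (-1 : ℝ) ≤ 1) γ r)
      (IccExtend (by norm_num : (-1 : ℝ) ≤ 1) γ s) s :=
    intervalIntegral.integral_hasDerivAt_right (γ.continuous.Icc_extend'.intervalIntegrable _ _)
      (γ.continuous.Icc_extend'.stronglyMeasurableAtFilter _ _) γ.continuous.Icc_extend'.continuousAt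
  rw [IccExtend_of_mem _ _ (Ioo_subset_Icc_self hs)] at h1
  refine h1.congr_of_eventuallyEq ?_
  filter_upwards [Ioo_mem_nhds hs.1 hs.2] with r hr
  rw [IccExtend_of_mem _ _ (Ioo_subset_Icc_self hr)]
  rfl

theorem primitive_zero {E : Type*} [NormedAddCommGroup E] [NormedSpace ℝ E]
    (γ : C(Icc (-1 : ℝ) 1, E)) : primitive E γ ⟨0, by norm_num⟩ = 0 :=
  intervalIntegral.integral_same

/-- Local solutions of a smooth autonomous equation depend smoothly on the initial value. -/
theorem exists_local_flow {E : Type u} [NormedAddCommGroup E] [NormedSpace ℝ E]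
    [FiniteDimensional ℝ E] {f : E → E} {U : Set E} (hU : IsOpen U) (hf : ContDiffOn ℝ ∞ f U)
    {x₀ : E} (hx₀ : x₀ ∈ U) (n : ℕ) :
    ∃ δ > 0, ∃ W : Set E, IsOpen W ∧ x₀ ∈ W ∧ ∃ Φ : E → ℝ → E,
      (∀ x ∈ W, Φ x 0 = x ∧ ∀ t ∈ Ioo (-δ) δ, Φ x t ∈ U ∧ HasDerivAt (Φ x) (f (Φ x t)) t) ∧
      ∀ t ∈ Ioo (-δ) δ, ContDiffOn ℝ n (fun x => Φ x t) W := by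
  have : CompleteSpace E := FiniteDimensional.complete ℝ E
  obtain ⟨R, hR, hRU⟩ := Metric.isOpen_iff.1 hU x₀ hx₀
  let ρ : ContDiffBump x₀ := ⟨R / 4, R / 2, by positivity, by linarith⟩
  have hρU : tsupport ρ ⊆ U := by
    rw [ρ.tsupport_eq]
    exact (Metric.closedBall_subset_ball (by change R / 2 < R; linarith)).trans hRU
  -- One more derivative than requested, because the inverse function theorem needs `C^1` and `n`
  -- may be 0. The bump function makes the field globally defined without changing it near `x₀`.
  have hg : ContDiff ℝ (n + 1 : ℕ) fun x => ρ x • f x := by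
    rw [contDiff_iff_contDiffAt]
    intro x
    by_cases hx : x ∈ U
    · exact ρ.contDiffAt.smul ((hf.contDiffAt (hU.mem_nhds hx)).of_le (mod_cast le_top))
    · have hx' : x ∉ tsupport ρ := fun h => hx (hρU h)
      refine contDiffAt_const (c := (0 : E)) |>.congr_of_eventuallyEq ?_
      filter_upwards [notMem_tsupport_iff_eventuallyEq.1 hx'] with y hy
      simp [hy]
  have hgf : ∀ x ∈ Metric.ball x₀ (R / 4), ρ x • f x = f x := fun x hx => by
    rw [ρ.one_of_mem_closedBall (Metric.ball_subset_closedBall hx), one_smul]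
  let g : C(E, E) := ⟨fun x => ρ x • f x, hg.continuous⟩
  let c₀ : C(Icc (-1 : ℝ) 1, E) := ContinuousMap.const _ x₀
  let constL : E →L[ℝ] C(Icc (-1 : ℝ) 1, E) := ContinuousLinearMap.const ℝ _
  -- The last component vanishes exactly when `γ = x + τ ∫₀ g(γ)`, the integral equation with time
  -- scaled by `τ`. Carrying `(x, τ)` along turns the implicit function theorem into the inverse
  -- function theorem.
  let Ψ : (E × ℝ) × C(Icc (-1 : ℝ) 1, E) → (E × ℝ) × C(Icc (-1 : ℝ) 1, E) := fun p =>
    (p.1, p.2 - constL p.1.1 - p.1.2 • primitive E (g.comp p.2))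
  have hΨ : ContDiff ℝ (n + 1 : ℕ) Ψ := by
    have hN : ContDiff ℝ (n + 1 : ℕ) fun γ : C(Icc (-1 : ℝ) 1, E) => g.comp γ :=
      contDiff_postcomp _ g hg
    have hN' : ContDiff ℝ (n + 1 : ℕ) fun p : (E × ℝ) × C(Icc (-1 : ℝ) 1, E) =>
        primitive E (g.comp p.2) := (primitive E).contDiff.comp (hN.comp contDiff_snd)
    have hc : ContDiff ℝ (n + 1 : ℕ) fun p : (E × ℝ) × C(Icc (-1 : ℝ) 1, E) =>
        constL p.1.1 := constL.contDiff.comp (contDiff_fst.comp contDiff_fst)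
    exact contDiff_fst.prodMk ((contDiff_snd.sub hc).sub
      ((contDiff_snd.comp contDiff_fst).smul hN'))
  let u₀ : (E × ℝ) × C(Icc (-1 : ℝ) 1, E) := ((x₀, 0), c₀)
  have hN₀ : HasFDerivAt (fun p : (E × ℝ) × C(Icc (-1 : ℝ) 1, E) => g.comp p.2)
      (fderiv ℝ (fun p : (E × ℝ) × C(Icc (-1 : ℝ) 1, E) => g.comp p.2) u₀) u₀ :=
    (((contDiff_postcomp _ g hg).comp contDiff_snd).differentiable (by norm_cast)
      u₀).hasFDerivAt
  let b : E × ℝ →L[ℝ] C(Icc (-1 : ℝ) 1, E) :=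
    constL.comp (ContinuousLinearMap.fst ℝ E ℝ) +
      (ContinuousLinearMap.snd ℝ E ℝ).smulRight (primitive E (g.comp c₀))
  -- At `τ = 0` the nonlinear term contributes nothing to the derivative in `γ`, so the differential
  -- is triangular with identity diagonal and has an explicit inverse.
  let T : ((E × ℝ) × C(Icc (-1 : ℝ) 1, E)) ≃L[ℝ] (E × ℝ) × C(Icc (-1 : ℝ) 1, E) :=
    ContinuousLinearEquiv.equivOfInverse
      ((ContinuousLinearMap.fst ℝ _ _).prod
        (ContinuousLinearMap.snd ℝ _ _ - b.comp (ContinuousLinearMap.fst ℝ _ _)))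
      ((ContinuousLinearMap.fst ℝ _ _).prod
        (ContinuousLinearMap.snd ℝ _ _ + b.comp (ContinuousLinearMap.fst ℝ _ _)))
      (fun p => by simp) (fun p => by simp)
  have hT : HasFDerivAt Ψ (T : _ →L[ℝ] _) u₀ := by
    have h1 : HasFDerivAt (fun p : (E × ℝ) × C(Icc (-1 : ℝ) 1, E) => constL p.1.1)
        (constL.comp ((ContinuousLinearMap.fst ℝ E ℝ).comp (ContinuousLinearMap.fst ℝ _ _))) u₀ :=
      ContinuousLinearMap.hasFDerivAt
        (constL.comp ((ContinuousLinearMap.fst ℝ E ℝ).comp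
          (ContinuousLinearMap.fst ℝ (E × ℝ) C(Icc (-1 : ℝ) 1, E))))
    have h2 : HasFDerivAt (fun p : (E × ℝ) × C(Icc (-1 : ℝ) 1, E) => p.1.2)
        ((ContinuousLinearMap.snd ℝ E ℝ).comp (ContinuousLinearMap.fst ℝ _ _)) u₀ :=
      ContinuousLinearMap.hasFDerivAt
        ((ContinuousLinearMap.snd ℝ E ℝ).comp
          (ContinuousLinearMap.fst ℝ (E × ℝ) C(Icc (-1 : ℝ) 1, E)))
    have h3 := h2.smul ((primitive E).hasFDerivAt.comp u₀ hN₀)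
    have h4 := hasFDerivAt_fst.prodMk
      (((hasFDerivAt_snd (𝕜 := ℝ) (p := u₀)).sub h1).sub h3)
    refine h4.congr_fderiv ?_
    ext p <;> simp [T, b, u₀, sub_sub]
  let Θ := hΨ.contDiffAt.localInverse hT (by norm_cast)
  have hΨ₀ : Ψ u₀ = ((x₀, 0), 0) := by
    ext p <;> simp [Ψ, u₀, constL, c₀]
  have hΘ : ContDiffAt ℝ (n + 1 : ℕ) Θ ((x₀, 0), 0) := by
    rw [← hΨ₀]
    exact hΨ.contDiffAt.to_localInverse hT (by norm_cast)
  have hΘ₀ : Θ ((x₀, 0), 0) = u₀ := by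
    rw [← hΨ₀]
    exact ContDiffAt.localInverse_apply_image _ hT _
  have hΨΘ : ∀ᶠ q in 𝓝 (((x₀, 0), 0) : (E × ℝ) × C(Icc (-1 : ℝ) 1, E)), Ψ (Θ q) = q := by
    rw [← hΨ₀]
    exact (hΨ.contDiffAt.hasStrictFDerivAt' hT (by norm_cast)).eventually_right_inverse
  let γ : E → ℝ → C(Icc (-1 : ℝ) 1, E) := fun x τ => (Θ ((x, τ), 0)).2
  let j : E × ℝ → (E × ℝ) × C(Icc (-1 : ℝ) 1, E) := fun q => (q, 0)
  have hj : ContDiff ℝ (n + 1 : ℕ) j := contDiff_id.prodMk contDiff_const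
  have hγ : ContDiffAt ℝ (n + 1 : ℕ) (fun q : E × ℝ => γ q.1 q.2) (x₀, 0) :=
    contDiffAt_snd.comp (x₀, (0 : ℝ))
      (ContDiffAt.comp (f := j) (x₀, (0 : ℝ)) hΘ hj.contDiffAt)
  have hγ₀ : γ x₀ 0 = c₀ := congrArg Prod.snd hΘ₀
  have e1 : ∀ᶠ q in 𝓝 (x₀, (0 : ℝ)), γ q.1 q.2 ∈ Metric.ball c₀ (R / 4) := by
    have := hγ.continuousAt
    refine this.eventually_mem (Metric.isOpen_ball.mem_nhds ?_)
    change γ x₀ 0 ∈ _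
    rw [hγ₀]
    exact Metric.mem_ball_self (by positivity)
  have e2 : ∀ᶠ q in 𝓝 (x₀, (0 : ℝ)), ContDiffAt ℝ n (fun q : E × ℝ => γ q.1 q.2) q :=
    (hγ.of_le (by norm_cast; omega)).eventually (by simp)
  have e3 : ∀ᶠ q in 𝓝 (x₀, (0 : ℝ)), Ψ (Θ (j q)) = j q :=
    (hj.continuous.tendsto (x₀, (0 : ℝ))).eventually hΨΘ
  obtain ⟨r, hr, hball⟩ := Metric.eventually_nhds_iff_ball.1 (e1.and (e2.and e3))
  -- The scale is now frozen at `τ = r / 2 > 0`; substituting `t / τ` converts the curves on `[-1,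
  -- 1]` into integral curves on `(-τ, τ)`.
  have hmem : ∀ x ∈ Metric.ball x₀ r, (x, r / 2) ∈ Metric.ball (x₀, (0 : ℝ)) r := by
    intro x hx
    rw [Metric.mem_ball, Prod.dist_eq, max_lt_iff]
    refine ⟨hx, ?_⟩
    rw [Real.dist_eq, sub_zero, abs_of_pos (by positivity)]
    linarith
  have hfix : ∀ x ∈ Metric.ball x₀ r, γ x (r / 2) =
      constL x + (r / 2) • primitive E (g.comp (γ x (r / 2))) := by
    intro x hx
    have h := (hball _ (hmem x hx)).2.2
    have h1 : (Θ (j (x, r / 2))).1 = (x, r / 2) := congrArg Prod.fst h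
    have h2 : γ x (r / 2) - constL (Θ (j (x, r / 2))).1.1 -
      (Θ (j (x, r / 2))).1.2 • primitive E (g.comp (γ x (r / 2))) = 0 := congrArg Prod.snd h
    rw [h1, sub_sub, sub_eq_zero] at h2
    exact h2
  have hI : (-1 : ℝ) ≤ 1 := by norm_num
  have hdiv : ∀ t ∈ Ioo (-(r / 2)) (r / 2), t / (r / 2) ∈ Ioo (-1 : ℝ) 1 := by
    intro t ht
    constructor
    · rw [lt_div_iff₀ (by positivity)]; linarith [ht.1]
    · rw [div_lt_iff₀ (by positivity)]; linarith [ht.2]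
  refine ⟨r / 2, by positivity, Metric.ball x₀ r, Metric.isOpen_ball, Metric.mem_ball_self hr,
    fun x t => IccExtend hI (γ x (r / 2)) (t / (r / 2)), fun x hx => ⟨?_, fun t ht => ?_⟩,
    fun t ht x hx => ?_⟩
  · beta_reduce
    rw [zero_div, IccExtend_of_mem _ _ (by norm_num : (0 : ℝ) ∈ Icc (-1 : ℝ) 1), hfix x hx]
    simp [primitive_zero, constL]
  · have ht' := hdiv t ht
    -- The solution stays in the ball where the bump function is 1, hence solves the original
    -- equation.
    have hin : γ x (r / 2) ⟨t / (r / 2), Ioo_subset_Icc_self ht'⟩ ∈ Metric.ball x₀ (R / 4) := by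
      have h := (hball _ (hmem x hx)).1
      rw [mem_ball_iff_norm] at h ⊢
      exact ((γ x (r / 2) - c₀).norm_coe_le_norm _).trans_lt h
    have hval : IccExtend hI (γ x (r / 2)) (t / (r / 2)) =
      γ x (r / 2) ⟨t / (r / 2), Ioo_subset_Icc_self ht'⟩ := IccExtend_of_mem _ _ _
    refine ⟨?_, ?_⟩
    · beta_reduce
      rw [hval]
      exact hRU (Metric.ball_subset_ball (by linarith) hin)
    · have hd := (hasDerivAt_primitive (g.comp (γ x (r / 2))) _ ht').scomp t
        ((hasDerivAt_id t).div_const (r / 2))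
      have hd2 := (hd.const_smul (r / 2)).const_add x
      have hgv : (g.comp (γ x (r / 2))) ⟨t / (r / 2), Ioo_subset_Icc_self ht'⟩ =
          f (IccExtend hI (γ x (r / 2)) (t / (r / 2))) := by
        rw [hval]
        exact hgf _ hin
      rw [hgv, smul_smul, mul_one_div_cancel (by positivity), one_smul] at hd2
      refine hd2.congr_of_eventuallyEq ?_
      filter_upwards [Ioo_mem_nhds ht.1 ht.2] with s hs
      have hs' := Ioo_subset_Icc_self (hdiv s hs)
      simp only [Function.comp, id, Pi.smul_apply]
      rw [IccExtend_of_mem _ _ hs', IccExtend_of_mem _ _ hs']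
      conv_lhs => rw [hfix x hx]
      simp [constL]
  · have h := (hball _ (hmem x hx)).2.1
    have h1 : ContDiffAt ℝ n (fun y : E => γ y (r / 2)) x :=
      ContDiffAt.comp (f := fun y : E => (y, r / 2)) x h (contDiffAt_id.prodMk contDiffAt_const)
    have h2 := (ContinuousMap.evalCLM ℝ
      (⟨t / (r / 2), Ioo_subset_Icc_self (hdiv t ht)⟩ : Icc (-1 : ℝ) 1)).contDiff.contDiffAt.comp x
        h1 (n := n) (𝕜 := ℝ)
    refine (h2.congr_of_eventuallyEq (.of_forall fun y => ?_)).contDiffWithinAt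
    exact IccExtend_of_mem _ _ _

end SmoothFlow

/-! ### Differential calculus in the Schur powers -/

section SchurCalculus

variable {lam mu : YoungDiagram}
variable {V W Z : Type*} [NormedAddCommGroup V] [NormedSpace ℝ V] [NormedAddCommGroup W]
  [NormedSpace ℝ W] [NormedAddCommGroup Z] [NormedSpace ℝ Z]

theorem schur_ext {w w' : Schur lam mu V} (h : ∀ θ v, w.1 θ v = w'.1 θ v) : w = w' :=
  Subtype.ext (ContinuousMultilinearMap.ext fun θ => ContinuousMultilinearMap.ext fun v => h θ v)

theorem schurMap_apply (P : V →L[ℝ] W) (Q : W →L[ℝ] V) (w : Schur lam mu V)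
    (θ : Cells lam → StrongDual ℝ W) (v : Cells mu → W) :
    (schurMap P Q w).1 θ v = w.1 (fun c => (θ c).comp P) (fun c => Q (v c)) := rfl

theorem schurAct_apply (a : V →L[ℝ] V) (w : Schur lam mu V) (θ : Cells lam → StrongDual ℝ V)
    (v : Cells mu → V) :
    (schurAct a w).1 θ v = ∑ c, w.1 (Function.update θ c ((θ c).comp a)) v -
      ∑ c, w.1 θ (Function.update v c (a (v c))) := tensAct_apply a w.1 θ v

/-- Naturality of the derivation action. The relation `Q P = 1` is what matches the modified slot on
the two sides. -/
theorem schurMap_schurAct {P : V →L[ℝ] W} {Q : W →L[ℝ] V} (h : ∀ v, Q (P v) = v) (a : V →L[ℝ] V)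
    (w : Schur lam mu V) :
    schurMap P Q (schurAct a w) = schurAct ((P.comp a).comp Q) (schurMap P Q w) := by
  refine schur_ext fun θ v => ?_
  rw [schurMap_apply, schurAct_apply, schurAct_apply]
  congr 1
  · refine Finset.sum_congr rfl fun c _ => ?_
    rw [schurMap_apply]
    congr 2
    funext d
    by_cases hd : d = c
    · subst hd
      ext x
      simp [h]
    · simp [hd]
  · refine Finset.sum_congr rfl fun c _ => ?_
    rw [schurMap_apply]
    congr 1
    funext d
    by_cases hd : d = c
    · subst hd
      simp [h]
    · simp [hd]

theorem schurAct_add (a b : V →L[ℝ] V) (w : Schur lam mu V) :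
    schurAct (a + b) w = schurAct a w + schurAct b w := Subtype.ext (tensAct_add a b w.1)

theorem schurAct_smul (r : ℝ) (a : V →L[ℝ] V) (w : Schur lam mu V) :
    schurAct (r • a) w = r • schurAct a w := Subtype.ext (tensAct_smul r a w.1)

variable (lam mu V) in
/-- Evaluation of a tensor at all families of elements of fixed bases. -/
noncomputable def schurCoord [FiniteDimensional ℝ V] : Schur lam mu V →ₗ[ℝ]
    ((Cells lam → Fin (Module.finrank ℝ (StrongDual ℝ V))) ×
      (Cells mu → Fin (Module.finrank ℝ V)) → ℂ) where
  toFun w i := w.1 (fun c => Module.finBasis ℝ (StrongDual ℝ V) (i.1 c))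
    (fun c => Module.finBasis ℝ V (i.2 c))
  map_add' _ _ := rfl
  map_smul' _ _ := rfl

theorem schurCoord_injective [FiniteDimensional ℝ V] :
    Function.Injective (schurCoord lam mu V) := by
  intro w w' h
  refine Subtype.ext (ContinuousMultilinearMap.toMultilinearMap_injective ?_)
  refine Module.Basis.ext_multilinear (fun _ => Module.finBasis ℝ (StrongDual ℝ V)) fun i => ?_
  refine ContinuousMultilinearMap.toMultilinearMap_injective ?_
  refine Module.Basis.ext_multilinear (fun _ => Module.finBasis ℝ V) fun j => ?_
  exact congrFun h (i, j)

instance [FiniteDimensional ℝ V] : FiniteDimensional ℝ (Schur lam mu V) :=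
  Module.Finite.of_injective (schurCoord lam mu V) schurCoord_injective

/-- Allows smoothness and derivatives of tensor-valued maps to be tested on scalar values at fixed
arguments. -/
theorem exists_schurCoord_leftInverse [FiniteDimensional ℝ V] :
    ∃ L : ((Cells lam → Fin (Module.finrank ℝ (StrongDual ℝ V))) ×
      (Cells mu → Fin (Module.finrank ℝ V)) → ℂ) →L[ℝ] Schur lam mu V,
      ∀ w, L (schurCoord lam mu V w) = w := by
  obtain ⟨g, hg⟩ := LinearMap.exists_leftInverse_of_injective (schurCoord lam mu V)
    (LinearMap.ker_eq_bot.2 schurCoord_injective)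
  exact ⟨LinearMap.toContinuousLinearMap g, fun w => LinearMap.congr_fun hg w⟩

theorem contDiffAt_schur [FiniteDimensional ℝ V] {E : Type*} [NormedAddCommGroup E]
    [NormedSpace ℝ E] {n : WithTop ℕ∞} {f : E → Schur lam mu V} {x : E}
    (h : ∀ θ v, ContDiffAt ℝ n (fun y => (f y).1 θ v) x) : ContDiffAt ℝ n f x := by
  obtain ⟨L, hL⟩ := exists_schurCoord_leftInverse (lam := lam) (mu := mu) (V := V)
  have h1 : ContDiffAt ℝ n (fun y => schurCoord lam mu V (f y)) x :=
    contDiffAt_pi.2 fun i => h _ _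
  exact (L.contDiff.contDiffAt.comp x h1).congr_of_eventuallyEq
    (.of_forall fun y => (hL (f y)).symm)

theorem hasDerivWithinAt_schur [FiniteDimensional ℝ V] {f : ℝ → Schur lam mu V}
    {f' : Schur lam mu V} {s : Set ℝ} {t : ℝ}
    (h : ∀ θ v, HasDerivWithinAt (fun r => (f r).1 θ v) (f'.1 θ v) s t) :
    HasDerivWithinAt f f' s t := by
  obtain ⟨L, hL⟩ := exists_schurCoord_leftInverse (lam := lam) (mu := mu) (V := V)
  have h1 : HasDerivWithinAt (fun r => schurCoord lam mu V (f r)) (schurCoord lam mu V f') s t :=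
    hasDerivWithinAt_pi.2 fun i => h _ _
  have h2 := L.hasFDerivAt.comp_hasDerivWithinAt t h1
  rw [hL] at h2
  exact h2.congr (fun y _ => (hL (f y)).symm) (hL (f t)).symm

theorem contDiff_multilinear_apply {ι : Type*} [Fintype ι] {G : Type*} [NormedAddCommGroup G]
    [NormedSpace ℝ G] :
    ContDiff ℝ ∞ fun p : ContinuousMultilinearMap ℝ (fun _ : ι => V) G × (ι → V) => p.1 p.2 :=
  ((ContinuousLinearMap.id ℝ
    (ContinuousMultilinearMap ℝ (fun _ : ι => V) G)).continuousMultilinearMapOption.contDiff).comp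
    (contDiff_pi.2 fun _ => contDiff_id)

theorem contDiff_schurMap [FiniteDimensional ℝ V] [FiniteDimensional ℝ W] :
    ContDiff ℝ ∞ (fun p : (V →L[ℝ] W) × (W →L[ℝ] V) =>
      (schurMap p.1 p.2 : Schur lam mu V →L[ℝ] Schur lam mu W)) := by
  rw [contDiff_clm_apply_iff]
  intro w
  rw [contDiff_iff_contDiffAt]
  intro p
  refine contDiffAt_schur fun θ v => ?_
  change ContDiffAt ℝ ∞ (fun p : (V →L[ℝ] W) × (W →L[ℝ] V) =>
    w.1 (fun c => (θ c).comp p.1) (fun c => p.2 (v c))) p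
  have h1 : ContDiff ℝ ∞ fun p : (V →L[ℝ] W) × (W →L[ℝ] V) => w.1 fun c => (θ c).comp p.1 :=
    w.1.contDiff.comp (contDiff_pi.2 fun c =>
      (ContinuousLinearMap.compL ℝ V W ℝ (θ c)).contDiff.comp contDiff_fst)
  have h2 : ContDiff ℝ ∞ fun p : (V →L[ℝ] W) × (W →L[ℝ] V) => fun c => p.2 (v c) :=
    contDiff_pi.2 fun c => contDiff_snd.clm_apply contDiff_const
  exact (contDiff_multilinear_apply.comp (h1.prodMk h2)).contDiffAt

/-- Product rule over all slots. The condition on `Q'` says that `Q` varies as the inverse of `P`,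
so contravariant and covariant slots combine into one derivation, that of the infinitesimal change
of frame `P' Q`. -/
theorem hasDerivWithinAt_schurMap [FiniteDimensional ℝ V] [FiniteDimensional ℝ W]
    {P : ℝ → V →L[ℝ] W} {Q : ℝ → W →L[ℝ] V} {S : ℝ → Schur lam mu V}
    {P' : V →L[ℝ] W} {Q' : W →L[ℝ] V} {S' : Schur lam mu V} {s : Set ℝ} {t : ℝ}
    (hP : HasDerivWithinAt P P' s t) (hQ : HasDerivWithinAt Q Q' s t)
    (hS : HasDerivWithinAt S S' s t) (hQP : ∀ v, Q t (P t v) = v)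
    (hQ' : ∀ w, Q' w = - Q t (P' (Q t w))) :
    HasDerivWithinAt (fun r => schurMap (P r) (Q r) (S r))
      (schurAct (P'.comp (Q t)) (schurMap (P t) (Q t) (S t)) + schurMap (P t) (Q t) S') s t := by
  refine hasDerivWithinAt_schur fun θ v => ?_
  change HasDerivWithinAt (fun r => (S r).1 (fun c => (θ c).comp (P r)) (fun c => Q r (v c))) _ s t
  have hP1 : ∀ c, HasFDerivWithinAt (fun r => (θ c).comp (P r))
      (ContinuousLinearMap.toSpanSingleton ℝ ((θ c).comp P')) s t := fun c =>
    ((ContinuousLinearMap.compL ℝ V W ℝ (θ c)).hasFDerivAt.comp_hasDerivWithinAt t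
      hP).hasFDerivWithinAt
  have hQ1 : ∀ c, HasFDerivWithinAt (fun r => Q r (v c))
      (ContinuousLinearMap.toSpanSingleton ℝ (Q' (v c))) s t := fun c => by
    simpa using (hQ.clm_apply (hasDerivWithinAt_const t s (v c))).hasFDerivWithinAt
  have hS1 : HasFDerivWithinAt (fun r => (S r).1)
      (ContinuousLinearMap.toSpanSingleton ℝ S'.1) s t :=
    ((((schur lam mu V).restrictScalars ℝ).subtypeL).hasFDerivAt.comp_hasDerivWithinAt t
      hS).hasFDerivWithinAt
  have h1 := (hS1.continuousMultilinearMap_apply hP1).continuousMultilinearMap_apply hQ1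
  refine h1.hasDerivWithinAt.congr_deriv ?_
  change _ = (schurAct (P'.comp (Q t)) (schurMap (P t) (Q t) (S t))).1 θ v +
    (schurMap (P t) (Q t) S').1 θ v
  rw [schurAct_apply, schurMap_apply]
  simp only [schurMap_apply]
  have e1 : ∀ c, (S t).1 (fun d => (Function.update θ c ((θ c).comp (P'.comp (Q t))) d).comp (P t))
      (fun d => Q t (v d)) = (S t).1 (Function.update (fun d => (θ d).comp (P t)) c
        ((θ c).comp P')) (fun d => Q t (v d)) := fun c => by
    congr 2
    funext d
    by_cases hd : d = c
    · subst hd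
      ext x
      simp [hQP]
    · simp [hd]
  have e2 : ∀ c, (S t).1 (fun d => (θ d).comp (P t))
      (fun d => Q t (Function.update v c (P'.comp (Q t) (v c)) d)) =
      - (S t).1 (fun d => (θ d).comp (P t)) (Function.update (fun d => Q t (v d)) c
        (Q' (v c))) := fun c => by
    have h := ((S t).1 fun d => (θ d).comp (P t)).map_update_smul (fun d => Q t (v d)) c (-1 : ℝ)
      (Q t (P' (Q t (v c))))
    rw [neg_one_smul, neg_one_smul] at h
    rw [hQ', h, neg_neg]
    congr 1
    funext d
    by_cases hd : d = c
    · subst hd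
      simp
    · simp [hd]
  simp only [e1, e2, Finset.sum_neg_distrib, sub_neg_eq_add]
  simp only [_root_.add_apply, _root_.sum_apply, ContinuousLinearMap.comp_apply,
    ContinuousLinearMap.toSpanSingleton_apply, one_smul,
    ContinuousMultilinearMap.toContinuousLinearMap_apply, ContinuousMultilinearMap.apply_apply]
  abel

end SchurCalculus

/-! ### Coordinate changes and their Jacobians -/

section Transition

open Set Filter Topology

variable {H : Type*} [NormedAddCommGroup H] [NormedSpace ℝ H]
variable {X : Type*} [TopologicalSpace X] [ChartedSpace H X]

/-- The coordinate change from the preferred chart at `c` to the preferred chart at `d`. -/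
noncomputable def coordChange (H : Type*) [NormedAddCommGroup H] [NormedSpace ℝ H]
    {X : Type*} [TopologicalSpace X] [ChartedSpace H X] (c d : X) : H → H :=
  extChartAt 𝓘(ℝ, H) d ∘ (extChartAt 𝓘(ℝ, H) c).symm

/-- The domain of the coordinate change. -/
def overlap (H : Type*) [NormedAddCommGroup H] [NormedSpace ℝ H]
    {X : Type*} [TopologicalSpace X] [ChartedSpace H X] (c d : X) : Set H :=
  ((extChartAt 𝓘(ℝ, H) c).symm.trans (extChartAt 𝓘(ℝ, H) d)).source

/-- The derivative of the coordinate change. -/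
noncomputable def jac (H : Type*) [NormedAddCommGroup H] [NormedSpace ℝ H]
    {X : Type*} [TopologicalSpace X] [ChartedSpace H X] (c d : X) (z : H) : H →L[ℝ] H :=
  fderiv ℝ (coordChange H c d) z

theorem mem_overlap {c d : X} {z : H} : z ∈ overlap H c d ↔
    z ∈ (extChartAt 𝓘(ℝ, H) c).target ∧
      (extChartAt 𝓘(ℝ, H) c).symm z ∈ (extChartAt 𝓘(ℝ, H) d).source := by
  simp only [overlap, PartialEquiv.trans_source, PartialEquiv.symm_source, mem_inter_iff,
    mem_preimage]

theorem chart_mem_overlap {c d y : X} (hc : y ∈ (extChartAt 𝓘(ℝ, H) c).source)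
    (hd : y ∈ (extChartAt 𝓘(ℝ, H) d).source) : extChartAt 𝓘(ℝ, H) c y ∈ overlap H c d := by
  rw [mem_overlap, PartialEquiv.left_inv _ hc]
  exact ⟨PartialEquiv.map_source _ hc, hd⟩

theorem coordChange_chart {c d y : X} (hc : y ∈ (extChartAt 𝓘(ℝ, H) c).source) :
    coordChange H c d (extChartAt 𝓘(ℝ, H) c y) = extChartAt 𝓘(ℝ, H) d y := by
  rw [coordChange, Function.comp_apply, PartialEquiv.left_inv _ hc]

theorem isOpen_target (c : X) : IsOpen (extChartAt 𝓘(ℝ, H) c).target :=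
  isOpen_extChartAt_target c

theorem isOpen_overlap (c d : X) : IsOpen (overlap H c d) := by
  have : overlap H c d = (extChartAt 𝓘(ℝ, H) c).target ∩
      (extChartAt 𝓘(ℝ, H) c).symm ⁻¹' (extChartAt 𝓘(ℝ, H) d).source := by
    ext z; exact mem_overlap
  rw [this]
  exact (continuousOn_extChartAt_symm c).isOpen_inter_preimage (isOpen_target c)
    (isOpen_extChartAt_source d)

theorem coordChange_mem_overlap {c d : X} {z : H} (hz : z ∈ overlap H c d) :
    coordChange H c d z ∈ overlap H d c := by
  rw [mem_overlap] at hz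
  exact chart_mem_overlap hz.2 (PartialEquiv.map_target _ hz.1)

theorem coordChange_coordChange {c d : X} {z : H} (hz : z ∈ overlap H c d) :
    coordChange H d c (coordChange H c d z) = z := by
  rw [mem_overlap] at hz
  rw [coordChange, coordChange, Function.comp_apply, Function.comp_apply,
    PartialEquiv.left_inv _ hz.2, PartialEquiv.right_inv _ hz.1]

variable [IsManifold 𝓘(ℝ, H) ∞ X]

theorem contDiffOn_coordChange (c d : X) : ContDiffOn ℝ ∞ (coordChange H c d) (overlap H c d) :=
  contDiffOn_ext_coord_change (I := 𝓘(ℝ, H)) d c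

theorem contDiffOn_jac (c d : X) : ContDiffOn ℝ ∞ (jac H c d) (overlap H c d) :=
  (contDiffOn_coordChange c d).fderiv_of_isOpen (isOpen_overlap c d) (by norm_cast)

theorem hasFDerivAt_coordChange {c d : X} {z : H} (hz : z ∈ overlap H c d) :
    HasFDerivAt (coordChange H c d) (jac H c d z) z :=
  (((contDiffOn_coordChange c d).contDiffAt ((isOpen_overlap c d).mem_nhds hz)).differentiableAt
    (by norm_num)).hasFDerivAt

theorem jac_jac {c d : X} {z : H} (hz : z ∈ overlap H c d) (v : H) :
    jac H d c (coordChange H c d z) (jac H c d z v) = v := by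
  have h1 := (hasFDerivAt_coordChange (coordChange_mem_overlap hz)).comp z
    (hasFDerivAt_coordChange hz)
  have h2 : HasFDerivAt (coordChange H d c ∘ coordChange H c d) (ContinuousLinearMap.id ℝ H) z := by
    refine (hasFDerivAt_id z).congr_of_eventuallyEq ?_
    filter_upwards [(isOpen_overlap c d).mem_nhds hz] with y hy
    exact coordChange_coordChange hy
  exact DFunLike.congr_fun (h1.unique h2) v

theorem jac_jac' {c d : X} {z : H} (hz : z ∈ overlap H c d) (v : H) :
    jac H c d z (jac H d c (coordChange H c d z) v) = v := by
  have h := jac_jac (coordChange_mem_overlap hz) v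
  rwa [coordChange_coordChange hz] at h

theorem toModel_eq {c y : X} (hy : y ∈ (extChartAt 𝓘(ℝ, H) c).source)
    (v : TangentSpace 𝓘(ℝ, H) y) :
    toModel c y v = tangentCoordChange 𝓘(ℝ, H) y c y (by exact v) := by
  rw [extChartAt_source] at hy
  rw [toModel, TangentBundle.continuousLinearMapAt_trivializationAt_eq_core hy]
  rfl

/-- Links the trivializations of the tangent bundle, in which the definitions are phrased, with
derivatives of coordinate changes, which can be differentiated again. -/
theorem toModel_eq_jac {c d y : X} (hc : y ∈ (extChartAt 𝓘(ℝ, H) c).source)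
    (hd : y ∈ (extChartAt 𝓘(ℝ, H) d).source) (v : TangentSpace 𝓘(ℝ, H) y) :
    toModel d y v = jac H c d (extChartAt 𝓘(ℝ, H) c y) (toModel c y v) := by
  have hj : jac H c d (extChartAt 𝓘(ℝ, H) c y) = tangentCoordChange 𝓘(ℝ, H) c d y := by
    rw [tangentCoordChange_def, modelWithCornersSelf_coe, range_id, fderivWithin_univ]
    rfl
  rw [hj]
  refine (toModel_eq hd v).trans ?_
  rw [toModel_eq hc]
  exact (tangentCoordChange_comp ⟨⟨mem_extChartAt_source y, hc⟩, hd⟩).symm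

theorem fromModel_toModel {c y : X} (hy : y ∈ (extChartAt 𝓘(ℝ, H) c).source)
    (v : TangentSpace 𝓘(ℝ, H) y) : fromModel c y (toModel c y v) = v := by
  rw [extChartAt_source] at hy
  exact Bundle.Trivialization.symmL_continuousLinearMapAt _ hy v

theorem toModel_fromModel {c y : X} (hy : y ∈ (extChartAt 𝓘(ℝ, H) c).source) (v : H) :
    toModel c y (fromModel c y v) = v := by
  rw [extChartAt_source] at hy
  exact Bundle.Trivialization.continuousLinearMapAt_symmL _ hy v

theorem fromModel_eq_jac {c d y : X} (hc : y ∈ (extChartAt 𝓘(ℝ, H) c).source)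
    (hd : y ∈ (extChartAt 𝓘(ℝ, H) d).source) (v : H) :
    fromModel c y v = fromModel d y (jac H c d (extChartAt 𝓘(ℝ, H) c y) v) := by
  conv_rhs => rw [← toModel_fromModel hc v, ← toModel_eq_jac hc hd, fromModel_toModel hd]

/-- The chain rule for the chart; it turns the intrinsic equations along a curve into ordinary
differential equations in coordinates. -/
theorem velocity_eq {γ : ℝ → X} {t : ℝ} {c : X}
    (hγ : ContMDiffAt 𝓘(ℝ, ℝ) 𝓘(ℝ, H) ∞ γ t) (hc : γ t ∈ (extChartAt 𝓘(ℝ, H) c).source) :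
    toModel c (γ t) (velocity H γ t) = deriv (fun r => extChartAt 𝓘(ℝ, H) c (γ r)) t := by
  have h1 : MDifferentiableAt 𝓘(ℝ, ℝ) 𝓘(ℝ, H) γ t := hγ.mdifferentiableAt (by norm_num)
  have hc' : γ t ∈ (chartAt H c).source := by rwa [extChartAt_source] at hc
  have h2 : MDifferentiableAt 𝓘(ℝ, H) 𝓘(ℝ, H) (extChartAt 𝓘(ℝ, H) c) (γ t) :=
    mdifferentiableAt_extChartAt hc'
  have h3 := mfderiv_comp t h2 h1
  rw [mfderiv_eq_fderiv] at h3
  have h4 : deriv (fun r => extChartAt 𝓘(ℝ, H) c (γ r)) t =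
      mfderiv 𝓘(ℝ, H) 𝓘(ℝ, H) (extChartAt 𝓘(ℝ, H) c) (γ t) (velocity H γ t) :=
    DFunLike.congr_fun h3 (1 : ℝ)
  have h5 : mfderiv 𝓘(ℝ, H) 𝓘(ℝ, H) (extChartAt 𝓘(ℝ, H) c) (γ t) =
      tangentCoordChange 𝓘(ℝ, H) (γ t) c (γ t) :=
    mfderiv_chartAt_eq_tangentCoordChange hc'
  refine (toModel_eq hc _).trans (Eq.trans ?_ h4.symm)
  exact (DFunLike.congr_fun h5 _).symm

theorem contDiffAt_chart_curve {γ : ℝ → X} {t : ℝ} {c : X}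
    (hγ : ContMDiffAt 𝓘(ℝ, ℝ) 𝓘(ℝ, H) ∞ γ t) (hc : γ t ∈ (extChartAt 𝓘(ℝ, H) c).source) :
    ContDiffAt ℝ ∞ (fun r => extChartAt 𝓘(ℝ, H) c (γ r)) t := by
  have hc' : γ t ∈ (chartAt H c).source := by rwa [extChartAt_source] at hc
  have h2 : ContMDiffAt 𝓘(ℝ, H) 𝓘(ℝ, H) ∞ (extChartAt 𝓘(ℝ, H) c) (γ t) :=
    contMDiffAt_extChartAt' hc'
  exact (h2.comp t hγ).contDiffAt

end Transition

/-! ### Transformation law and smoothness of the Christoffel symbols -/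

section Christoffel

open Set Filter Topology

theorem christoffelLower_apply {H : Type*} [NormedAddCommGroup H] [NormedSpace ℝ H]
    (G : H → H →L[ℝ] H →L[ℝ] ℝ) (z v w y : H) :
    christoffelLower G z v w y =
      1 / 2 * (fderiv ℝ G z v w y + fderiv ℝ G z w v y - fderiv ℝ G z y v w) := by
  simp [christoffelLower]

/-- The change of Christoffel symbols of the first kind under a change of variables. -/
theorem christoffelLower_pullback {H : Type*} [NormedAddCommGroup H] [NormedSpace ℝ H]
    {G G' : H → H →L[ℝ] H →L[ℝ] ℝ} {ψ : H → H} {J : H → H →L[ℝ] H} {D : H →L[ℝ] H →L[ℝ] H} {z : H}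
    (hψ : HasFDerivAt ψ (J z) z) (hJ : HasFDerivAt J D z) (hD : ∀ v w, D v w = D w v)
    (hG : DifferentiableAt ℝ G z) (hG' : DifferentiableAt ℝ G' (ψ z))
    (hsymm : ∀ v w, G' (ψ z) v w = G' (ψ z) w v)
    (h : ∀ᶠ y in 𝓝 z, ∀ v w, G y v w = G' (ψ y) (J y v) (J y w)) (v w y : H) :
    christoffelLower G z v w y =
      christoffelLower G' (ψ z) (J z v) (J z w) (J z y) + G' (ψ z) (D v w) (J z y) := by
  -- Leibniz rule for the pulled-back metric. In the Christoffel combination the symmetry of `D` and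
  -- of `G'` cancels all second order terms except two equal ones, which absorb the factor `1 / 2`.
  have key : ∀ a v w, fderiv ℝ G z a v w = fderiv ℝ G' (ψ z) (J z a) (J z v) (J z w) +
      G' (ψ z) (D a v) (J z w) + G' (ψ z) (J z v) (D a w) := by
    intro a v w
    have h1 := (hG.hasFDerivAt.clm_apply (hasFDerivAt_const v z)).clm_apply
      (hasFDerivAt_const w z)
    have h2 := ((hG'.hasFDerivAt.comp z hψ).clm_apply
      (hJ.clm_apply (hasFDerivAt_const v z))).clm_apply (hJ.clm_apply (hasFDerivAt_const w z))
    have h3 := h1.unique (h2.congr_of_eventuallyEq (h.mono fun y hy => hy v w))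
    have h4 := DFunLike.congr_fun h3 a
    simp at h4
    rw [h4]
    ring
  rw [christoffelLower_apply, christoffelLower_apply, key, key, key, hD w v, hD y v, hD y w,
    hsymm (J z w) (D v y), hsymm (J z v)]
  ring

variable {H : Type*} [NormedAddCommGroup H] [NormedSpace ℝ H]
variable {X : Type*} [TopologicalSpace X] [ChartedSpace H X] [IsManifold 𝓘(ℝ, H) ∞ X]
variable [Bundle.RiemannianBundle (fun x : X => TangentSpace 𝓘(ℝ, H) x)]

theorem metricInChart_apply (c : X) (z v w : H) : metricInChart c z v w =
    inner ℝ (fromModel c ((extChartAt 𝓘(ℝ, H) c).symm z) v)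
      (fromModel c ((extChartAt 𝓘(ℝ, H) c).symm z) w) := rfl

theorem metricInChart_symm (c : X) (z v w : H) :
    metricInChart c z v w = metricInChart c z w v := by
  rw [metricInChart_apply, metricInChart_apply, real_inner_comm]

theorem metricInChart_eq_zero {c : X} {z : H} (hz : z ∈ (extChartAt 𝓘(ℝ, H) c).target) {v : H}
    (h : metricInChart c z v v = 0) : v = 0 := by
  rw [metricInChart_apply, inner_self_eq_zero] at h
  rw [← toModel_fromModel (PartialEquiv.map_target _ hz) v, h, map_zero]

theorem metricInChart_coordChange {c d : X} {z : H} (hz : z ∈ overlap H c d) (v w : H) :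
    metricInChart c z v w =
      metricInChart d (coordChange H c d z) (jac H c d z v) (jac H c d z w) := by
  rw [mem_overlap] at hz
  have e : (extChartAt 𝓘(ℝ, H) d).symm (coordChange H c d z) = (extChartAt 𝓘(ℝ, H) c).symm z :=
    PartialEquiv.left_inv _ hz.2
  have hs := PartialEquiv.map_target _ hz.1
  have hzz := PartialEquiv.right_inv _ hz.1
  rw [metricInChart_apply, metricInChart_apply, e, fromModel_eq_jac hs hz.2 v,
    fromModel_eq_jac hs hz.2 w, hzz]

variable [FiniteDimensional ℝ H]

theorem metricInChart_isInvertible {c : X} {z : H} (hz : z ∈ (extChartAt 𝓘(ℝ, H) c).target) :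
    (metricInChart c z : H →L[ℝ] H →L[ℝ] ℝ).IsInvertible := by
  have hinj : Function.Injective (metricInChart c z) := by
    rw [injective_iff_map_eq_zero]
    intro v hv
    exact metricInChart_eq_zero hz (by rw [hv]; rfl)
  have hfr : Module.finrank ℝ H = Module.finrank ℝ (H →L[ℝ] ℝ) := by
    rw [(LinearMap.toContinuousLinearMap (𝕜 := ℝ) (E := H) (F' := ℝ)).symm.finrank_eq]
    exact (Subspace.dual_finrank_eq (K := ℝ) (V := H)).symm
  refine ⟨(LinearEquiv.ofInjectiveOfFinrankEq
    (metricInChart c z : H →ₗ[ℝ] H →L[ℝ] ℝ) hinj hfr).toContinuousLinearEquiv, ?_⟩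
  rfl

/-- The Christoffel symbols in the preferred chart at `c`. -/
noncomputable def chr (c : X) (z v : H) : H →L[ℝ] H :=
  (metricInChart c z).inverse.comp (christoffelLower (metricInChart c) z v)

theorem metricInChart_chr {c : X} {z : H} (hz : z ∈ (extChartAt 𝓘(ℝ, H) c).target) (v w y : H) :
    metricInChart c z (chr c z v w) y = christoffelLower (metricInChart c) z v w y := by
  rw [chr, ContinuousLinearMap.comp_apply]
  rw [(metricInChart_isInvertible hz).self_apply_inverse]

theorem eq_of_metricInChart {c : X} {z : H} (hz : z ∈ (extChartAt 𝓘(ℝ, H) c).target) {v w : H}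
    (h : ∀ y, metricInChart c z v y = metricInChart c z w y) : v = w := by
  refine sub_eq_zero.1 (metricInChart_eq_zero hz ?_)
  have h1 := h (v - w)
  rw [← sub_eq_zero] at h1
  rw [map_sub (metricInChart c z)]
  exact h1

theorem chr_add (c : X) (z v w : H) : chr c z (v + w) = chr c z v + chr c z w := by
  rw [chr, christoffelLower_add, ContinuousLinearMap.comp_add]
  rfl

theorem chr_smul (c : X) (z : H) (r : ℝ) (v : H) : chr c z (r • v) = r • chr c z v := by
  rw [chr, christoffelLower_smul, ContinuousLinearMap.comp_smul]
  rfl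

theorem metricInChart_chart {c y : X} (hy : y ∈ (extChartAt 𝓘(ℝ, H) c).source) (v w : H) :
    metricInChart c (extChartAt 𝓘(ℝ, H) c y) v w =
      inner ℝ (fromModel c y v) (fromModel c y w) := by
  rw [metricInChart_apply, PartialEquiv.left_inv _ hy]

/-- The definition raises the index with the Riesz isomorphism of the fibre, `chr` with the inverse
of the metric in coordinates; pairing with the nondegenerate metric identifies the two at the centre
of the chart. -/
theorem toModel_christoffel (x : X) (v w : TangentSpace 𝓘(ℝ, H) x) :
    toModel x x (christoffel x v w) =
      chr x (extChartAt 𝓘(ℝ, H) x x) (toModel x x v) (toModel x x w) := by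
  have hx := mem_extChartAt_source (I := 𝓘(ℝ, H)) x
  have hz : extChartAt 𝓘(ℝ, H) x x ∈ (extChartAt 𝓘(ℝ, H) x).target := mem_extChartAt_target x
  refine eq_of_metricInChart hz fun y => ?_
  rw [metricInChart_chr hz, metricInChart_chart hx, fromModel_toModel hx]
  refine (InnerProductSpace.toDual_symm_apply).trans ?_
  change christoffelLower (metricInChart x) (extChartAt 𝓘(ℝ, H) x x) (toModel x x v)
    (toModel x x w) (toModel x x (fromModel x x y)) = _
  rw [toModel_fromModel hx]

variable [IsContMDiffRiemannianBundle 𝓘(ℝ, H) ∞ H (fun x : X => TangentSpace 𝓘(ℝ, H) x)]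

theorem contDiffOn_metricInChart (c : X) :
    ContDiffOn ℝ ∞ (metricInChart c : H → H →L[ℝ] H →L[ℝ] ℝ) (extChartAt 𝓘(ℝ, H) c).target := by
  have hsec : ∀ v : H, ContMDiffOn 𝓘(ℝ, H) (𝓘(ℝ, H).prod 𝓘(ℝ, H)) ∞
      (fun y : X => (⟨y, fromModel c y v⟩ : Bundle.TotalSpace H (TangentSpace 𝓘(ℝ, H))))
      (chartAt H c).source := by
    intro v
    have h := (trivializationAt H (TangentSpace 𝓘(ℝ, H)) c).contMDiffOn_section_baseSet_iff
      (IB := 𝓘(ℝ, H)) (n := ∞) (s := fun y : X => fromModel c y v)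
    rw [TangentBundle.trivializationAt_baseSet] at h
    rw [h]
    refine (contMDiffOn_const (c := v)).congr fun y hy => ?_
    have := toModel_fromModel (c := c) (y := y) (by rwa [extChartAt_source]) v
    rw [toModel, Bundle.Trivialization.continuousLinearMapAt_apply,
      Bundle.Trivialization.coe_linearMapAt_of_mem _ (by simpa using hy)] at this
    exact this
  rw [contDiffOn_clm_apply]
  intro v
  rw [contDiffOn_clm_apply]
  intro w
  have h1 := ContMDiffOn.inner_bundle (E := fun x : X => TangentSpace 𝓘(ℝ, H) x)
    (hsec v) (hsec w)
  have h2 := h1.comp (contMDiffOn_extChartAt_symm (n := ∞) (I := 𝓘(ℝ, H)) c) (fun z hz => by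
    have := PartialEquiv.map_target _ hz
    rwa [extChartAt_source] at this)
  exact h2.contDiffOn

theorem contDiffOn_chr (c : X) :
    ContDiffOn ℝ ∞ (fun p : H × H => chr c p.1 p.2)
      ((extChartAt 𝓘(ℝ, H) c).target ×ˢ Set.univ) := by
  have hG := contDiffOn_metricInChart (H := H) c
  have hd : ContDiffOn ℝ ∞ (fderiv ℝ (metricInChart c : H → H →L[ℝ] H →L[ℝ] ℝ))
      (extChartAt 𝓘(ℝ, H) c).target := hG.fderiv_of_isOpen (isOpen_target c) (by norm_cast)
  have hfst : ContDiffOn ℝ ∞ (Prod.fst : H × H → H)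
    ((extChartAt 𝓘(ℝ, H) c).target ×ˢ Set.univ) := contDiff_fst.contDiffOn
  have hsnd : ContDiffOn ℝ ∞ (Prod.snd : H × H → H)
    ((extChartAt 𝓘(ℝ, H) c).target ×ˢ Set.univ) := contDiff_snd.contDiffOn
  have hd1 := hd.comp hfst (fun p hp => hp.1)
  have hinv : ContDiffOn ℝ ∞ (fun p : H × H => (metricInChart c p.1).inverse)
      ((extChartAt 𝓘(ℝ, H) c).target ×ˢ Set.univ) := by
    intro p hp
    exact ((metricInChart_isInvertible hp.1).contDiffAt_map_inverse).comp_contDiffWithinAt p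
      ((hG.comp hfst fun p hp => hp.1) p hp)
  refine hinv.clm_comp ?_
  have e1 : ContDiffOn ℝ ∞ (fun p : H × H => fderiv ℝ (metricInChart c) p.1 p.2)
      ((extChartAt 𝓘(ℝ, H) c).target ×ˢ Set.univ) := hd1.clm_apply hsnd
  have e2 : ContDiffOn ℝ ∞ (fun p : H × H => (fderiv ℝ (metricInChart c) p.1).flip p.2)
      ((extChartAt 𝓘(ℝ, H) c).target ×ˢ Set.univ) :=
    ((ContinuousLinearMap.flipₗᵢ ℝ H H (H →L[ℝ] ℝ)).contDiff.comp_contDiffOn hd1).clm_apply hsnd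
  have e3 : ContDiffOn ℝ ∞ (fun p : H × H => ((fderiv ℝ (metricInChart c) p.1).flip p.2).flip)
      ((extChartAt 𝓘(ℝ, H) c).target ×ˢ Set.univ) :=
    (ContinuousLinearMap.flipₗᵢ ℝ H H ℝ).contDiff.comp_contDiffOn e2
  exact ((e1.add e2).sub e3).const_smul (1 / 2 : ℝ)

/-- The change of Christoffel symbols under a change of charts. -/
theorem jac_chr {c d : X} {z : H} (hz : z ∈ overlap H c d) (v w : H) :
    jac H c d z (chr c z v w) =
      chr d (coordChange H c d z) (jac H c d z v) (jac H c d z w) +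
        fderiv ℝ (jac H c d) z v w := by
  have hzc := (mem_overlap.1 hz).1
  have hzd := (mem_overlap.1 (coordChange_mem_overlap hz)).1
  have hO := (isOpen_overlap (H := H) c d).mem_nhds hz
  have hψ := (contDiffOn_coordChange (H := H) c d).contDiffAt hO
  have hJ : HasFDerivAt (jac H c d) (fderiv ℝ (jac H c d) z) z :=
    (((contDiffOn_jac c d).contDiffAt hO).differentiableAt (by norm_num)).hasFDerivAt
  -- Schwarz's theorem: the derivative of the Jacobian is the second derivative of the coordinate
  -- change.
  have hD : ∀ v w, fderiv ℝ (jac H c d) z v w = fderiv ℝ (jac H c d) z w v := fun v w =>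
    (hψ.isSymmSndFDerivAt (by
      rw [minSmoothness_of_isRCLikeNormedField]; exact WithTop.coe_le_coe.2 le_top)).eq v w
  refine eq_of_metricInChart hzd fun y => ?_
  -- The Jacobian is onto, so it is enough to test against its image, where the metric of one chart
  -- pulls back to that of the other.
  obtain ⟨y, rfl⟩ : ∃ y', y = jac H c d z y' := ⟨_, (jac_jac' hz y).symm⟩
  rw [← metricInChart_coordChange hz, metricInChart_chr hzc, map_add, _root_.add_apply,
    metricInChart_chr hzd]
  refine christoffelLower_pullback (hasFDerivAt_coordChange hz) hJ hD ?_ ?_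
    (metricInChart_symm d _) ?_ v w y
  · exact ((contDiffOn_metricInChart c).contDiffAt ((isOpen_target c).mem_nhds
      hzc)).differentiableAt (by norm_num)
  · exact ((contDiffOn_metricInChart d).contDiffAt ((isOpen_target d).mem_nhds
      hzd)).differentiableAt (by norm_num)
  · filter_upwards [hO] with y hy
    exact metricInChart_coordChange hy

end Christoffel

/-! ### Geodesics and derivatives of tensors along curves in an arbitrary chart -/

section ChartEquations

open Set Filter Topology

theorem contDiffAt_deriv {E : Type*} [NormedAddCommGroup E] [NormedSpace ℝ E] {f : ℝ → E} {t : ℝ}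
    (hf : ContDiffAt ℝ ∞ f t) : ContDiffAt ℝ ∞ (deriv f) t :=
  (hf.fderiv_right (m := ∞) (by norm_cast)).clm_apply contDiffAt_const

variable {H : Type*} [NormedAddCommGroup H] [NormedSpace ℝ H]
variable {X : Type*} [TopologicalSpace X] [ChartedSpace H X]

theorem eventually_mem_source {γ : ℝ → X} {t : ℝ} {c : X}
    (hγ : ContinuousAt γ t) (hc : γ t ∈ (extChartAt 𝓘(ℝ, H) c).source) :
    ∀ᶠ r in 𝓝 t, γ r ∈ (extChartAt 𝓘(ℝ, H) c).source :=
  hγ.eventually_mem ((isOpen_extChartAt_source c).mem_nhds hc)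

variable [IsManifold 𝓘(ℝ, H) ∞ X]

/-- Change of charts for the velocity of a curve. -/
theorem deriv_chart_eq {γ : ℝ → X} {t : ℝ} {c d : X}
    (hγ : ContMDiffAt 𝓘(ℝ, ℝ) 𝓘(ℝ, H) ∞ γ t) (hc : γ t ∈ (extChartAt 𝓘(ℝ, H) c).source)
    (hd : γ t ∈ (extChartAt 𝓘(ℝ, H) d).source) :
    deriv (fun r => extChartAt 𝓘(ℝ, H) d (γ r)) t =
      jac H c d (extChartAt 𝓘(ℝ, H) c (γ t)) (deriv (fun r => extChartAt 𝓘(ℝ, H) c (γ r)) t) := by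
  rw [← velocity_eq hγ hc, ← velocity_eq hγ hd, toModel_eq_jac hc hd]

theorem hasFDerivAt_jac {c d : X} {z : H} (hz : z ∈ overlap H c d) :
    HasFDerivAt (jac H c d) (fderiv ℝ (jac H c d) z) z :=
  (((contDiffOn_jac c d).contDiffAt ((isOpen_overlap c d).mem_nhds hz)).differentiableAt
    (by norm_num)).hasFDerivAt

/-- Second order chain rule. Its Hessian term is the one cancelled by the inhomogeneous term of
`jac_chr` when the geodesic equation changes charts. -/
theorem hasDerivAt_deriv_coordChange {z : ℝ → H} {t : ℝ} {c d : X}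
    (hy : ContDiffAt ℝ ∞ z t) (hz : z t ∈ overlap H c d) :
    HasDerivAt (deriv fun r => coordChange H c d (z r))
      (fderiv ℝ (jac H c d) (z t) (deriv z t) (deriv z t) +
        jac H c d (z t) (deriv (deriv z) t)) t := by
  have hy1 : HasDerivAt z (deriv z t) t := (hy.differentiableAt (by norm_num)).hasDerivAt
  have hy2 : HasDerivAt (deriv z) (deriv (deriv z) t) t :=
    ((contDiffAt_deriv hy).differentiableAt (by norm_num)).hasDerivAt
  have h1 := ((hasFDerivAt_jac hz).comp_hasDerivAt t hy1).clm_apply hy2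
  refine h1.congr_of_eventuallyEq ?_
  have e1 : ∀ᶠ r in 𝓝 t, ContDiffAt ℝ 1 z r :=
    (hy.of_le (by norm_cast)).eventually (by simp)
  have e2 : ∀ᶠ r in 𝓝 t, z r ∈ overlap H c d :=
    hy.continuousAt.eventually_mem ((isOpen_overlap c d).mem_nhds hz)
  filter_upwards [e1, e2] with r hr hr2
  exact ((hasFDerivAt_coordChange hr2).comp_hasDerivAt r
    (hr.differentiableAt (by norm_num)).hasDerivAt).deriv

theorem coordChange_curve_eventuallyEq {γ : ℝ → X} {t : ℝ} {c : X} (d : X)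
    (hγ : ContinuousAt γ t) (hc : γ t ∈ (extChartAt 𝓘(ℝ, H) c).source) :
    (fun r => extChartAt 𝓘(ℝ, H) d (γ r)) =ᶠ[𝓝 t]
      fun r => coordChange H c d (extChartAt 𝓘(ℝ, H) c (γ r)) := by
  filter_upwards [eventually_mem_source hγ hc] with r hr
  exact (coordChange_chart hr).symm

variable [FiniteDimensional ℝ H]
variable [Bundle.RiemannianBundle (fun x : X => TangentSpace 𝓘(ℝ, H) x)]
variable [IsContMDiffRiemannianBundle 𝓘(ℝ, H) ∞ H (fun x : X => TangentSpace 𝓘(ℝ, H) x)]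

/-- The geodesic equation in the preferred chart at an arbitrary point. -/
theorem IsGeodesicOn.hasDerivAt_deriv {γ : ℝ → X} {J : Set ℝ} (h : IsGeodesicOn H γ J) {t : ℝ}
    (ht : t ∈ J) {c : X} (hc : γ t ∈ (extChartAt 𝓘(ℝ, H) c).source) :
    HasDerivAt (deriv fun r => extChartAt 𝓘(ℝ, H) c (γ r))
      (- chr c (extChartAt 𝓘(ℝ, H) c (γ t)) (deriv (fun r => extChartAt 𝓘(ℝ, H) c (γ r)) t)
        (deriv (fun r => extChartAt 𝓘(ℝ, H) c (γ r)) t)) t := by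
  obtain ⟨hγ, heq⟩ := h t ht
  have hd := mem_extChartAt_source (I := 𝓘(ℝ, H)) (γ t)
  have hO := chart_mem_overlap hd hc
  have h1 := hasDerivAt_deriv_coordChange (contDiffAt_chart_curve hγ hd) hO
  have h2 := h1.congr_of_eventuallyEq (coordChange_curve_eventuallyEq c hγ.continuousAt hd).deriv
  refine h2.congr_deriv ?_
  rw [iteratedDeriv_succ, iteratedDeriv_one, toModel_christoffel, velocity_eq hγ hd] at heq
  rw [eq_neg_of_add_eq_zero_left heq, map_neg, jac_chr hO, ← deriv_chart_eq hγ hd hc,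
    coordChange_chart hd]
  abel

/-- Differentiating the inverse of the derivative of a coordinate change. -/
theorem hasFDerivAt_jac_inverse {c d : X} {z : H} (hz : z ∈ overlap H c d) :
    ∃ D : H →L[ℝ] H →L[ℝ] H, HasFDerivAt (fun y => jac H d c (coordChange H c d y)) D z ∧
      ∀ v w, D v w = - jac H d c (coordChange H c d z)
        (fderiv ℝ (jac H c d) z v (jac H d c (coordChange H c d z) w)) := by
  have h1 := (hasFDerivAt_jac (coordChange_mem_overlap hz)).comp z (hasFDerivAt_coordChange hz)
  refine ⟨_, h1, fun v w => ?_⟩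
  -- Differentiating `J⁻¹ J = 1` gives the derivative `-J⁻¹ (dJ) J⁻¹` of the inverse.
  have h2 := h1.clm_comp (hasFDerivAt_jac hz)
  have h3 : HasFDerivAt (fun y => (jac H d c (coordChange H c d y)).comp (jac H c d y))
      (0 : H →L[ℝ] H →L[ℝ] H) z := by
    refine (hasFDerivAt_const (ContinuousLinearMap.id ℝ H) z).congr_of_eventuallyEq ?_
    filter_upwards [(isOpen_overlap c d).mem_nhds hz] with y hy
    ext v
    exact jac_jac hy v
  have h4 := DFunLike.congr_fun (DFunLike.congr_fun (h2.unique h3) v)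
    (jac H d c (coordChange H c d z) w)
  simp [jac_jac' hz] at h4
  rw [eq_neg_iff_add_eq_zero, add_comm]
  exact h4

variable {lam mu : YoungDiagram}

/-- The change of components of tensors between the preferred charts at `c` and `d`. -/
noncomputable def tensorChange (lam mu : YoungDiagram) (c d : X) (z : H) :
    Schur lam mu H →L[ℝ] Schur lam mu H :=
  schurMap (jac H c d z) (jac H d c (coordChange H c d z))

theorem contDiffOn_tensorChange (c d : X) :
    ContDiffOn ℝ ∞ (tensorChange (H := H) lam mu c d) (overlap H c d) := by
  have h1 : ContDiffOn ℝ ∞ (fun z => (jac H c d z, jac H d c (coordChange H c d z)))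
      (overlap H c d) := (contDiffOn_jac c d).prodMk
    ((contDiffOn_jac d c).comp (contDiffOn_coordChange c d) fun _ h => coordChange_mem_overlap h)
  have h2 := contDiff_schurMap (lam := lam) (mu := mu) (V := H) (W := H)
  have h3 := h2.comp_contDiffOn h1
  exact h3

theorem eToModel_eq_tensorChange {c d y : X} (hc : y ∈ (extChartAt 𝓘(ℝ, H) c).source)
    (hd : y ∈ (extChartAt 𝓘(ℝ, H) d).source) (e : EFib H lam mu y) :
    eToModel lam mu d y e =
      tensorChange lam mu c d (extChartAt 𝓘(ℝ, H) c y) (eToModel lam mu c y e) := by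
  refine schur_ext fun θ v => ?_
  rw [tensorChange, coordChange_chart hc]
  change e.1 (fun i => (θ i).comp (toModel d y)) (fun i => fromModel d y (v i)) =
    e.1 (fun i => ((θ i).comp (jac H c d (extChartAt 𝓘(ℝ, H) c y))).comp (toModel c y))
      (fun i => fromModel c y (jac H d c (extChartAt 𝓘(ℝ, H) d y) (v i)))
  congr 2
  · funext i
    ext w
    exact congrArg (θ i) (toModel_eq_jac hc hd w)
  · funext i
    exact fromModel_eq_jac hd hc (v i)

/-- Change of charts for covariant derivatives of tensor fields along a curve. -/
theorem hasDerivWithinAt_tensorChange {c d : X} {ζ : ℝ → H} {v : H} {I : Set ℝ} {t : ℝ}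
    {S : ℝ → Schur lam mu H} {S' : Schur lam mu H} (hζ : HasDerivWithinAt ζ v I t)
    (hS : HasDerivWithinAt S S' I t) (hz : ζ t ∈ overlap H c d) :
    HasDerivWithinAt (fun r => tensorChange lam mu c d (ζ r) (S r))
      (tensorChange lam mu c d (ζ t) (S' + schurAct (chr c (ζ t) v) (S t)) -
        schurAct (chr d (coordChange H c d (ζ t)) (jac H c d (ζ t) v))
          (tensorChange lam mu c d (ζ t) (S t))) I t := by
  obtain ⟨D, hD, hD'⟩ := hasFDerivAt_jac_inverse hz
  have h1 := hasDerivWithinAt_schurMap ((hasFDerivAt_jac hz).comp_hasDerivWithinAt t hζ)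
    (hD.comp_hasDerivWithinAt t hζ) hS (jac_jac hz) (fun w => hD' v w)
  refine h1.congr_deriv ?_
  -- The inhomogeneous term of the law for Christoffel symbols is the infinitesimal change of frame
  -- coming from the differentiated Jacobian, so the two cancel and a tensorial expression remains.
  have h2 : ((jac H c d (ζ t)).comp (chr c (ζ t) v)).comp (jac H d c (coordChange H c d (ζ t))) =
      chr d (coordChange H c d (ζ t)) (jac H c d (ζ t) v) +
        (fderiv ℝ (jac H c d) (ζ t) v).comp (jac H d c (coordChange H c d (ζ t))) := by
    ext w
    simp [jac_chr hz, jac_jac' hz]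
  rw [map_add, tensorChange, schurMap_schurAct (jac_jac hz), h2, schurAct_add]
  simp only [Function.comp]
  abel

end ChartEquations

/-! ### Tensoriality of the covariant derivative -/

section CovariantDerivative

open Set Filter Topology

variable {H : Type*} [NormedAddCommGroup H] [NormedSpace ℝ H] [FiniteDimensional ℝ H]
variable {X : Type*} [TopologicalSpace X] [ChartedSpace H X] [IsManifold 𝓘(ℝ, H) ∞ X]
variable [Bundle.RiemannianBundle (fun x : X => TangentSpace 𝓘(ℝ, H) x)]
variable {lam mu : YoungDiagram}

theorem eToModel_eGamma (x : X) (v : TangentSpace 𝓘(ℝ, H) x) (e : EFib H lam mu x) :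
    eToModel lam mu x x (eGamma x v e) =
      schurAct (chr x (extChartAt 𝓘(ℝ, H) x x) (toModel x x v)) (eToModel lam mu x x e) := by
  have hx := mem_extChartAt_source (I := 𝓘(ℝ, H)) x
  refine (schurMap_schurAct (V := TangentSpace 𝓘(ℝ, H) x) (W := H) (P := toModel x x)
    (Q := fromModel x x) (fromModel_toModel hx) (christoffel x v) e).trans ?_
  congr 1
  congr 1
  ext w
  refine (toModel_christoffel x v (fromModel x x w)).trans ?_
  rw [toModel_fromModel hx]

theorem schurMap_fromModel_toModel {c y : X} (hy : y ∈ (extChartAt 𝓘(ℝ, H) c).source)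
    (e : EFib H lam mu y) :
    schurMap (V := H) (W := TangentSpace 𝓘(ℝ, H) y) (fromModel c y) (toModel c y)
      (eToModel lam mu c y e) = e := by
  refine schur_ext fun θ v => ?_
  change e.1 (fun i => ((θ i).comp (fromModel c y)).comp (toModel c y))
    (fun i => fromModel c y (toModel c y (v i))) = e.1 θ v
  congr 2
  · funext i
    ext w
    exact congrArg (θ i) (fromModel_toModel hy w)
  · funext i
    exact fromModel_toModel hy (v i)

theorem eToModel_schurMap_fromModel {c y : X} (hy : y ∈ (extChartAt 𝓘(ℝ, H) c).source)
    (e : Schur lam mu H) :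
    eToModel lam mu c y (schurMap (V := H) (W := TangentSpace 𝓘(ℝ, H) y) (fromModel c y)
      (toModel c y) e) = e := by
  refine schur_ext fun θ v => ?_
  change e.1 (fun i => ((θ i).comp (toModel c y)).comp (fromModel c y))
    (fun i => toModel c y (fromModel c y (v i))) = e.1 θ v
  congr 2
  · funext i
    ext w
    exact congrArg (θ i) (toModel_fromModel hy w)
  · funext i
    exact toModel_fromModel hy (v i)

theorem eToModel_injective {c y : X} (hy : y ∈ (extChartAt 𝓘(ℝ, H) c).source) :
    Function.Injective (eToModel lam mu c y : EFib H lam mu y → Schur lam mu H) := fun a b h => by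
  rw [← schurMap_fromModel_toModel hy a, h, schurMap_fromModel_toModel hy b]

theorem eToModel_kFromModel {k : ℕ} (x : X) (M : KSchur lam mu H k)
    (m : Fin k → TangentSpace 𝓘(ℝ, H) x) :
    eToModel lam mu x x (kFromModel x x M m) = M fun i => toModel x x (m i) :=
  eToModel_schurMap_fromModel (mem_extChartAt_source x) _

theorem kGamma_apply {k : ℕ} (x : X) (v : TangentSpace 𝓘(ℝ, H) x) (M : KFib H lam mu k x)
    (m : Fin k → TangentSpace 𝓘(ℝ, H) x) :
    kGamma x v M m = eGamma x v (M m) -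
      ∑ i, M (Function.update m i (christoffel x v (m i))) := by
  refine Eq.trans ?_ (congrArg (eGamma x v (M m) - ·) (slotSum_apply
    (V := TangentSpace 𝓘(ℝ, H) x) (christoffel x v) M m))
  rfl

theorem eToModel_nablaAt {k : ℕ} (s : ∀ x : X, KFib H lam mu k x) (x : X)
    (v : TangentSpace 𝓘(ℝ, H) x) (m : Fin k → TangentSpace 𝓘(ℝ, H) x) :
    eToModel lam mu x x (nablaAt s x v m) =
      fderiv ℝ (sectionInChart s x) (extChartAt 𝓘(ℝ, H) x x) (toModel x x v)
        (fun i => toModel x x (m i)) +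
      (schurAct (chr x (extChartAt 𝓘(ℝ, H) x x) (toModel x x v)) (eToModel lam mu x x (s x m)) -
        ∑ i, eToModel lam mu x x (s x (Function.update m i (christoffel x v (m i))))) := by
  have h : nablaAt s x v m =
      kFromModel x x (fderiv ℝ (sectionInChart s x) (extChartAt 𝓘(ℝ, H) x x) (toModel x x v)) m +
        kGamma x v (s x) m := rfl
  rw [h, map_add, eToModel_kFromModel, kGamma_apply, map_sub, eToModel_eGamma, map_sum]

variable [IsContMDiffRiemannianBundle 𝓘(ℝ, H) ∞ H (fun x : X => TangentSpace 𝓘(ℝ, H) x)]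

/-- The covariant derivative along a curve is tensorial, so its vanishing passes from one chart to
the other. -/
theorem parallel_change {γ : ℝ → X} {t : ℝ} {I : Set ℝ} {c d : X} (htI : t ∈ I)
    (hγ : ContMDiffAt 𝓘(ℝ, ℝ) 𝓘(ℝ, H) ∞ γ t) (hc : γ t ∈ (extChartAt 𝓘(ℝ, H) c).source)
    (hd : γ t ∈ (extChartAt 𝓘(ℝ, H) d).source) (s : ∀ r, EFib H lam mu (γ r))
    (h : HasDerivWithinAt (fun r => eToModel lam mu c (γ r) (s r))
      (- schurAct (chr c (extChartAt 𝓘(ℝ, H) c (γ t))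
        (deriv (fun r => extChartAt 𝓘(ℝ, H) c (γ r)) t)) (eToModel lam mu c (γ t) (s t))) I t) :
    HasDerivWithinAt (fun r => eToModel lam mu d (γ r) (s r))
      (- schurAct (chr d (extChartAt 𝓘(ℝ, H) d (γ t))
        (deriv (fun r => extChartAt 𝓘(ℝ, H) d (γ r)) t)) (eToModel lam mu d (γ t) (s t))) I t := by
  have hy1 : HasDerivAt (fun r => extChartAt 𝓘(ℝ, H) c (γ r))
      (deriv (fun r => extChartAt 𝓘(ℝ, H) c (γ r)) t) t :=
    ((contDiffAt_chart_curve hγ hc).differentiableAt (by norm_num)).hasDerivAt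
  have h1 := hasDerivWithinAt_tensorChange (lam := lam) (mu := mu) (c := c) (d := d)
    hy1.hasDerivWithinAt h (chart_mem_overlap hc hd)
  rw [neg_add_cancel, map_zero, zero_sub, coordChange_chart hc, ← deriv_chart_eq hγ hc hd,
    ← eToModel_eq_tensorChange hc hd] at h1
  refine h1.congr_of_eventuallyEq_of_mem ?_ htI
  have e := (eventually_mem_source (H := H) hγ.continuousAt hc).and
    (eventually_mem_source (H := H) hγ.continuousAt hd)
  filter_upwards [nhdsWithin_le_nhds e] with r hr
  exact eToModel_eq_tensorChange hr.1 hr.2 (s r)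

/-- The equation of parallel transport in the preferred chart at an arbitrary point. -/
theorem parallel_iff {γ : ℝ → X} {t : ℝ} {I : Set ℝ} {c : X} (htI : t ∈ I)
    (hγ : ContMDiffAt 𝓘(ℝ, ℝ) 𝓘(ℝ, H) ∞ γ t) (hc : γ t ∈ (extChartAt 𝓘(ℝ, H) c).source)
    (s : ∀ r, EFib H lam mu (γ r)) :
    HasDerivWithinAt (fun r => eToModel lam mu (γ t) (γ r) (s r))
      (- eToModel lam mu (γ t) (γ t) (eGamma (γ t) (velocity H γ t) (s t))) I t ↔
    HasDerivWithinAt (fun r => eToModel lam mu c (γ r) (s r))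
      (- schurAct (chr c (extChartAt 𝓘(ℝ, H) c (γ t))
        (deriv (fun r => extChartAt 𝓘(ℝ, H) c (γ r)) t)) (eToModel lam mu c (γ t) (s t))) I t := by
  have hd := mem_extChartAt_source (I := 𝓘(ℝ, H)) (γ t)
  rw [eToModel_eGamma, velocity_eq hγ hd]
  exact ⟨parallel_change htI hγ hd hc s, parallel_change htI hγ hc hd s⟩

/-- The components of a section of `E` in the preferred chart at `c`. -/
noncomputable def compInChart (u : ∀ x : X, EFib H lam mu x) (c : X) (z : H) : Schur lam mu H :=
  eToModel lam mu c ((extChartAt 𝓘(ℝ, H) c).symm z) (u ((extChartAt 𝓘(ℝ, H) c).symm z))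

theorem compInChart_chart (u : ∀ x : X, EFib H lam mu x) {c y : X}
    (hy : y ∈ (extChartAt 𝓘(ℝ, H) c).source) :
    compInChart u c (extChartAt 𝓘(ℝ, H) c y) = eToModel lam mu c y (u y) := by
  rw [compInChart, PartialEquiv.left_inv _ hy]

theorem IsSmoothSection.contDiffOn {u : ∀ x : X, EFib H lam mu x} (hu : IsSmoothSection u) (c : X) :
    ContDiffOn ℝ ∞ (compInChart u c) (extChartAt 𝓘(ℝ, H) c).target :=
  ((hu c).comp (contMDiffOn_extChartAt_symm (n := ∞) (I := 𝓘(ℝ, H)) c) (fun z hz => by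
    have := PartialEquiv.map_target _ hz
    rwa [extChartAt_source] at this)).contDiffOn

/-- The components of `∇ u` in the preferred chart at `c`. -/
noncomputable def covInChart (u : ∀ x : X, EFib H lam mu x) (c : X) (z v : H) : Schur lam mu H :=
  fderiv ℝ (compInChart u c) z v + schurAct (chr c z v) (compInChart u c z)

/-- Reduces to the covariant derivative along a curve: both sides are derivatives, along one
coordinate segment, of the same section read in two charts. -/
theorem covInChart_change {u : ∀ x : X, EFib H lam mu x} (hu : IsSmoothSection u) {c d : X} {z : H}
    (hz : z ∈ overlap H c d) (v : H) :
    covInChart u d (coordChange H c d z) (jac H c d z v) =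
      tensorChange lam mu c d z (covInChart u c z v) := by
  have hzc := (mem_overlap.1 hz).1
  have hzd := (mem_overlap.1 (coordChange_mem_overlap hz)).1
  have hUc : HasFDerivAt (compInChart u c) (fderiv ℝ (compInChart u c) z) z :=
    (((hu.contDiffOn c).contDiffAt ((isOpen_target c).mem_nhds hzc)).differentiableAt
      (by norm_num)).hasFDerivAt
  have hUd : HasFDerivAt (compInChart u d) (fderiv ℝ (compInChart u d) (coordChange H c d z))
      (coordChange H c d z) :=
    (((hu.contDiffOn d).contDiffAt ((isOpen_target d).mem_nhds hzd)).differentiableAt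
      (by norm_num)).hasFDerivAt
  -- The straight segment through `z` with velocity `v` in the chart at `c`, used only near time 0.
  have hζ : HasDerivAt (fun r : ℝ => z + r • v) v 0 := by
    simpa using ((hasDerivAt_id (0 : ℝ)).smul_const v).const_add z
  have hζ0 : z + (0 : ℝ) • v = z := by simp
  have h1 := hasDerivWithinAt_tensorChange (lam := lam) (mu := mu) (c := c) (d := d)
    (hζ.hasDerivWithinAt (s := univ))
    (HasFDerivAt.comp_hasDerivWithinAt (0 : ℝ) (by rw [hζ0]; exact hUc)
      (hζ.hasDerivWithinAt (s := univ))) (by rw [hζ0]; exact hz)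
  have h2 : HasDerivAt (fun r : ℝ => compInChart u d (coordChange H c d (z + r • v)))
      (fderiv ℝ (compInChart u d) (coordChange H c d z) (jac H c d z v)) 0 := by
    have hK : HasFDerivAt (coordChange H c d) (jac H c d z) (z + (0 : ℝ) • v) := by
      rw [hζ0]; exact hasFDerivAt_coordChange hz
    have hK' : HasFDerivAt (compInChart u d) (fderiv ℝ (compInChart u d) (coordChange H c d z))
        (coordChange H c d (z + (0 : ℝ) • v)) := by
      rw [hζ0]; exact hUd
    exact HasFDerivAt.comp_hasDerivAt (0 : ℝ) hK' (HasFDerivAt.comp_hasDerivAt (0 : ℝ) hK hζ)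
  have hev : ∀ y ∈ overlap H c d, compInChart u d (coordChange H c d y) =
      tensorChange lam mu c d y (compInChart u c y) := by
    intro y hy
    have hy' := mem_overlap.1 hy
    have hs := PartialEquiv.map_target _ hy'.1
    have h4 := eToModel_eq_tensorChange hs hy'.2 (u ((extChartAt 𝓘(ℝ, H) c).symm y))
    rw [PartialEquiv.right_inv _ hy'.1] at h4
    exact (compInChart_chart u hy'.2).trans h4
  rw [hasDerivWithinAt_univ] at h1
  have h3 : HasDerivAt (fun r : ℝ => tensorChange lam mu c d (z + r • v)
      (compInChart u c (z + r • v))) _ 0 := h2.congr_of_eventuallyEq (by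
    have : ∀ᶠ r : ℝ in 𝓝 0, z + r • v ∈ overlap H c d := by
      refine hζ.continuousAt.eventually_mem ((isOpen_overlap c d).mem_nhds ?_)
      rw [hζ0]; exact hz
    filter_upwards [this] with r hr
    exact (hev _ hr).symm)
  have h5 := h3.unique h1
  simp only [hζ0, Function.comp] at h5
  rw [covInChart, covInChart, h5, hev z hz]
  abel

end CovariantDerivative

/-! ### First and second covariant derivatives in a fixed chart -/

section IteratedCovariantDerivative

open Set Filter Topology

variable {H : Type*} [NormedAddCommGroup H] [NormedSpace ℝ H] [FiniteDimensional ℝ H]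
variable {X : Type*} [TopologicalSpace X] [ChartedSpace H X] [IsManifold 𝓘(ℝ, H) ∞ X]
variable [Bundle.RiemannianBundle (fun x : X => TangentSpace 𝓘(ℝ, H) x)]
variable {lam mu : YoungDiagram}

variable (lam mu H) in
/-- `schurAct` as a continuous linear map of the endomorphism. -/
noncomputable def schurActL : (H →L[ℝ] H) →L[ℝ] (Schur lam mu H →L[ℝ] Schur lam mu H) :=
  LinearMap.toContinuousLinearMap
    { toFun := fun a => schurAct a
      map_add' := fun a b => by ext1 w; exact schurAct_add a b w
      map_smul' := fun r a => by ext1 w; exact schurAct_smul r a w }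

theorem nablaIter_zero_apply (u : ∀ x : X, EFib H lam mu x) (y : X)
    (m : Fin 0 → TangentSpace 𝓘(ℝ, H) y) : nablaIter u 0 y m = u y := rfl

theorem sectionInChart_nablaIter_zero (u : ∀ x : X, EFib H lam mu x) (c : X) (z : H) :
    sectionInChart (nablaIter u 0) c z =
      (continuousMultilinearCurryFin0 ℝ H (Schur lam mu H)).symm (compInChart u c z) := by
  ext1 m
  rfl

theorem fderiv_multilinear_apply {k : ℕ} {S : H → KSchur lam mu H k} {z : H}
    (hS : DifferentiableAt ℝ S z) (v : H) (m : Fin k → H) :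
    fderiv ℝ S z v m = fderiv ℝ (fun y => S y m) z v := by
  have h := ((ContinuousMultilinearMap.apply ℝ (fun _ : Fin k => H)
    (Schur lam mu H) m).hasFDerivAt (x := S z)).comp z hS.hasFDerivAt
  have h' : HasFDerivAt (fun y => S y m) _ z := h
  rw [h'.fderiv]
  rfl

variable [IsContMDiffRiemannianBundle 𝓘(ℝ, H) ∞ H (fun x : X => TangentSpace 𝓘(ℝ, H) x)]

/-- By definition `∇u` at `y` is computed in the preferred chart at `y`, which changes with `y`.
Tensoriality rewrites it in one chart at `c`, a form that can be differentiated to reach the second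
covariant derivative. -/
theorem eToModel_nablaAt_zero {u : ∀ x : X, EFib H lam mu x} (hu : IsSmoothSection u) {c y : X}
    (hy : y ∈ (extChartAt 𝓘(ℝ, H) c).source) (v : TangentSpace 𝓘(ℝ, H) y)
    (m : Fin 0 → TangentSpace 𝓘(ℝ, H) y) :
    eToModel lam mu c y (nablaAt (nablaIter u 0) y v m) =
      covInChart u c (extChartAt 𝓘(ℝ, H) c y) (toModel c y v) := by
  have hyy := mem_extChartAt_source (I := 𝓘(ℝ, H)) y
  have h1 : eToModel lam mu y y (nablaAt (nablaIter u 0) y v m) =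
      covInChart u y (extChartAt 𝓘(ℝ, H) y y) (toModel y y v) := by
    have hd : DifferentiableAt ℝ (compInChart u y) (extChartAt 𝓘(ℝ, H) y y) :=
      (((hu.contDiffOn y).contDiffAt ((isOpen_target y).mem_nhds
        (mem_extChartAt_target y))).differentiableAt (by norm_num))
    rw [eToModel_nablaAt, fderiv_multilinear_apply, covInChart, compInChart_chart u hyy,
      nablaIter_zero_apply]
    · simp only [Finset.univ_eq_empty, Finset.sum_empty, sub_zero]
      rfl
    · have : sectionInChart (nablaIter u 0) y = fun z =>
        (continuousMultilinearCurryFin0 ℝ H (Schur lam mu H)).symm (compInChart u y z) :=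
        funext fun z => sectionInChart_nablaIter_zero u y z
      rw [this]
      exact ((continuousMultilinearCurryFin0 ℝ H
        (Schur lam mu H)).symm.toContinuousLinearEquiv.differentiableAt).comp _ hd
  rw [eToModel_eq_tensorChange hyy hy, h1, ← covInChart_change hu (chart_mem_overlap hyy hy),
    coordChange_chart hyy, ← toModel_eq_jac hyy hy]

theorem contDiffOn_fderiv_compInChart {u : ∀ x : X, EFib H lam mu x} (hu : IsSmoothSection u)
    (c : X) : ContDiffOn ℝ ∞ (fderiv ℝ (compInChart u c)) (extChartAt 𝓘(ℝ, H) c).target :=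
  (hu.contDiffOn c).fderiv_of_isOpen (isOpen_target c) (by norm_cast)

theorem contDiffOn_schurAct_chr {u : ∀ x : X, EFib H lam mu x} (hu : IsSmoothSection u) (c : X)
    (v : H) : ContDiffOn ℝ ∞ (fun z => schurAct (chr c z v) (compInChart u c z))
      (extChartAt 𝓘(ℝ, H) c).target := by
  have h2 : ContDiffOn ℝ ∞ (fun z => chr c z v) (extChartAt 𝓘(ℝ, H) c).target :=
    ContDiffOn.comp (g := fun p : H × H => chr c p.1 p.2) (f := fun z => (z, v))
      (contDiffOn_chr c) (contDiff_prodMk_left v).contDiffOn fun z hz => ⟨hz, mem_univ v⟩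
  have h3 : ContDiffOn ℝ ∞ (fun z => schurActL H lam mu (chr c z v))
      (extChartAt 𝓘(ℝ, H) c).target := (schurActL H lam mu).contDiff.comp_contDiffOn h2
  exact h3.clm_apply (hu.contDiffOn c)

theorem contDiffOn_fderiv_compInChart_apply {u : ∀ x : X, EFib H lam mu x}
    (hu : IsSmoothSection u) (c : X) (v : H) :
    ContDiffOn ℝ ∞ (fun z => fderiv ℝ (compInChart u c) z v) (extChartAt 𝓘(ℝ, H) c).target :=
  (ContinuousLinearMap.apply ℝ (Schur lam mu H) v).contDiff.comp_contDiffOn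
    (contDiffOn_fderiv_compInChart hu c)

theorem contDiffOn_covInChart {u : ∀ x : X, EFib H lam mu x} (hu : IsSmoothSection u) (c : X)
    (v : H) : ContDiffOn ℝ ∞ (fun z => covInChart u c z v) (extChartAt 𝓘(ℝ, H) c).target :=
  (contDiffOn_fderiv_compInChart_apply hu c v).add (contDiffOn_schurAct_chr hu c v)

/-- The components of `∇ u` as a linear map. -/
noncomputable def covL (u : ∀ x : X, EFib H lam mu x) (c : X) (z : H) : H →L[ℝ] Schur lam mu H :=
  LinearMap.toContinuousLinearMap
    { toFun := covInChart u c z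
      map_add' := fun v w => by
        simp only [covInChart, map_add, chr_add, schurAct_add]
        abel
      map_smul' := fun r v => by
        simp only [covInChart, map_smul, chr_smul, schurAct_smul, smul_add, RingHom.id_apply] }

theorem covL_apply (u : ∀ x : X, EFib H lam mu x) (c : X) (z v : H) :
    covL u c z v = covInChart u c z v := rfl

theorem contDiffOn_covL {u : ∀ x : X, EFib H lam mu x} (hu : IsSmoothSection u) (c : X) :
    ContDiffOn ℝ ∞ (covL u c) (extChartAt 𝓘(ℝ, H) c).target :=
  contDiffOn_clm_apply.2 fun v => contDiffOn_covInChart hu c v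

theorem eToModel_nablaIter_one {u : ∀ x : X, EFib H lam mu x} (hu : IsSmoothSection u) {c y : X}
    (hy : y ∈ (extChartAt 𝓘(ℝ, H) c).source) (m : Fin 1 → TangentSpace 𝓘(ℝ, H) y) :
    eToModel lam mu c y (nablaIter u 1 y m) =
      covInChart u c (extChartAt 𝓘(ℝ, H) c y) (toModel c y (m 0)) :=
  eToModel_nablaAt_zero hu hy (m 0) (Fin.tail m)

theorem sectionInChart_nablaIter_one {u : ∀ x : X, EFib H lam mu x} (hu : IsSmoothSection u)
    (c : X) {z : H} (hz : z ∈ (extChartAt 𝓘(ℝ, H) c).target) :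
    sectionInChart (nablaIter u 1) c z =
      (continuousMultilinearCurryFin1 ℝ H (Schur lam mu H)).symm (covL u c z) := by
  ext1 m
  have hs := PartialEquiv.map_target _ hz
  refine (eToModel_nablaIter_one hu hs (fun i => fromModel c _ (m i))).trans ?_
  rw [PartialEquiv.right_inv _ hz, toModel_fromModel hs]
  rfl

/-- The Hessian formula. The subtracted term is the connection acting on the covariant slot created
by the first derivative; `m 0` is the direction of the second one. -/
theorem eToModel_nablaIter_two {u : ∀ x : X, EFib H lam mu x} (hu : IsSmoothSection u) (x : X)
    (m : Fin 2 → TangentSpace 𝓘(ℝ, H) x) :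
    eToModel lam mu x x (nablaIter u 2 x m) =
      fderiv ℝ (covL u x) (extChartAt 𝓘(ℝ, H) x x) (toModel x x (m 0)) (toModel x x (m 1)) +
      schurAct (chr x (extChartAt 𝓘(ℝ, H) x x) (toModel x x (m 0)))
        (covL u x (extChartAt 𝓘(ℝ, H) x x) (toModel x x (m 1))) -
      covL u x (extChartAt 𝓘(ℝ, H) x x)
        (chr x (extChartAt 𝓘(ℝ, H) x x) (toModel x x (m 0)) (toModel x x (m 1))) := by
  have hx := mem_extChartAt_source (I := 𝓘(ℝ, H)) x
  have hxt := mem_extChartAt_target (I := 𝓘(ℝ, H)) x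
  have hd : DifferentiableAt ℝ (covL u x) (extChartAt 𝓘(ℝ, H) x x) :=
      (((contDiffOn_covL hu x).contDiffAt ((isOpen_target x).mem_nhds hxt)).differentiableAt
        (by norm_num))
  have hev : sectionInChart (nablaIter u 1) x =ᶠ[𝓝 (extChartAt 𝓘(ℝ, H) x x)]
      fun z => (continuousMultilinearCurryFin1 ℝ H (Schur lam mu H)).symm (covL u x z) := by
    filter_upwards [(isOpen_target x).mem_nhds hxt] with z hz
    exact sectionInChart_nablaIter_one hu x hz
  let L : (H →L[ℝ] Schur lam mu H) →L[ℝ] KSchur lam mu H 1 :=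
    (continuousMultilinearCurryFin1 ℝ H (Schur lam mu H)).symm.toContinuousLinearEquiv
  have hd2 : HasFDerivAt (sectionInChart (nablaIter u 1) x)
      (L.comp (fderiv ℝ (covL u x) (extChartAt 𝓘(ℝ, H) x x))) (extChartAt 𝓘(ℝ, H) x x) :=
    ((L.hasFDerivAt (x := covL u x (extChartAt 𝓘(ℝ, H) x x))).comp _
      hd.hasFDerivAt).congr_of_eventuallyEq hev
  have h := eToModel_nablaAt (nablaIter u 1) x (m 0) (Fin.tail m)
  rw [hd2.fderiv, eToModel_nablaIter_one hu hx, Fin.sum_univ_one,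
    eToModel_nablaIter_one hu hx, Function.update_self, toModel_christoffel] at h
  refine h.trans ?_
  rw [add_sub_assoc]
  rfl

end IteratedCovariantDerivative

/-! ### Uniqueness of geodesics and integrating factors for parallel transport -/

section ChartSolutions

open Set Filter Topology

variable {H : Type*} [NormedAddCommGroup H] [NormedSpace ℝ H] [FiniteDimensional ℝ H]
variable {X : Type*} [TopologicalSpace X] [ChartedSpace H X] [IsManifold 𝓘(ℝ, H) ∞ X]
variable [Bundle.RiemannianBundle (fun x : X => TangentSpace 𝓘(ℝ, H) x)]
variable {lam mu : YoungDiagram}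

/-- The geodesic vector field in the preferred chart at `c`. -/
noncomputable def geodesicField (c : X) (p : H × H) : H × H := (p.2, - chr c p.1 p.2 p.2)

/-- Position and velocity of a curve in the preferred chart at `c`. -/
noncomputable def chartState (c : X) (γ : ℝ → X) (t : ℝ) : H × H :=
  (extChartAt 𝓘(ℝ, H) c (γ t), deriv (fun r => extChartAt 𝓘(ℝ, H) c (γ r)) t)

variable [IsContMDiffRiemannianBundle 𝓘(ℝ, H) ∞ H (fun x : X => TangentSpace 𝓘(ℝ, H) x)]

theorem contDiffOn_geodesicField (c : X) :
    ContDiffOn ℝ ∞ (geodesicField (H := H) c) ((extChartAt 𝓘(ℝ, H) c).target ×ˢ univ) :=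
  contDiffOn_snd.prodMk (((contDiffOn_chr c).clm_apply contDiffOn_snd).neg)

theorem IsGeodesicOn.hasDerivAt_chartState {γ : ℝ → X} {J : Set ℝ} (h : IsGeodesicOn H γ J) {t : ℝ}
    (ht : t ∈ J) {c : X} (hc : γ t ∈ (extChartAt 𝓘(ℝ, H) c).source) :
    HasDerivAt (chartState (H := H) c γ) (geodesicField c (chartState c γ t)) t :=
  ((contDiffAt_chart_curve (h t ht).1 hc).differentiableAt (by norm_num)).hasDerivAt.prodMk
    (h.hasDerivAt_deriv ht hc)

/-- A geodesic which agrees at some time with a solution of the geodesic equation in a chart agrees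
with it as long as both are defined. -/
theorem chartState_eq_of_solution [T2Space X] {c : X} {γ : ℝ → X} {a b α β t₁ : ℝ} {p : ℝ → H × H}
    (hγ : IsGeodesicOn H γ (Ioo a b))
    (hp : ∀ t ∈ Ioo α β, (p t).1 ∈ (extChartAt 𝓘(ℝ, H) c).target ∧
      HasDerivAt p (geodesicField c (p t)) t)
    (h₁ : t₁ ∈ Ioo a b) (h₁' : t₁ ∈ Ioo α β) (hc : γ t₁ ∈ (extChartAt 𝓘(ℝ, H) c).source)
    (hs : chartState c γ t₁ = p t₁) {t : ℝ} (ht : t ∈ Ioo a b) (ht' : t ∈ Ioo α β) :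
    γ t ∈ (extChartAt 𝓘(ℝ, H) c).source ∧ chartState c γ t = p t := by
  have hJ : IsPreconnected (Ioo a b ∩ Ioo α β) := by
    rw [Ioo_inter_Ioo]; exact isPreconnected_Ioo
  have hJo : IsOpen (Ioo a b ∩ Ioo α β) := isOpen_Ioo.inter isOpen_Ioo
  -- The set of times of agreement inside the chart is open by local uniqueness for a locally
  -- Lipschitz field, and relatively closed in an interval by continuity.
  let u : Set ℝ := {r | (r ∈ Ioo a b ∩ Ioo α β) ∧ γ r ∈ (extChartAt 𝓘(ℝ, H) c).source ∧
    chartState c γ r = p r}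
  suffices Ioo a b ∩ Ioo α β ⊆ u from (this ⟨ht, ht'⟩).2
  refine hJ.subset_of_closure_inter_subset ?_ ⟨t₁, ⟨h₁, h₁'⟩, ⟨h₁, h₁'⟩, hc, hs⟩ ?_
  · rw [isOpen_iff_mem_nhds]
    rintro r ⟨hr, hrc, hrs⟩
    have hev := eventually_mem_source (H := H) (hγ r hr.1).1.continuousAt hrc
    have hgt : p r ∈ (extChartAt 𝓘(ℝ, H) c).target ×ˢ (univ : Set H) := ⟨(hp r hr.2).1, mem_univ _⟩
    have hgo : IsOpen ((extChartAt 𝓘(ℝ, H) c).target ×ˢ (univ : Set H)) :=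
      (isOpen_target c).prod isOpen_univ
    obtain ⟨K, s, hs, hK⟩ := (((contDiffOn_geodesicField (H := H) c).contDiffAt
      (hgo.mem_nhds hgt)).of_le (by norm_cast : (1 : ℕ∞ω) ≤ ∞)).exists_lipschitzOnWith
    have hd1 := hγ.hasDerivAt_chartState hr.1 hrc
    have e1 : ∀ᶠ q in 𝓝 r, HasDerivAt (chartState (H := H) c γ) (geodesicField c (chartState c γ q)) q ∧
        chartState c γ q ∈ s := by
      have : ∀ᶠ q in 𝓝 r, chartState c γ q ∈ s := by
        refine hd1.continuousAt.eventually_mem ?_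
        rw [hrs]; exact hs
      filter_upwards [hev, this, hJo.mem_nhds hr] with q h1 h2 h3
      exact ⟨hγ.hasDerivAt_chartState h3.1 h1, h2⟩
    have e2 : ∀ᶠ q in 𝓝 r, HasDerivAt p (geodesicField c (p q)) q ∧ p q ∈ s := by
      filter_upwards [(hp r hr.2).2.continuousAt.eventually_mem hs, hJo.mem_nhds hr] with q h1 h2
      exact ⟨(hp q h2.2).2, h1⟩
    have e3 := ODE_solution_unique_of_eventually (v := fun _ => geodesicField c) (s := fun _ => s)
      (K := K) (Eventually.of_forall fun _ => hK) e1 e2 hrs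
    filter_upwards [hev, e3, hJo.mem_nhds hr] with q h1 h2 h3
    exact ⟨h3, h1, h2⟩
  · rintro r ⟨hru, hr⟩
    have hfr : ∃ᶠ q in 𝓝 r, q ∈ u := mem_closure_iff_frequently.1 hru
    have hcont : ContinuousAt (fun q => (extChartAt 𝓘(ℝ, H) c).symm (p q).1) r := by
      have h1 : ContinuousAt (fun q => (p q).1) r :=
        continuous_fst.continuousAt.comp (hp r hr.2).2.continuousAt
      exact ContinuousAt.comp (g := (extChartAt 𝓘(ℝ, H) c).symm) (f := fun q => (p q).1)
        ((continuousOn_extChartAt_symm c).continuousAt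
          ((isOpen_target c).mem_nhds (hp r hr.2).1)) h1
    -- Both sides are limits of common values at times of `u` tending to `r`, so they agree because
    -- `X` is Hausdorff. This prevents the geodesic from leaving the chart domain while the
    -- coordinate solution remains in the target.
    have heq : γ r = (extChartAt 𝓘(ℝ, H) c).symm (p r).1 := by
      refine tendsto_nhds_unique_of_frequently_eq (hγ r hr.1).1.continuousAt hcont
        (hfr.mono fun q hq => ?_)
      have h2 : extChartAt 𝓘(ℝ, H) c (γ q) = (p q).1 := congrArg Prod.fst hq.2.2
      rw [← h2, PartialEquiv.left_inv _ hq.2.1]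
    have hrc : γ r ∈ (extChartAt 𝓘(ℝ, H) c).source := by
      rw [heq]; exact PartialEquiv.map_target _ (hp r hr.2).1
    exact ⟨hr, hrc, tendsto_nhds_unique_of_frequently_eq
      (hγ.hasDerivAt_chartState hr.1 hrc).continuousAt (hp r hr.2).2.continuousAt
      (hfr.mono fun q hq => hq.2.2)⟩

/-- `s` is a parallel section of `E` along the restriction of `γ` to `[a, b]`. -/
def IsParallelOn (γ : ℝ → X) (s : ∀ t : ℝ, EFib H lam mu (γ t)) (a b : ℝ) : Prop :=
  ∀ t ∈ Icc a b,
    HasDerivWithinAt (fun r => eToModel lam mu (γ t) (γ r) (s r))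
      (- eToModel lam mu (γ t) (γ t) (eGamma (γ t) (velocity H γ t) (s t))) (Icc a b) t

/-- In the preferred chart at `c`: a solution `p` of the geodesic equation, together with the matrix
`K` of the parallel transport along it and its inverse `N`. -/
structure IsFrameSolution (c : X) (p : ℝ → H × H) (N K : ℝ → Schur lam mu H →L[ℝ] Schur lam mu H)
    (J : Set ℝ) : Prop where
  mem : ∀ t ∈ J, (p t).1 ∈ (extChartAt 𝓘(ℝ, H) c).target
  deriv_state : ∀ t ∈ J, HasDerivAt p (geodesicField c (p t)) t
  deriv_left : ∀ t ∈ J, HasDerivAt N ((N t).comp (schurAct (chr c (p t).1 (p t).2))) t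
  deriv_right : ∀ t ∈ J, HasDerivAt K (-((schurAct (chr c (p t).1 (p t).2)).comp (K t))) t

theorem eq_of_hasDerivWithinAt_zero {E : Type*} [NormedAddCommGroup E] [NormedSpace ℝ E]
    {f : ℝ → E} {a b : ℝ} (hab : a ≤ b) (h : ∀ t ∈ Icc a b, HasDerivWithinAt f 0 (Icc a b) t) :
    f b = f a :=
  constant_of_has_deriv_right_zero (fun t ht => (h t ht).continuousWithinAt)
    (fun t ht => (h t ⟨ht.1, ht.2.le⟩).mono_of_mem_nhdsWithin (Icc_mem_nhdsGE_of_mem ht)) b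
    ⟨hab, le_rfl⟩

theorem apply_apply_of_comp_eq_one {E : Type*} [NormedAddCommGroup E] [NormedSpace ℝ E]
    [FiniteDimensional ℝ E] {A B : E →L[ℝ] E} (h : A.comp B = 1) (e : E) : B (A e) = e := by
  have h1 : ∀ w, A (B w) = w := fun w => DFunLike.congr_fun h w
  have h2 : Function.Surjective (B : E →ₗ[ℝ] E) :=
    LinearMap.injective_iff_surjective.1 (Function.LeftInverse.injective (g := A) h1)
  obtain ⟨w, hw⟩ := h2 e
  rw [← hw]
  exact congrArg B (h1 w)

namespace IsFrameSolution

variable {c : X} {p : ℝ → H × H} {N K : ℝ → Schur lam mu H →L[ℝ] Schur lam mu H} {J : Set ℝ}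

/-- With `Γ` the connection matrix, `(N K)' = N Γ K - N Γ K = 0`. -/
theorem comp_eq_one (h : IsFrameSolution c p N K J) {t₁ t₂ : ℝ} (h12 : t₁ ≤ t₂)
    (hJ : Icc t₁ t₂ ⊆ J) (hN : N t₁ = 1) (hK : K t₁ = 1) :
    (N t₂).comp (K t₂) = 1 := by
  have := eq_of_hasDerivWithinAt_zero (f := fun t => (N t).comp (K t)) h12 fun t ht => by
    refine (((h.deriv_left t (hJ ht)).clm_comp (h.deriv_right t (hJ ht))).congr_deriv
      ?_).hasDerivWithinAt
    ext1 w
    simp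
  rw [this, hN, hK]
  rfl

theorem comp_eq_one' (h : IsFrameSolution c p N K J) {t₁ t₂ : ℝ} (h12 : t₁ ≤ t₂)
    (hJ : Icc t₁ t₂ ⊆ J) (hN : N t₁ = 1) (hK : K t₁ = 1) (e : Schur lam mu H) :
    K t₂ (N t₂ e) = e :=
  apply_apply_of_comp_eq_one (h.comp_eq_one h12 hJ hN hK) e

variable {γ : ℝ → X}

/-- `N` is an integrating factor: `(N s)' = N Γ s - N Γ s = 0` for a parallel `s`. This is the
uniqueness half, since the value at `t₂` determines the value at `t₁`. -/
theorem left_apply_eq (h : IsFrameSolution c p N K J) {t₁ t₂ : ℝ} (h12 : t₁ ≤ t₂)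
    (hJ : Icc t₁ t₂ ⊆ J) (hN : N t₁ = 1)
    (hγ : ∀ t ∈ Icc t₁ t₂, ContMDiffAt 𝓘(ℝ, ℝ) 𝓘(ℝ, H) ∞ γ t)
    (hc : ∀ t ∈ Icc t₁ t₂, γ t ∈ (extChartAt 𝓘(ℝ, H) c).source ∧ chartState c γ t = p t)
    (s : ∀ t : ℝ, EFib H lam mu (γ t)) (hs : IsParallelOn γ s t₁ t₂) :
    N t₂ (eToModel lam mu c (γ t₂) (s t₂)) = eToModel lam mu c (γ t₁) (s t₁) := by
  have := eq_of_hasDerivWithinAt_zero (f := fun t => N t (eToModel lam mu c (γ t) (s t))) h12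
    fun t ht => by
      have h1 := (parallel_iff ht (hγ t ht) (hc t ht).1 s).1 (hs t ht)
      refine ((h.deriv_left t (hJ ht)).hasDerivWithinAt.clm_apply h1).congr_deriv ?_
      rw [← (hc t ht).2]
      simp [chartState]
  rw [this, hN]
  rfl

/-- The existence half: `N t₂` carries `e` back to time `t₁` and `K` propagates the result forward,
recovering `e` at `t₂` because `K` inverts `N`. -/
theorem exists_parallel (h : IsFrameSolution c p N K J) {t₁ t₂ : ℝ} (h12 : t₁ ≤ t₂)
    (hJ : Icc t₁ t₂ ⊆ J) (hN : N t₁ = 1) (hK : K t₁ = 1)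
    (hγ : ∀ t ∈ Icc t₁ t₂, ContMDiffAt 𝓘(ℝ, ℝ) 𝓘(ℝ, H) ∞ γ t)
    (hc : ∀ t ∈ Icc t₁ t₂, γ t ∈ (extChartAt 𝓘(ℝ, H) c).source ∧ chartState c γ t = p t)
    (e : EFib H lam mu (γ t₂)) :
    ∃ s : ∀ t : ℝ, EFib H lam mu (γ t), IsParallelOn γ s t₁ t₂ ∧ s t₂ = e := by
  let S : ℝ → Schur lam mu H := fun t => K t (N t₂ (eToModel lam mu c (γ t₂) e))
  refine ⟨fun t => schurMap (V := H) (W := TangentSpace 𝓘(ℝ, H) (γ t)) (fromModel c (γ t))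
    (toModel c (γ t)) (S t), fun t ht => ?_, ?_⟩
  · refine (parallel_iff ht (hγ t ht) (hc t ht).1 _).2 ?_
    rw [eToModel_schurMap_fromModel (hc t ht).1]
    have h1 : HasDerivWithinAt S (- schurAct (chr c (p t).1 (p t).2) (S t)) (Icc t₁ t₂) t :=
      (((h.deriv_right t (hJ ht)).clm_apply (hasDerivAt_const t _)).congr_deriv
        (by simp [S])).hasDerivWithinAt
    rw [← (hc t ht).2] at h1
    refine h1.congr_of_mem (fun r hr => ?_) ht
    exact eToModel_schurMap_fromModel (hc r hr).1 _
  · have h2 : S t₂ = eToModel lam mu c (γ t₂) e := h.comp_eq_one' h12 hJ hN hK _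
    have h3 := schurMap_fromModel_toModel (hc t₂ ⟨h12, le_rfl⟩).1 e
    rw [← h2] at h3
    exact h3

/-- Geodesics and parallel transport along them are given by solutions in charts. -/
theorem transport [T2Space X] {α β a b : ℝ} (h : IsFrameSolution c p N K (Ioo α β))
    (hγ : IsGeodesicOn H γ (Ioo a b)) {t₁ t₂ : ℝ} (h12 : t₁ ≤ t₂) (h₁ : t₁ ∈ Ioo a b)
    (h₂ : t₂ ∈ Ioo a b) (h₁' : t₁ ∈ Ioo α β) (h₂' : t₂ ∈ Ioo α β) (hN : N t₁ = 1) (hK : K t₁ = 1)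
    (hc : γ t₁ ∈ (extChartAt 𝓘(ℝ, H) c).source) (hs : chartState c γ t₁ = p t₁) :
    γ t₂ ∈ (extChartAt 𝓘(ℝ, H) c).source ∧ chartState c γ t₂ = p t₂ ∧
      (∀ s : ∀ t : ℝ, EFib H lam mu (γ t), IsParallelOn γ s t₁ t₂ →
        N t₂ (eToModel lam mu c (γ t₂) (s t₂)) = eToModel lam mu c (γ t₁) (s t₁)) ∧
      ∀ e : EFib H lam mu (γ t₂), ∃ s : ∀ t : ℝ, EFib H lam mu (γ t),
        IsParallelOn γ s t₁ t₂ ∧ s t₂ = e := by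
  have hI : Icc t₁ t₂ ⊆ Ioo a b := fun t ht => ⟨h₁.1.trans_le ht.1, ht.2.trans_lt h₂.2⟩
  have hI' : Icc t₁ t₂ ⊆ Ioo α β := fun t ht => ⟨h₁'.1.trans_le ht.1, ht.2.trans_lt h₂'.2⟩
  have hst : ∀ t ∈ Icc t₁ t₂, γ t ∈ (extChartAt 𝓘(ℝ, H) c).source ∧ chartState c γ t = p t :=
    fun t ht => chartState_eq_of_solution hγ (fun r hr => ⟨h.mem r hr, h.deriv_state r hr⟩) h₁ h₁'
      hc hs (hI ht) (hI' ht)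
  have hγ' : ∀ t ∈ Icc t₁ t₂, ContMDiffAt 𝓘(ℝ, ℝ) 𝓘(ℝ, H) ∞ γ t := fun t ht => (hγ t (hI ht)).1
  obtain ⟨h3, h4⟩ := hst t₂ ⟨h12, le_rfl⟩
  exact ⟨h3, h4, h.left_apply_eq h12 hI' hN hγ' hst, h.exists_parallel h12 hI' hN hK hγ' hst⟩

end IsFrameSolution

end ChartSolutions

/-! ### Local flows of geodesics with frames, and their gluing -/

section FrameFlow

open Set Filter Topology

variable {H : Type*} [NormedAddCommGroup H] [NormedSpace ℝ H] [FiniteDimensional ℝ H]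
variable {X : Type*} [TopologicalSpace X] [ChartedSpace H X] [IsManifold 𝓘(ℝ, H) ∞ X]
variable [Bundle.RiemannianBundle (fun x : X => TangentSpace 𝓘(ℝ, H) x)]
variable {lam mu : YoungDiagram}

/-- The vector field whose integral curves are geodesics together with parallel frames, in the
preferred chart at `c`. -/
noncomputable def frameField (c : X) (y : (H × H) × ((Schur lam mu H →L[ℝ] Schur lam mu H) ×
    (Schur lam mu H →L[ℝ] Schur lam mu H))) :
    (H × H) × ((Schur lam mu H →L[ℝ] Schur lam mu H) ×
      (Schur lam mu H →L[ℝ] Schur lam mu H)) :=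
  (geodesicField c y.1, (y.2.1.comp (schurActL H lam mu (chr c y.1.1 y.1.2)),
    -((schurActL H lam mu (chr c y.1.1 y.1.2)).comp y.2.2)))

variable [IsContMDiffRiemannianBundle 𝓘(ℝ, H) ∞ H (fun x : X => TangentSpace 𝓘(ℝ, H) x)]

theorem contDiffOn_frameField (c : X) :
    ContDiffOn ℝ ∞ (frameField (H := H) (lam := lam) (mu := mu) c)
      (Prod.fst ⁻¹' ((extChartAt 𝓘(ℝ, H) c).target ×ˢ (univ : Set H))) := by
  set U : Set ((H × H) × ((Schur lam mu H →L[ℝ] Schur lam mu H) ×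
    (Schur lam mu H →L[ℝ] Schur lam mu H))) :=
    Prod.fst ⁻¹' ((extChartAt 𝓘(ℝ, H) c).target ×ˢ (univ : Set H))
  have h0 : ContDiffOn ℝ ∞ (fun y : (H × H) × ((Schur lam mu H →L[ℝ] Schur lam mu H) ×
    (Schur lam mu H →L[ℝ] Schur lam mu H)) => y.1) U := contDiffOn_fst
  have h1 : ContDiffOn ℝ ∞ (fun y : (H × H) × ((Schur lam mu H →L[ℝ] Schur lam mu H) ×
    (Schur lam mu H →L[ℝ] Schur lam mu H)) => geodesicField c y.1) U :=
    ContDiffOn.comp (g := geodesicField c) (contDiffOn_geodesicField c) h0 fun y hy => hy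
  have h2 : ContDiffOn ℝ ∞ (fun y : (H × H) × ((Schur lam mu H →L[ℝ] Schur lam mu H) ×
    (Schur lam mu H →L[ℝ] Schur lam mu H)) => chr c y.1.1 y.1.2) U :=
    ContDiffOn.comp (g := fun p : H × H => chr c p.1 p.2) (contDiffOn_chr c) h0 fun y hy => hy
  have h3 : ContDiffOn ℝ ∞ (fun y : (H × H) × ((Schur lam mu H →L[ℝ] Schur lam mu H) ×
    (Schur lam mu H →L[ℝ] Schur lam mu H)) => schurActL H lam mu (chr c y.1.1 y.1.2)) U :=
    (schurActL H lam mu).contDiff.comp_contDiffOn h2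
  have h4 : ContDiffOn ℝ ∞ (fun y : (H × H) × ((Schur lam mu H →L[ℝ] Schur lam mu H) ×
    (Schur lam mu H →L[ℝ] Schur lam mu H)) => y.2.1) U := contDiff_snd.fst.contDiffOn
  have h5 : ContDiffOn ℝ ∞ (fun y : (H × H) × ((Schur lam mu H →L[ℝ] Schur lam mu H) ×
    (Schur lam mu H →L[ℝ] Schur lam mu H)) => y.2.2) U := contDiff_snd.snd.contDiffOn
  exact h1.prodMk ((h4.clm_comp h3).prodMk (h3.clm_comp h5).neg)

/-- Adjoining the transport matrices to position and velocity gives a single autonomous system, so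
smooth dependence of the transport on the initial velocity comes together with that of the geodesic.
-/
theorem exists_frame_flow (c : X) {p₀ : H × H} (hp₀ : p₀.1 ∈ (extChartAt 𝓘(ℝ, H) c).target)
    (n : ℕ) : ∃ δ > 0, ∃ W : Set (H × H), IsOpen W ∧ p₀ ∈ W ∧ ∃ (P : H × H → ℝ → H × H)
      (N K : H × H → ℝ → Schur lam mu H →L[ℝ] Schur lam mu H),
      (∀ p ∈ W, P p 0 = p ∧ N p 0 = 1 ∧ K p 0 = 1 ∧
        IsFrameSolution c (P p) (N p) (K p) (Ioo (-δ) δ)) ∧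
      ∀ t ∈ Ioo (-δ) δ, ContDiffOn ℝ n (fun p => P p t) W ∧ ContDiffOn ℝ n (fun p => N p t) W := by
  have hU : IsOpen (Prod.fst ⁻¹' ((extChartAt 𝓘(ℝ, H) c).target ×ˢ (univ : Set H)) :
      Set ((H × H) × ((Schur lam mu H →L[ℝ] Schur lam mu H) ×
        (Schur lam mu H →L[ℝ] Schur lam mu H)))) :=
    ((isOpen_target c).prod isOpen_univ).preimage continuous_fst
  obtain ⟨δ, hδ, W, hWo, hW, Φ, hΦ, hΦs⟩ := exists_local_flow hU
    (contDiffOn_frameField (lam := lam) (mu := mu) c) (x₀ := (p₀, ((1 : Schur lam mu H →L[ℝ]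
      Schur lam mu H), (1 : Schur lam mu H →L[ℝ] Schur lam mu H)))) ⟨hp₀, mem_univ _⟩ n
  let ι : H × H → (H × H) × ((Schur lam mu H →L[ℝ] Schur lam mu H) ×
        (Schur lam mu H →L[ℝ] Schur lam mu H)) := fun p => (p, (1, 1))
  have hι : ContDiff ℝ n ι := contDiff_id.prodMk contDiff_const
  refine ⟨δ, hδ, ι ⁻¹' W, hWo.preimage hι.continuous, hW, fun p t => (Φ (ι p) t).1,
    fun p t => (Φ (ι p) t).2.1, fun p t => (Φ (ι p) t).2.2, fun p hp => ?_, fun t ht => ?_⟩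
  · obtain ⟨h0, h⟩ := hΦ _ hp
    refine ⟨congrArg Prod.fst h0, congrArg (fun y => y.2.1) h0,
      congrArg (fun y => y.2.2) h0, fun t ht => ((h t ht).1).1, fun t ht => ?_,
      fun t ht => ?_, fun t ht => ?_⟩
    · exact (h t ht).2.fst
    · exact (h t ht).2.snd.fst
    · exact (h t ht).2.snd.snd
  · have h1 : ContDiffOn ℝ n (fun p => Φ (ι p) t) (ι ⁻¹' W) :=
      ContDiffOn.comp (g := fun y => Φ y t) (hΦs t ht) hι.contDiffOn fun p hp => hp
    exact ⟨h1.fst, h1.snd.fst⟩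

namespace IsFrameSolution

variable {c : X} {p : ℝ → H × H} {N K : ℝ → Schur lam mu H →L[ℝ] Schur lam mu H} {J : Set ℝ}

theorem shift (h : IsFrameSolution c p N K J) (t₁ : ℝ) :
    IsFrameSolution c (fun t => p (t - t₁)) (fun t => N (t - t₁)) (fun t => K (t - t₁))
      {t | t - t₁ ∈ J} where
  mem _ ht := h.mem _ ht
  deriv_state t ht := (h.deriv_state _ ht).comp_sub_const t t₁
  deriv_left t ht := (h.deriv_left _ ht).comp_sub_const t t₁
  deriv_right t ht := (h.deriv_right _ ht).comp_sub_const t t₁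

/-- Homogeneity: the geodesic field is quadratic and the transport equation linear in the velocity.
Hence the geodesic of `t ξ` at time 1 can be read on that of `ξ` at time `t`. -/
theorem rescale (h : IsFrameSolution c p N K J) (a : ℝ) :
    IsFrameSolution c (fun t => ((p (a * t)).1, a • (p (a * t)).2)) (fun t => N (a * t))
      (fun t => K (a * t)) {t | a * t ∈ J} := by
  have hm : ∀ t, HasDerivAt (fun t => a * t) a t := fun t => by
    simpa using (hasDerivAt_id t).const_mul a
  refine ⟨fun t ht => h.mem _ ht, fun t ht => ?_, fun t ht => ?_, fun t ht => ?_⟩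
  · have h1 := HasDerivAt.scomp t (h.deriv_state _ ht) (hm t)
    have h2 : HasDerivAt (fun t => (p (a * t)).1) (a • (geodesicField c (p (a * t))).1) t :=
      (ContinuousLinearMap.fst ℝ H H).hasFDerivAt.comp_hasDerivAt t h1
    have h3 : HasDerivAt (fun t => (p (a * t)).2) (a • (geodesicField c (p (a * t))).2) t :=
      (ContinuousLinearMap.snd ℝ H H).hasFDerivAt.comp_hasDerivAt t h1
    refine (h2.prodMk (h3.const_smul a)).congr_deriv ?_
    simp [geodesicField, chr_smul]
  · refine (HasDerivAt.scomp t (h.deriv_left _ ht) (hm t)).congr_deriv ?_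
    ext1 w
    simp [chr_smul, schurAct_smul]
  · refine (HasDerivAt.scomp t (h.deriv_right _ ht) (hm t)).congr_deriv ?_
    ext1 w
    simp [chr_smul, schurAct_smul]

theorem mono (h : IsFrameSolution c p N K J) {J' : Set ℝ} (hJ : J' ⊆ J) :
    IsFrameSolution c p N K J' :=
  ⟨fun t ht => h.mem t (hJ ht), fun t ht => h.deriv_state t (hJ ht),
    fun t ht => h.deriv_left t (hJ ht), fun t ht => h.deriv_right t (hJ ht)⟩

end IsFrameSolution

theorem IsParallelOn.mono {γ : ℝ → X} {s : ∀ t : ℝ, EFib H lam mu (γ t)} {a b a' b' : ℝ}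
    (h : IsParallelOn γ s a b) (ha : a ≤ a') (hb : b' ≤ b) : IsParallelOn γ s a' b' :=
  fun t ht => (h t ⟨ha.trans ht.1, ht.2.trans hb⟩).mono (Icc_subset_Icc ha hb)

/-- Away from the junction `b` the point is outside the closure of one half, where the derivative
condition is vacuous; at `b` both one-sided derivatives are available and equal. -/
theorem hasDerivWithinAt_Icc_of_split {E : Type*} [NormedAddCommGroup E] [NormedSpace ℝ E]
    {f : ℝ → E} {f' : E} {a b d t : ℝ} (hab : a ≤ b) (hbd : b ≤ d)
    (h1 : t ≤ b → HasDerivWithinAt f f' (Icc a b) t)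
    (h2 : b ≤ t → HasDerivWithinAt f f' (Icc b d) t) : HasDerivWithinAt f f' (Icc a d) t := by
  rw [← Icc_union_Icc_eq_Icc hab hbd]
  rcases lt_trichotomy t b with h | h | h
  · exact (h1 h.le).union (HasFDerivWithinAt.of_notMem_closure (by
      rw [isClosed_Icc.closure_eq]; exact fun h' => absurd h'.1 (not_le.2 h)))
  · exact (h1 h.le).union (h2 h.ge)
  · exact HasDerivWithinAt.union (HasFDerivWithinAt.of_notMem_closure (by
      rw [isClosed_Icc.closure_eq]; exact fun h' => absurd h'.2 (not_le.2 h))) (h2 h.le)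

theorem IsParallelOn.glue {γ : ℝ → X} {s₁ s₂ : ∀ t : ℝ, EFib H lam mu (γ t)} {a b d : ℝ}
    (hab : a ≤ b) (hbd : b ≤ d) (h₁ : IsParallelOn γ s₁ a b) (h₂ : IsParallelOn γ s₂ b d)
    (h : s₁ b = s₂ b) :
    ∃ s : ∀ t : ℝ, EFib H lam mu (γ t), IsParallelOn γ s a d ∧ s a = s₁ a ∧ s d = s₂ d := by
  classical
  let s : ∀ t : ℝ, EFib H lam mu (γ t) := fun t => if t ≤ b then s₁ t else s₂ t
  have e1 : ∀ t ≤ b, s t = s₁ t := fun t ht => if_pos ht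
  have e2 : ∀ t, b ≤ t → s t = s₂ t := fun t ht => by
    rcases ht.eq_or_lt with rfl | h'
    · rw [e1 _ le_rfl, h]
    · exact if_neg (not_le.2 h')
  refine ⟨s, fun t ht => hasDerivWithinAt_Icc_of_split hab hbd (fun htb => ?_) (fun htb => ?_),
    e1 a hab, e2 d hbd⟩
  · rw [e1 t htb]
    refine (h₁ t ⟨ht.1, htb⟩).congr_of_mem (fun r hr => ?_) ⟨ht.1, htb⟩
    rw [e1 r hr.2]
  · rw [e2 t htb]
    refine (h₂ t ⟨htb, ht.2⟩).congr_of_mem (fun r hr => ?_) ⟨htb, ht.2⟩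
    rw [e2 r hr.1]

/-- The admissible step `η` varies with `t`, but a Lebesgue number of the covering by the
corresponding balls bounds it below, and finitely many equal steps reach 1. -/
theorem Icc_local_step_induction {P : ℝ → Prop} (h0 : P 0)
    (hloc : ∀ t ∈ Icc (0 : ℝ) 1, ∃ η > 0, ∀ t₁ ∈ Icc (0 : ℝ) 1, ∀ t₂ ∈ Icc (0 : ℝ) 1,
      |t₁ - t| < η → |t₂ - t| < η → t₁ ≤ t₂ → P t₁ → P t₂) : P 1 := by
  choose! η hη hstep using hloc
  obtain ⟨δ, hδ, hL⟩ := lebesgue_number_lemma_of_metric (s := Icc (0 : ℝ) 1)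
    (c := fun t : Icc (0 : ℝ) 1 => Metric.ball t.1 (η t)) isCompact_Icc (fun _ => Metric.isOpen_ball)
    (fun t ht => mem_iUnion.2 ⟨⟨t, ht⟩, Metric.mem_ball_self (hη t ht)⟩)
  obtain ⟨n, hn⟩ := exists_nat_one_div_lt hδ
  have hn0 : (0 : ℝ) < n + 1 := by positivity
  have key : ∀ k : ℕ, k ≤ n + 1 → P (k / (n + 1)) := by
    intro k
    induction k with
    | zero => intro _; simpa using h0
    | succ k ih =>
      intro hk
      have hk' : (k : ℝ) + 1 ≤ n + 1 := by exact_mod_cast hk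
      have m1 : (k / (n + 1) : ℝ) ∈ Icc (0 : ℝ) 1 :=
        ⟨by positivity, (div_le_one hn0).2 (by linarith)⟩
      have m2 : ((k + 1 : ℕ) / (n + 1) : ℝ) ∈ Icc (0 : ℝ) 1 :=
        ⟨by positivity, (div_le_one hn0).2 (by push_cast; linarith)⟩
      obtain ⟨i, hi⟩ := hL _ m1
      have b1 := hi (Metric.mem_ball_self hδ)
      have b2 := hi (a := ((k + 1 : ℕ) / (n + 1) : ℝ)) (by
        rw [Metric.mem_ball, Real.dist_eq, ← sub_div]
        push_cast
        rw [add_sub_cancel_left, abs_of_pos (by positivity)]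
        exact hn)
      rw [Metric.mem_ball, Real.dist_eq] at b1 b2
      refine hstep i i.2 _ m1 _ m2 b1 b2 ?_ (ih (by omega))
      gcongr
      simp
  have := key (n + 1) le_rfl
  rwa [Nat.cast_add, Nat.cast_one, div_self hn0.ne'] at this

end FrameFlow

/-! ### Smoothness of the exponential map and of radial parallel transport -/

section SmoothTransport

open Set Filter Topology

variable {H : Type*} [NormedAddCommGroup H] [NormedSpace ℝ H] [FiniteDimensional ℝ H]
variable {X : Type*} [TopologicalSpace X] [ChartedSpace H X] [IsManifold 𝓘(ℝ, H) ∞ X]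
variable [Bundle.RiemannianBundle (fun x : X => TangentSpace 𝓘(ℝ, H) x)]
variable {lam mu : YoungDiagram}

/-- `γ` is a geodesic issued from `x` with initial velocity `ζ` in the preferred chart at `x`. -/
structure IsLaunched (x : X) (ζ : H) (γ : ℝ → X) : Prop where
  geodesic : ∃ a b : ℝ, a < 0 ∧ 1 < b ∧ IsGeodesicOn H γ (Ioo a b)
  start : γ 0 = x
  state : chartState x γ 0 = (extChartAt 𝓘(ℝ, H) x x, ζ)

theorem IsGeodesicFrom.isLaunched {x : X} {ξ : TangentSpace 𝓘(ℝ, H) x} {γ : ℝ → X}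
    (h : IsGeodesicFrom x ξ γ) : IsLaunched x (toModel x x ξ) γ := by
  have h0 : γ 0 = x := congrArg Bundle.TotalSpace.proj h.2
  have h1 : toModel x (γ 0) (velocity H γ 0) = toModel x x ξ :=
    congrArg (fun p : TangentBundle 𝓘(ℝ, H) X => toModel x p.1 p.2) h.2
  obtain ⟨a, b, ha, hb, hg⟩ := h.1
  have hx : γ 0 ∈ (extChartAt 𝓘(ℝ, H) x).source := by rw [h0]; exact mem_extChartAt_source x
  refine ⟨⟨a, b, ha, hb, hg⟩, h0, ?_⟩
  rw [velocity_eq (hg 0 ⟨ha, by linarith⟩).1 hx] at h1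
  rw [chartState, h0, h1]

theorem isGeodesicFrom_geodesic {x : X} {ξ : TangentSpace 𝓘(ℝ, H) x} (h : ξ ∈ expDomain x) :
    IsGeodesicFrom x ξ (geodesic x ξ) := by
  have h' : ∃ γ : ℝ → X, IsGeodesicFrom x ξ γ := h
  rw [geodesic, dif_pos h']
  exact h'.choose_spec

theorem exists_sigma_mk_eq {x y : X} (h : y = x) (a : EFib H lam mu y) :
    ∃ w : EFib H lam mu x, (⟨y, a⟩ : Σ y : X, EFib H lam mu y) = ⟨x, w⟩ := by
  subst h
  exact ⟨a, rfl⟩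

theorem eToModel_eq_of_sigma_mk_eq (c : X) {y y' : X} {a : EFib H lam mu y} {b : EFib H lam mu y'}
    (h : (⟨y, a⟩ : Σ y : X, EFib H lam mu y) = ⟨y', b⟩) :
    eToModel lam mu c y a = eToModel lam mu c y' b := by
  obtain ⟨h1, h2⟩ := Sigma.mk.inj h
  subst h1
  rw [eq_of_heq h2]

variable [IsContMDiffRiemannianBundle 𝓘(ℝ, H) ∞ H (fun x : X => TangentSpace 𝓘(ℝ, H) x)]

/-- Computation of the parallel transport along the geodesic `t ↦ exp_x(t ξ)`. -/
theorem eToModel_transport {x c : X} {ξ : TangentSpace 𝓘(ℝ, H) x} (hξ : ξ ∈ expDomain x)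
    {M : Schur lam mu H → Schur lam mu H}
    (h1 : ∀ s : ∀ t : ℝ, EFib H lam mu (geodesic x ξ t), IsParallelOn (geodesic x ξ) s 0 1 →
      M (eToModel lam mu c (geodesic x ξ 1) (s 1)) = eToModel lam mu x (geodesic x ξ 0) (s 0))
    (h2 : ∀ e : EFib H lam mu (geodesic x ξ 1), ∃ s : ∀ t : ℝ, EFib H lam mu (geodesic x ξ t),
      IsParallelOn (geodesic x ξ) s 0 1 ∧ s 1 = e) (e : EFib H lam mu (expMap x ξ)) :
    eToModel lam mu x x (transport x ξ e) = M (eToModel lam mu c (expMap x ξ) e) := by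
  -- Existence excludes the default value 0 in the definition of `transport`; the uniqueness in `h1`
  -- then evaluates whichever vector was chosen.
  have hex : ∃ w, IsTransported x ξ e w := by
    obtain ⟨s, hs, hs1⟩ := h2 e
    obtain ⟨w, hw⟩ := exists_sigma_mk_eq (isGeodesicFrom_geodesic hξ).isLaunched.start (s 0)
    exact ⟨w, s, hs, hs1, hw⟩
  have hT : IsTransported x ξ e (transport x ξ e) := by
    have h : transport x ξ e = hex.choose := dif_pos hex
    rw [h]
    exact hex.choose_spec
  obtain ⟨s, hs, hs1, hs0⟩ := hT
  have h3 : eToModel lam mu x (geodesic x ξ 0) (s 0) = eToModel lam mu x x (transport x ξ e) :=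
    eToModel_eq_of_sigma_mk_eq x hs0
  exact (h3.symm.trans (h1 s hs).symm).trans
    (congrArg (fun a => M (eToModel lam mu c (geodesic x ξ 1) a)) hs1)

/-- For initial velocities near `ζ₀`, the position and velocity at time `t` of the geodesic issued
from `x`, and the parallel transport along it from time `t` to time `0`, are given in the preferred
chart at `c` by functions which are `n` times differentiable at `ζ₀`. -/
def HasSmoothTransport (lam mu : YoungDiagram) (n : ℕ) (x : X) (ζ₀ : H) (c : X) (t : ℝ) : Prop :=
  ∃ (σ : H → H × H) (M : H → Schur lam mu H →L[ℝ] Schur lam mu H),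
    ContDiffAt ℝ n σ ζ₀ ∧ ContDiffAt ℝ n M ζ₀ ∧
    ∀ᶠ ζ in 𝓝 ζ₀, ∀ γ : ℝ → X, IsLaunched x ζ γ →
      γ t ∈ (extChartAt 𝓘(ℝ, H) c).source ∧ chartState c γ t = σ ζ ∧
      (∀ s : ∀ t : ℝ, EFib H lam mu (γ t), IsParallelOn γ s 0 t →
        M ζ (eToModel lam mu c (γ t) (s t)) = eToModel lam mu x (γ 0) (s 0)) ∧
      ∀ e : EFib H lam mu (γ t), ∃ s : ∀ t : ℝ, EFib H lam mu (γ t),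
        IsParallelOn γ s 0 t ∧ s t = e

theorem hasSmoothTransport_zero (n : ℕ) (x : X) (ζ₀ : H) :
    HasSmoothTransport lam mu n x ζ₀ x 0 := by
  refine ⟨fun ζ => (extChartAt 𝓘(ℝ, H) x x, ζ), fun _ => 1, contDiffAt_const.prodMk contDiffAt_id,
    contDiffAt_const, Eventually.of_forall fun ζ γ hγ => ?_⟩
  have hx : γ 0 ∈ (extChartAt 𝓘(ℝ, H) x).source := by
    rw [hγ.start]; exact mem_extChartAt_source x
  refine ⟨hx, hγ.state, fun s _ => rfl, fun e => ?_⟩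
  refine ⟨fun t => schurMap (V := H) (W := TangentSpace 𝓘(ℝ, H) (γ t)) (fromModel x (γ t))
    (toModel x (γ t)) (eToModel lam mu x (γ 0) e), fun t ht => ?_, schurMap_fromModel_toModel hx e⟩
  rw [Icc_self, mem_singleton_iff] at ht
  rw [Icc_self, ht]
  -- The time interval is a single point, where the parallel equation is vacuous.
  exact HasFDerivWithinAt.of_subsingleton subsingleton_singleton

theorem IsLaunched.contMDiffAt {x : X} {ζ : H} {γ : ℝ → X} (h : IsLaunched x ζ γ) {t : ℝ}
    (ht : t ∈ Icc (0 : ℝ) 1) : ContMDiffAt 𝓘(ℝ, ℝ) 𝓘(ℝ, H) ∞ γ t := by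
  obtain ⟨a, b, ha, hb, hg⟩ := h.geodesic
  exact (hg t ⟨ha.trans_le ht.1, ht.2.trans_lt hb⟩).1

theorem tensorChange_tensorChange {c d : X} {y : X} (hc : y ∈ (extChartAt 𝓘(ℝ, H) c).source)
    (hd : y ∈ (extChartAt 𝓘(ℝ, H) d).source) (e : EFib H lam mu y) :
    tensorChange lam mu d c (coordChange H c d (extChartAt 𝓘(ℝ, H) c y))
      (eToModel lam mu d y e) = eToModel lam mu c y e := by
  rw [coordChange_chart hc, ← eToModel_eq_tensorChange hd hc]

/-- The state is composed with the coordinate change and its Jacobian. The matrix `M` takes as input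
components at the far end, so it is composed with the tensor change from `d` back to `c`. -/
theorem HasSmoothTransport.change {n : ℕ} {x c d : X} {ζ₀ : H} {t : ℝ} (ht : t ∈ Icc (0 : ℝ) 1)
    (h : HasSmoothTransport lam mu n x ζ₀ c t) {γ₀ : ℝ → X} (hγ₀ : IsLaunched x ζ₀ γ₀)
    (hd : γ₀ t ∈ (extChartAt 𝓘(ℝ, H) d).source) : HasSmoothTransport lam mu n x ζ₀ d t := by
  obtain ⟨σ, M, hσ, hM, hev⟩ := h
  obtain ⟨h1, h2, -⟩ := hev.self_of_nhds γ₀ hγ₀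
  have hO : (σ ζ₀).1 ∈ overlap H c d := by
    rw [← h2]; exact chart_mem_overlap h1 hd
  have hOn := (isOpen_overlap (H := H) c d).mem_nhds hO
  have hOn' := (isOpen_overlap (H := H) d c).mem_nhds (coordChange_mem_overlap hO)
  have hn : (n : ℕ∞ω) ≤ ∞ := by exact_mod_cast le_top
  have s1 : ContDiffAt ℝ n (fun ζ => (σ ζ).1) ζ₀ := hσ.fst
  have s2 : ContDiffAt ℝ n (fun ζ => (σ ζ).2) ζ₀ := hσ.snd
  have s3 : ContDiffAt ℝ n (fun ζ => coordChange H c d (σ ζ).1) ζ₀ :=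
    ContDiffAt.comp ζ₀ (g := coordChange H c d) (f := fun ζ => (σ ζ).1)
      (((contDiffOn_coordChange c d).contDiffAt hOn).of_le hn) s1
  have s4 : ContDiffAt ℝ n (fun ζ => jac H c d (σ ζ).1) ζ₀ :=
    ContDiffAt.comp ζ₀ (g := jac H c d) (f := fun ζ => (σ ζ).1)
      (((contDiffOn_jac c d).contDiffAt hOn).of_le hn) s1
  have s5 : ContDiffAt ℝ n (fun ζ => tensorChange lam mu d c (coordChange H c d (σ ζ).1)) ζ₀ :=
    ContDiffAt.comp ζ₀ (g := tensorChange lam mu d c) (f := fun ζ => coordChange H c d (σ ζ).1)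
      (((contDiffOn_tensorChange (lam := lam) (mu := mu) d c).contDiffAt hOn').of_le hn) s3
  refine ⟨fun ζ => (coordChange H c d (σ ζ).1, jac H c d (σ ζ).1 (σ ζ).2),
    fun ζ => (M ζ).comp (tensorChange lam mu d c (coordChange H c d (σ ζ).1)),
    s3.prodMk (s4.clm_apply s2), hM.clm_comp s5, ?_⟩
  filter_upwards [hev, s1.continuousAt.eventually_mem hOn] with ζ hζ hζO γ hγ
  obtain ⟨k1, k2, k3, k4⟩ := hζ γ hγ
  have e1 : extChartAt 𝓘(ℝ, H) c (γ t) = (σ ζ).1 := congrArg Prod.fst k2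
  have e2 : deriv (fun r => extChartAt 𝓘(ℝ, H) c (γ r)) t = (σ ζ).2 := congrArg Prod.snd k2
  have hd' : γ t ∈ (extChartAt 𝓘(ℝ, H) d).source := by
    have := (mem_overlap.1 hζO).2
    rwa [← e1, PartialEquiv.left_inv _ k1] at this
  refine ⟨hd', ?_, fun s hs => ?_, k4⟩
  · rw [chartState, ← e1, ← e2, coordChange_chart k1, deriv_chart_eq (hγ.contMDiffAt ht) k1 hd']
  · rw [← k3 s hs, ← e1]
    exact congrArg (M ζ) (tensorChange_tensorChange k1 hd' (s t))

/-- Transport from `t₂` to 0 factors through `t₁`: `M` is composed with the backward matrix `N` of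
the local flow started at the state `σ ζ`. The equation being autonomous, that flow may be shifted
to start at time `t₁`. -/
theorem HasSmoothTransport.step [T2Space X] {n : ℕ} {x c : X} {ζ₀ : H} {t₁ t₂ δ : ℝ}
    (h₁ : t₁ ∈ Icc (0 : ℝ) 1) (h₂ : t₂ ∈ Icc (0 : ℝ) 1) (h12 : t₁ ≤ t₂) (hδ : t₂ - t₁ < δ)
    {W : Set (H × H)} (hW : IsOpen W) {P : H × H → ℝ → H × H}
    {N K : H × H → ℝ → Schur lam mu H →L[ℝ] Schur lam mu H}
    (hP : ∀ p ∈ W, P p 0 = p ∧ N p 0 = 1 ∧ K p 0 = 1 ∧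
        IsFrameSolution c (P p) (N p) (K p) (Ioo (-δ) δ))
    (hPs : ∀ t ∈ Ioo (-δ) δ,
      ContDiffOn ℝ n (fun p => P p t) W ∧ ContDiffOn ℝ n (fun p => N p t) W)
    (h : HasSmoothTransport lam mu n x ζ₀ c t₁) {γ₀ : ℝ → X} (hγ₀ : IsLaunched x ζ₀ γ₀)
    (hγW : chartState c γ₀ t₁ ∈ W) : HasSmoothTransport lam mu n x ζ₀ c t₂ := by
  obtain ⟨σ, M, hσ, hM, hev⟩ := h
  obtain ⟨-, h2, -⟩ := hev.self_of_nhds γ₀ hγ₀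
  have hσW : W ∈ 𝓝 (σ ζ₀) := by rw [← h2]; exact hW.mem_nhds hγW
  have hτ : t₂ - t₁ ∈ Ioo (-δ) δ := ⟨by linarith, hδ⟩
  have s1 : ContDiffAt ℝ n (fun ζ => P (σ ζ) (t₂ - t₁)) ζ₀ :=
    ContDiffAt.comp ζ₀ (g := fun p => P p (t₂ - t₁)) ((hPs _ hτ).1.contDiffAt hσW) hσ
  have s2 : ContDiffAt ℝ n (fun ζ => N (σ ζ) (t₂ - t₁)) ζ₀ :=
    ContDiffAt.comp ζ₀ (g := fun p => N p (t₂ - t₁)) ((hPs _ hτ).2.contDiffAt hσW) hσ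
  refine ⟨fun ζ => P (σ ζ) (t₂ - t₁), fun ζ => (M ζ).comp (N (σ ζ) (t₂ - t₁)), s1,
    hM.clm_comp s2, ?_⟩
  filter_upwards [hev, hσ.continuousAt.eventually_mem hσW] with ζ hζ hζW γ hγ
  obtain ⟨k1, k2, k3, k4⟩ := hζ γ hγ
  obtain ⟨p0, n0, q0, hF⟩ := hP _ hζW
  obtain ⟨a, b, ha, hb, hg⟩ := hγ.geodesic
  have hF' := (hF.shift t₁).mono (J' := Ioo (t₁ - δ) (t₁ + δ)) fun t ht =>
    ⟨by linarith [ht.1], by linarith [ht.2]⟩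
  have hδ0 : 0 < δ := by linarith
  obtain ⟨m1, m2, m3, m4⟩ := hF'.transport hg h12 ⟨ha.trans_le h₁.1, h₁.2.trans_lt hb⟩
    ⟨ha.trans_le h₂.1, h₂.2.trans_lt hb⟩ ⟨by linarith, by linarith⟩ ⟨by linarith, by linarith⟩
    (by simpa using n0) (by simpa using q0) k1 (by rw [k2, sub_self, p0])
  refine ⟨m1, m2, fun s hs => ?_, fun e => ?_⟩
  · rw [← k3 s (hs.mono le_rfl h12), ← m3 s (hs.mono h₁.1 le_rfl)]
    rfl
  · obtain ⟨s₂, hs₂, he⟩ := m4 e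
    obtain ⟨s₁, hs₁, he₁⟩ := k4 (s₂ t₁)
    obtain ⟨s, hs, -, hse⟩ := hs₁.glue h₁.1 h12 hs₂ he₁
    exact ⟨s, hs, hse.trans he⟩

/-- The lifetime of the local flows is not uniform along `γ₀` and the chart must change. The step
induction handles both when applied to the property stated in all charts around `γ₀ t`
simultaneously. -/
theorem hasSmoothTransport_one [T2Space X] (n : ℕ) {x : X} {ζ₀ : H} {γ₀ : ℝ → X}
    (hγ₀ : IsLaunched x ζ₀ γ₀) : HasSmoothTransport lam mu n x ζ₀ (γ₀ 1) 1 := by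
  refine Icc_local_step_induction (P := fun t => ∀ c : X, γ₀ t ∈ (extChartAt 𝓘(ℝ, H) c).source →
    HasSmoothTransport lam mu n x ζ₀ c t) (fun c hc => ?_) (fun t ht => ?_) (γ₀ 1)
    (mem_extChartAt_source _)
  · exact (hasSmoothTransport_zero n x ζ₀).change ⟨le_rfl, zero_le_one⟩ hγ₀ hc
  · have hc := mem_extChartAt_source (I := 𝓘(ℝ, H)) (γ₀ t)
    obtain ⟨δ, hδ, W, hW, hWt, P, N, K, hP, hPs⟩ := exists_frame_flow (lam := lam) (mu := mu)
      (γ₀ t) (p₀ := chartState (γ₀ t) γ₀ t) (mem_extChartAt_target (I := 𝓘(ℝ, H)) (γ₀ t)) n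
    obtain ⟨a, b, ha, hb, hg⟩ := hγ₀.geodesic
    have htab : t ∈ Ioo a b := ⟨ha.trans_le ht.1, ht.2.trans_lt hb⟩
    have e1 := eventually_mem_source (H := H) (hg t htab).1.continuousAt hc
    have e2 : ∀ᶠ r in 𝓝 t, chartState (γ₀ t) γ₀ r ∈ W :=
      (hg.hasDerivAt_chartState htab hc).continuousAt.eventually_mem (hW.mem_nhds hWt)
    obtain ⟨η, hη, hηs⟩ := Metric.eventually_nhds_iff.1 (e1.and e2)
    -- Two times within `δ / 2` of `t` differ by less than the lifetime `δ` of the flow.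
    refine ⟨min η (δ / 2), by positivity, fun t₁ h₁ t₂ h₂ h1t h2t h12 hPt c hc' => ?_⟩
    rw [lt_min_iff] at h1t h2t
    have hd : t₂ - t₁ < δ := by
      have := abs_lt.1 h1t.2
      have := abs_lt.1 h2t.2
      linarith
    obtain ⟨f1, f2⟩ := hηs (y := t₁) h1t.1
    exact ((hPt _ f1).step h₁ h₂ h12 hd hW hP hPs hγ₀ f2).change h₂ hγ₀ hc'

/-- The function `ξ ↦ τ_x^E (u (exp_x ξ))` is smooth on the domain of `exp_x`. -/
theorem exists_contDiffAt_transport [T2Space X] {u : ∀ x : X, EFib H lam mu x}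
    (hu : IsSmoothSection u) {x : X} {ξ₀ : TangentSpace 𝓘(ℝ, H) x} (hξ₀ : ξ₀ ∈ expDomain x)
    (n : ℕ) : ∃ G : H → Schur lam mu H, ContDiffAt ℝ n G (toModel x x ξ₀) ∧
      ∀ᶠ ζ in 𝓝 (toModel x x ξ₀), ∀ ξ : TangentSpace 𝓘(ℝ, H) x, toModel x x ξ = ζ →
        ξ ∈ expDomain x → eToModel lam mu x x (transport x ξ (u (expMap x ξ))) = G ζ := by
  have hγ₀ := (isGeodesicFrom_geodesic hξ₀).isLaunched
  obtain ⟨σ, M, hσ, hM, hev⟩ := hasSmoothTransport_one (lam := lam) (mu := mu) n hγ₀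
  obtain ⟨h1, h2, -⟩ := hev.self_of_nhds _ hγ₀
  have hT : (σ (toModel x x ξ₀)).1 ∈ (extChartAt 𝓘(ℝ, H) (geodesic x ξ₀ 1)).target := by
    rw [← h2]; exact mem_extChartAt_target (I := 𝓘(ℝ, H)) _
  have hU : ContDiffAt ℝ n (fun ζ => compInChart u (geodesic x ξ₀ 1) (σ ζ).1) (toModel x x ξ₀) :=
    ContDiffAt.comp _ (g := compInChart u (geodesic x ξ₀ 1)) (f := fun ζ => (σ ζ).1)
      (((hu.contDiffOn _).contDiffAt ((isOpen_target _).mem_nhds hT)).of_le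
        (by exact_mod_cast le_top)) hσ.fst
  refine ⟨fun ζ => M ζ (compInChart u (geodesic x ξ₀ 1) (σ ζ).1), hM.clm_apply hU, ?_⟩
  filter_upwards [hev] with ζ hζ ξ hξζ hξ
  subst hξζ
  obtain ⟨k1, k2, k3, k4⟩ := hζ _ (isGeodesicFrom_geodesic hξ).isLaunched
  rw [eToModel_transport hξ k3 k4, ← k2]
  exact congrArg _ (compInChart_chart u k1).symm

end SmoothTransport

/-! ### Second order expansion along radial geodesics -/

section RadialExpansion

open Set Filter Topology

variable {H : Type*} [NormedAddCommGroup H] [NormedSpace ℝ H] [FiniteDimensional ℝ H]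
variable {X : Type*} [TopologicalSpace X] [T2Space X] [ChartedSpace H X] [IsManifold 𝓘(ℝ, H) ∞ X]
variable [Bundle.RiemannianBundle (fun x : X => TangentSpace 𝓘(ℝ, H) x)]
variable [IsContMDiffRiemannianBundle 𝓘(ℝ, H) ∞ H (fun x : X => TangentSpace 𝓘(ℝ, H) x)]
variable {lam mu : YoungDiagram} {c : X} {p : ℝ → H × H}
  {N K : ℝ → Schur lam mu H →L[ℝ] Schur lam mu H} {J : Set ℝ}

theorem IsFrameSolution.hasDerivAt_fst (h : IsFrameSolution c p N K J) {t : ℝ} (ht : t ∈ J) :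
    HasDerivAt (fun t => (p t).1) (p t).2 t :=
  (ContinuousLinearMap.fst ℝ H H).hasFDerivAt.comp_hasDerivAt t (h.deriv_state t ht)

theorem IsFrameSolution.hasDerivAt_snd (h : IsFrameSolution c p N K J) {t : ℝ} (ht : t ∈ J) :
    HasDerivAt (fun t => (p t).2) (- chr c (p t).1 (p t).2 (p t).2) t :=
  (ContinuousLinearMap.snd ℝ H H).hasFDerivAt.comp_hasDerivAt t (h.deriv_state t ht)

/-- Differentiating a transported section is transporting its covariant derivative. -/
theorem IsFrameSolution.hasDerivAt_comp {u : ∀ x : X, EFib H lam mu x} (hu : IsSmoothSection u)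
    (h : IsFrameSolution c p N K J) {t : ℝ} (ht : t ∈ J) :
    HasDerivAt (fun t => N t (compInChart u c (p t).1)) (N t (covL u c (p t).1 (p t).2)) t := by
  have hU : HasFDerivAt (compInChart u c) (fderiv ℝ (compInChart u c) (p t).1) (p t).1 :=
    (((hu.contDiffOn c).contDiffAt ((isOpen_target c).mem_nhds (h.mem t ht))).differentiableAt
      (by norm_num)).hasFDerivAt
  have h1 : HasDerivAt (fun t => compInChart u c (p t).1)
      (fderiv ℝ (compInChart u c) (p t).1 (p t).2) t :=
    HasFDerivAt.comp_hasDerivAt (l := compInChart u c) (f := fun t => (p t).1) t hU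
      (h.hasDerivAt_fst ht)
  refine ((h.deriv_left t ht).clm_apply h1).congr_deriv ?_
  rw [covL_apply, covInChart, map_add, add_comm]
  rfl

/-- Besides the integrating factor, the geodesic equation enters: the derivative of the velocity
supplies the last term, which completes the expression to the Hessian evaluated twice on the
velocity. -/
theorem IsFrameSolution.hasDerivAt_covL {u : ∀ x : X, EFib H lam mu x} (hu : IsSmoothSection u)
    (h : IsFrameSolution c p N K J) {t : ℝ} (ht : t ∈ J) :
    HasDerivAt (fun t => N t (covL u c (p t).1 (p t).2))
      (N t (fderiv ℝ (covL u c) (p t).1 (p t).2 (p t).2 +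
        schurAct (chr c (p t).1 (p t).2) (covL u c (p t).1 (p t).2) -
        covL u c (p t).1 (chr c (p t).1 (p t).2 (p t).2))) t := by
  have hU : HasFDerivAt (covL u c) (fderiv ℝ (covL u c) (p t).1) (p t).1 :=
    (((contDiffOn_covL hu c).contDiffAt ((isOpen_target c).mem_nhds (h.mem t ht))).differentiableAt
      (by norm_num)).hasFDerivAt
  have h1 : HasDerivAt (fun t => covL u c (p t).1) (fderiv ℝ (covL u c) (p t).1 (p t).2) t :=
    HasFDerivAt.comp_hasDerivAt (l := covL u c) (f := fun t => (p t).1) t hU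
      (h.hasDerivAt_fst ht)
  refine ((h.deriv_left t ht).clm_apply (h1.clm_apply (h.hasDerivAt_snd ht))).congr_deriv ?_
  rw [map_neg, ← sub_eq_add_neg]
  simp only [map_add, map_sub, ContinuousLinearMap.comp_apply]
  abel

/-- The second order expansion of the transported section along a radial geodesic. -/
theorem exists_radial_expansion {u : ∀ x : X, EFib H lam mu x} (hu : IsSmoothSection u) (x : X)
    (v : TangentSpace 𝓘(ℝ, H) x) : ∃ δ > 0, ∃ h h' : ℝ → Schur lam mu H,
      (∀ t ∈ Ioo (-δ) δ, t • v ∈ expDomain x →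
        eToModel lam mu x x (transport x (t • v) (u (expMap x (t • v)))) = h t) ∧
      (∀ t ∈ Ioo (-δ) δ, HasDerivAt h (h' t) t) ∧
      HasDerivAt h' (eToModel lam mu x x (nablaIter u 2 x fun _ => v)) 0 ∧
      h' 0 = eToModel lam mu x x (nablaIter u 1 x fun _ => v) ∧
      h 0 = eToModel lam mu x x (nablaIter u 0 x fun _ => v) := by
  have hx := mem_extChartAt_source (I := 𝓘(ℝ, H)) x
  -- Only one solution is needed here, so regularity in the initial value is not requested: `n = 0`.
  obtain ⟨δ, hδ, W, hW, hW0, P, N, K, hP, -⟩ := exists_frame_flow (lam := lam) (mu := mu) x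
    (p₀ := (extChartAt 𝓘(ℝ, H) x x, toModel x x v)) (mem_extChartAt_target (I := 𝓘(ℝ, H)) x) 0
  obtain ⟨p0, n0, q0, hF⟩ := hP _ hW0
  generalize P (extChartAt 𝓘(ℝ, H) x x, toModel x x v) = p at *
  generalize N (extChartAt 𝓘(ℝ, H) x x, toModel x x v) = N at *
  generalize K (extChartAt 𝓘(ℝ, H) x x, toModel x x v) = K at *
  have h0 : (0 : ℝ) ∈ Ioo (-δ) δ := ⟨by linarith, hδ⟩
  -- Halving `δ` lets the solution rescaled by `t` live on `(-2, 2)`, an open interval containing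
  -- `[0, 1]`.
  refine ⟨δ / 2, by positivity, fun t => N t (compInChart u x (p t).1),
    fun t => N t (covL u x (p t).1 (p t).2), fun t ht hv => ?_, fun t ht => ?_, ?_, ?_, ?_⟩
  · have hs : IsFrameSolution x (fun r => ((p (t * r)).1, t • (p (t * r)).2)) (fun r => N (t * r))
        (fun r => K (t * r)) (Ioo (-2) 2) := (hF.rescale t).mono fun r hr => by
      have h1 : |t * r| < δ := by
        rw [abs_mul]
        have h2 : |t| < δ / 2 := abs_lt.2 ht
        have h3 : |r| < 2 := abs_lt.2 hr
        nlinarith [abs_nonneg t, abs_nonneg r]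
      exact abs_lt.1 h1
    have hγ := (isGeodesicFrom_geodesic hv).isLaunched
    obtain ⟨a, b, ha, hb, hg⟩ := hγ.geodesic
    obtain ⟨m1, m2, m3, m4⟩ := hs.transport hg zero_le_one ⟨ha, by linarith⟩ ⟨by linarith, hb⟩
      (by norm_num) (by norm_num) (by simpa using n0) (by simpa using q0)
      (by rw [hγ.start]; exact hx) (by rw [hγ.state, mul_zero, p0, map_smul])
    rw [eToModel_transport hv m3 m4, mul_one]
    have e1 : extChartAt 𝓘(ℝ, H) x (geodesic x (t • v) 1) = (p (t * 1)).1 := congrArg Prod.fst m2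
    rw [mul_one] at e1
    refine congrArg (N t) ?_
    rw [← e1]
    exact (compInChart_chart u m1).symm
  · exact hF.hasDerivAt_comp hu ⟨by linarith [ht.1], by linarith [ht.2]⟩
  · have h1 := hF.hasDerivAt_covL hu h0
    rw [p0, n0] at h1
    rw [eToModel_nablaIter_two hu]
    exact h1
  · beta_reduce
    rw [p0, n0, eToModel_nablaIter_one hu hx]
    rfl
  · beta_reduce
    rw [p0, n0, nablaIter_zero_apply, ← compInChart_chart u hx]
    exact ContinuousLinearMap.id_apply (R₁ := ℝ) _

end RadialExpansion

/-! ### Euclidean Fourier inversion and polarization -/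

section FourierAnalysis

open Set Filter Topology FourierTransform

variable {V : Type*} [NormedAddCommGroup V] [InnerProductSpace ℝ V]

/-- The norm fails to be smooth only at the origin, near which the cut-off is constant. -/
theorem contDiff_cutoff {χ : ℝ → ℝ} (hχ : ContDiffOn ℝ ∞ χ (Ici 0))
    (hχ1 : ∀ t ∈ Icc (0 : ℝ) 1, χ t = 1) {ε : ℝ} (hε : 0 < ε) :
    ContDiff ℝ ∞ fun ξ : V => χ (‖ξ‖ / ε) := by
  rw [contDiff_iff_contDiffAt]
  intro ξ
  rcases eq_or_ne ξ 0 with rfl | hξ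
  · refine (contDiffAt_const (c := (1 : ℝ))).congr_of_eventuallyEq ?_
    filter_upwards [Metric.ball_mem_nhds (0 : V) hε] with ζ hζ
    rw [mem_ball_zero_iff] at hζ
    exact hχ1 _ ⟨by positivity, (div_le_one hε).2 hζ.le⟩
  · have h1 : 0 < ‖ξ‖ / ε := by positivity
    exact ContDiffAt.comp ξ (g := χ) (f := fun ξ : V => ‖ξ‖ / ε)
      (hχ.contDiffAt (Ici_mem_nhds h1)) ((contDiffAt_norm ℝ hξ).div_const ε)

/-- On the diagonal, the derivative of order `k` is the `k`-th derivative of `t ↦ f(tv)`. Here `h`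
is another expression of that restriction, known only near 0 and after the passage to coordinates
`L`. -/
theorem map_iteratedFDeriv_diagonal {S T : Type*} [NormedAddCommGroup S] [NormedSpace ℝ S]
    [NormedAddCommGroup T] [NormedSpace ℝ T] {f : V → S} (hf : ContDiff ℝ ∞ f) (L : S →L[ℝ] T)
    {v : V} {h h' : ℝ → T} {d : T} (h0 : ∀ᶠ t in 𝓝 (0 : ℝ), L (f (t • v)) = h t)
    (h1 : ∀ᶠ t in 𝓝 (0 : ℝ), HasDerivAt h (h' t) t) (h2 : HasDerivAt h' d 0) :
    L (iteratedFDeriv ℝ 0 f 0 fun _ => v) = h 0 ∧ L (iteratedFDeriv ℝ 1 f 0 fun _ => v) = h' 0 ∧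
      L (iteratedFDeriv ℝ 2 f 0 fun _ => v) = d := by
  have hl : ∀ t : ℝ, HasDerivAt (fun t : ℝ => t • v) v t := fun t => by
    simpa using (hasDerivAt_id t).smul_const v
  have hd : ∀ t : ℝ, HasDerivAt (fun t : ℝ => L (f (t • v))) (L (fderiv ℝ f (t • v) v)) t :=
    fun t => L.hasFDerivAt.comp_hasDerivAt t
      (((hf.differentiable (by norm_num)) (t • v)).hasFDerivAt.comp_hasDerivAt t (hl t))
  have hf' : ContDiff ℝ ∞ (fderiv ℝ f) := hf.fderiv_right (by norm_cast)
  have hd2 : HasDerivAt (fun t : ℝ => L (fderiv ℝ f (t • v) v))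
      (L (fderiv ℝ (fderiv ℝ f) ((0 : ℝ) • v) v v)) 0 :=
    L.hasFDerivAt.comp_hasDerivAt 0 ((ContinuousLinearMap.apply ℝ S v).hasFDerivAt.comp_hasDerivAt 0
      (((hf'.differentiable (by norm_num)) ((0 : ℝ) • v)).hasFDerivAt.comp_hasDerivAt 0 (hl 0)))
  have e1 : ∀ᶠ t in 𝓝 (0 : ℝ), L (fderiv ℝ f (t • v) v) = h' t := by
    filter_upwards [h0.eventually_nhds, h1] with t ht ht1
    exact (hd t).unique (ht1.congr_of_eventuallyEq ht)
  have e2 := hd2.unique (h2.congr_of_eventuallyEq e1)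
  have e3 := h0.self_of_nhds
  have e4 := e1.self_of_nhds
  rw [zero_smul] at e2 e3 e4
  rw [iteratedFDeriv_zero_apply, iteratedFDeriv_one_apply, iteratedFDeriv_two_apply]
  exact ⟨e3, e4, e2⟩

/-- A symmetric linear form on multilinear maps in at most two variables only depends on the values
on the diagonal. -/
theorem eq_of_diagonal_eq {S G : Type*} [NormedAddCommGroup S] [NormedSpace ℝ S]
    [AddCommGroup G] [Module ℝ G] {k : ℕ} (hk : k ≤ 2)
    (B : ContinuousMultilinearMap ℝ (fun _ : Fin k => V) S →ₗ[ℝ] G)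
    (hB : ∀ (σ : Equiv.Perm (Fin k)) (M : ContinuousMultilinearMap ℝ (fun _ : Fin k => V) S),
      B (M.domDomCongr σ) = B M)
    {M M' : ContinuousMultilinearMap ℝ (fun _ : Fin k => V) S}
    (h : ∀ v : V, (M fun _ => v) = M' fun _ => v) : B M = B M' := by
  interval_cases k
  · congr 1
    ext m
    rw [Subsingleton.elim m fun _ => 0, h]
  · congr 1
    ext m
    have : m = fun _ => m 0 := funext fun i => by rw [Subsingleton.elim i 0]
    rw [this, h]
  · rw [← sub_eq_zero, ← map_sub]
    set D := M - M' with hD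
    have hD0 : ∀ v : V, D ![v, v] = 0 := fun v => by
      have : (![v, v] : Fin 2 → V) = fun _ => v := by
        funext i; fin_cases i <;> rfl
      rw [this, hD]
      exact sub_eq_zero.2 (h v)
    have hadd : ∀ a b c : V, D ![a + b, c] = D ![a, c] + D ![b, c] := fun a b c => by
      simpa using D.cons_add ![c] a b
    have hadd' : ∀ a b c : V, D ![a, b + c] = D ![a, b] + D ![a, c] := fun a b c => by
      have := D.map_update_add ![a, 0] 1 b c
      have hu : ∀ w : V, Function.update (![a, 0] : Fin 2 → V) 1 w = ![a, w] := fun w => by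
        funext i; fin_cases i <;> rfl
      rwa [hu, hu, hu] at this
    -- Polarization: vanishing on the diagonal makes `D` alternating. Since `B` is invariant under
    -- the swap, `B D = -B D`, hence `B D = 0`.
    have hsw : D.domDomCongr (Equiv.swap 0 1) = - D := by
      ext m
      have hm : m = ![m 0, m 1] := by funext i; fin_cases i <;> rfl
      have h1 := hD0 (m 0 + m 1)
      rw [hadd, hadd', hadd', hD0, hD0, zero_add, add_zero] at h1
      have h2 : (fun i => m ((Equiv.swap 0 1 : Equiv.Perm (Fin 2)) i)) = ![m 1, m 0] := by
        funext i; fin_cases i <;> rfl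
      change D (fun i => m ((Equiv.swap 0 1 : Equiv.Perm (Fin 2)) i)) = - D m
      rw [h2, hm]
      exact eq_neg_of_add_eq_zero_right h1
    have h3 := hB (Equiv.swap 0 1) D
    rw [hsw, map_neg] at h3
    have h4 : (2 : ℝ) • B D = 0 := by
      rw [two_smul]
      exact eq_neg_iff_add_eq_zero.1 h3.symm
    exact (smul_eq_zero.1 h4).resolve_left two_ne_zero

variable [FiniteDimensional ℝ V] [MeasurableSpace V] [BorelSpace V]

theorem integrable_fourier_of_hasCompactSupport {S : Type*} [NormedAddCommGroup S]
    [NormedSpace ℂ S] {g : V → S} (hg : ContDiff ℝ ∞ g) (hc : HasCompactSupport g) :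
    Integrable (𝓕 g) := by
  have h := (𝓕 (hc.toSchwartzMap hg)).integrable (μ := volume)
  rwa [SchwartzMap.fourier_coe] at h

theorem fourier_inversion_zero {S : Type*} [NormedAddCommGroup S] [NormedSpace ℂ S]
    [CompleteSpace S] {g : V → S} (hg : ContDiff ℝ ∞ g) (hc : HasCompactSupport g) :
    ∫ w, 𝓕 g w = g 0 := by
  have h := congrFun (hg.continuous.fourierInv_fourier_eq
    (hg.continuous.integrable_of_hasCompactSupport hc)
    (integrable_fourier_of_hasCompactSupport hg hc)) 0
  rw [Real.fourierInv_eq'] at h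
  simpa using h

theorem fourier_iteratedFDeriv_apply {S : Type*} [NormedAddCommGroup S] [NormedSpace ℂ S]
    {f : V → S} (hf : ContDiff ℝ ∞ f) (hc : HasCompactSupport f) (k : ℕ) (w : V) (m : Fin k → V) :
    𝓕 (iteratedFDeriv ℝ k f) w m =
      (∏ i, inner ℝ w (m i)) • (2 * Real.pi * Complex.I) ^ k • 𝓕 f w := by
  have h := congrFun (Real.fourier_iteratedFDeriv (N := ⊤) hf (fun n _ =>
    (hf.continuous_iteratedFDeriv (m := n) (by exact_mod_cast le_top)).integrable_of_hasCompactSupport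
      (hc.iteratedFDeriv n)) (n := k) le_top) w
  have h2 : ∏ i, (-innerSL ℝ : V →L[ℝ] V →L[ℝ] ℝ) w (m i) = (-1) ^ k * ∏ i, inner ℝ w (m i) := by
    have h3 : ∀ i, (-innerSL ℝ : V →L[ℝ] V →L[ℝ] ℝ) w (m i) = (-1) * inner ℝ w (m i) := fun i => by
      rw [neg_one_mul]; rfl
    simp only [h3, Finset.prod_mul_distrib, Finset.prod_const, Finset.card_univ, Fintype.card_fin]
  -- Two signs `(-1)^k` cancel: one from the pairing `-⟨·, ·⟩` of the general formula, one from its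
  -- factor `(-2πi)^k`.
  have h4 : ((-1 : ℂ) ^ k) * (-1) ^ k = 1 := by rw [← mul_pow]; simp
  rw [h, VectorFourier.fourierPowSMulRight_apply, h2, ← Complex.coe_smul, ← Complex.coe_smul,
    smul_smul, smul_smul, neg_pow]
  congr 1
  push_cast
  linear_combination (2 * Real.pi * Complex.I) ^ k * (∏ i, (inner ℝ w (m i) : ℂ)) * h4

/-- Fourier inversion for the derivatives at the origin of a compactly supported function, the
dual space being identified with the space itself. -/
theorem fourier_inversion_coeff {S G : Type*} [NormedAddCommGroup S] [NormedSpace ℂ S]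
    [hS : NormedSpace ℝ S] [IsScalarTower ℝ ℂ S] [CompleteSpace S]
    [NormedAddCommGroup G] [NormedSpace ℝ G] [CompleteSpace G] {f : V → S}
    (hf : ContDiff ℝ ∞ f) (hc : HasCompactSupport f) (k : ℕ)
    (B : ContinuousMultilinearMap ℝ (fun _ : Fin k => V) S →L[ℝ] G) :
    Integrable (fun η : StrongDual ℝ V =>
      B (((ContinuousMultilinearMap.mkPiAlgebra ℝ (Fin k) ℝ).compContinuousLinearMap
        fun _ => η).smulRight ((2 * Real.pi * Complex.I) ^ k •
          ∫ ξ, Complex.exp (-2 * Real.pi * Complex.I * (η ξ : ℝ)) • f ξ)))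
      ((volume : Measure V).map (InnerProductSpace.toDual ℝ V)) ∧
    ∫ η, B (((ContinuousMultilinearMap.mkPiAlgebra ℝ (Fin k) ℝ).compContinuousLinearMap
        fun _ => η).smulRight ((2 * Real.pi * Complex.I) ^ k •
          ∫ ξ, Complex.exp (-2 * Real.pi * Complex.I * (η ξ : ℝ)) • f ξ))
      ∂((volume : Measure V).map (InnerProductSpace.toDual ℝ V)) = B (iteratedFDeriv ℝ k f 0) := by
  -- The real structure of `S` is an independent datum (for the Schur powers it comes from the
  -- ambient tensors); the scalar tower forces it to be the restriction of the complex one.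
  have hinst : hS = NormedSpace.complexToReal := by
    ext r s
    exact (algebraMap_smul ℂ r s).symm
  subst hinst
  have hemb : MeasurableEmbedding (InnerProductSpace.toDual ℝ V) :=
    (InnerProductSpace.toDual ℝ V).toHomeomorph.measurableEmbedding
  -- At `η = ⟨w, ·⟩` the argument of `B` is the Fourier transform of the `k`-th derivative of `f`;
  -- afterwards `B` only has to commute with the integral.
  have hk : ∀ w : V, B (((ContinuousMultilinearMap.mkPiAlgebra ℝ (Fin k) ℝ).compContinuousLinearMap
        fun _ => InnerProductSpace.toDual ℝ V w).smulRight ((2 * Real.pi * Complex.I) ^ k •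
          ∫ ξ, Complex.exp (-2 * Real.pi * Complex.I *
            (InnerProductSpace.toDual ℝ V w ξ : ℝ)) • f ξ)) =
      B (𝓕 (iteratedFDeriv ℝ k f) w) := by
    intro w
    congr 1
    ext m
    rw [fourier_iteratedFDeriv_apply hf hc, Real.fourier_eq']
    have h1 : ∀ ξ, Complex.exp (-2 * Real.pi * Complex.I *
        (InnerProductSpace.toDual ℝ V w ξ : ℝ)) • f ξ =
        Complex.exp (((-2 * Real.pi * inner ℝ ξ w : ℝ) : ℂ) * Complex.I) • f ξ := fun ξ => by
      rw [InnerProductSpace.toDual_apply_apply, real_inner_comm]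
      congr 2
      push_cast
      ring
    simp only [h1]
    rfl
  have hg : ContDiff ℝ ∞ (iteratedFDeriv ℝ k f) := hf.iteratedFDeriv_right (by norm_cast)
  have hgc : HasCompactSupport (iteratedFDeriv ℝ k f) := hc.iteratedFDeriv k
  have hint := integrable_fourier_of_hasCompactSupport hg hgc
  constructor
  · rw [hemb.integrable_map_iff]
    refine (B.integrable_comp hint).congr (Eventually.of_forall fun w => ?_)
    exact (hk w).symm
  · rw [hemb.integral_map]
    simp only [hk]
    rw [B.integral_comp_comm hint, fourier_inversion_zero hg hgc]

end FourierAnalysis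

/-! ### The inversion formula on the manifold -/

section Inversion

open Set Filter Topology

variable {H : Type*} [NormedAddCommGroup H] [NormedSpace ℝ H] [FiniteDimensional ℝ H]
variable {X : Type*} [TopologicalSpace X] [ChartedSpace H X] [IsManifold 𝓘(ℝ, H) ∞ X]
variable [Bundle.RiemannianBundle (fun x : X => TangentSpace 𝓘(ℝ, H) x)]
variable {lam mu : YoungDiagram}

instance {V : Type*} [NormedAddCommGroup V] [NormedSpace ℝ V] :
    IsScalarTower ℝ ℂ (Schur lam mu V) := inferInstance

/-- The function `ξ ↦ χ(|ξ| / ε) τ_x^E (u (exp_x ξ))`. -/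
noncomputable def cutoffTransport (χ : ℝ → ℝ) (ε : ℝ) (u : ∀ x : X, EFib H lam mu x) (x : X)
    (ξ : TangentSpace 𝓘(ℝ, H) x) : EFib H lam mu x :=
  χ (‖ξ‖ / ε) • transport x ξ (u (expMap x ξ))

theorem fourierIntegrand_eq (χ : ℝ → ℝ) (ε : ℝ) (u : ∀ x : X, EFib H lam mu x) (x : X)
    (η : StrongDual ℝ (TangentSpace 𝓘(ℝ, H) x)) (ξ : TangentSpace 𝓘(ℝ, H) x) :
    fourierIntegrand χ ε u x η ξ =
      Complex.exp (-2 * Real.pi * Complex.I * (η ξ : ℝ)) • cutoffTransport χ ε u x ξ := by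
  rw [fourierIntegrand, mul_smul, cutoffTransport]
  exact congrArg _ (algebraMap_smul ℂ (χ (‖ξ‖ / ε)) (transport x ξ (u (expMap x ξ))))

theorem cutoffTransport_eq_zero {χ : ℝ → ℝ} (hχ0 : ∀ t, 2 ≤ t → χ t = 0) {ε : ℝ} (hε : 0 < ε)
    (u : ∀ x : X, EFib H lam mu x) {x : X} {ξ : TangentSpace 𝓘(ℝ, H) x} (hξ : 2 * ε ≤ ‖ξ‖) :
    cutoffTransport χ ε u x ξ = 0 := by
  rw [cutoffTransport, hχ0 _ ((le_div_iff₀ hε).2 hξ), zero_smul]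

theorem injDomain_subset_expDomain (x : X) :
    injDomain x ⊆ (expDomain x : Set (TangentSpace 𝓘(ℝ, H) x)) := fun _ hξ =>
  (connectedComponentIn_subset _ _ hξ).1

theorem hasCompactSupport_cutoffTransport {χ : ℝ → ℝ} (hχ0 : ∀ t, 2 ≤ t → χ t = 0) {ε : ℝ}
    (hε : 0 < ε) (u : ∀ x : X, EFib H lam mu x) (x : X) :
    HasCompactSupport (cutoffTransport χ ε u x) := by
  have : ProperSpace (TangentSpace 𝓘(ℝ, H) x) := FiniteDimensional.proper ℝ _
  refine HasCompactSupport.intro (isCompact_closedBall (0 : TangentSpace 𝓘(ℝ, H) x) (2 * ε))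
    fun ξ hξ => cutoffTransport_eq_zero hχ0 hε u ?_
  rw [mem_closedBall_zero_iff, not_le] at hξ
  exact hξ.le

variable [T2Space X]
variable [IsContMDiffRiemannianBundle 𝓘(ℝ, H) ∞ H (fun x : X => TangentSpace 𝓘(ℝ, H) x)]

/-- Proved order by order, since the local `C^n` representative of the transported section depends
on `n`. -/
theorem contDiff_cutoffTransport {χ : ℝ → ℝ} (hχ : ContDiffOn ℝ ∞ χ (Ici 0))
    (hχ1 : ∀ t ∈ Icc (0 : ℝ) 1, χ t = 1) (hχ0 : ∀ t, 2 ≤ t → χ t = 0) {ε : ℝ} (hε : 0 < ε)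
    {u : ∀ x : X, EFib H lam mu x} (hu : IsSmoothSection u) {x : X}
    (hεD : {ξ : TangentSpace 𝓘(ℝ, H) x | ‖ξ‖ ≤ 2 * ε} ⊆ expDomain x) :
    ContDiff ℝ ∞ (cutoffTransport χ ε u x) := by
  rw [contDiff_infty]
  intro n
  rw [contDiff_iff_contDiffAt]
  intro ξ₀
  rcases le_or_gt ‖ξ₀‖ (2 * ε) with h | h
  · obtain ⟨G, hG, hev⟩ := exists_contDiffAt_transport hu (hεD h) n
    let P : TangentSpace 𝓘(ℝ, H) x →L[ℝ] H := toModel x x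
    let L : Schur lam mu H →L[ℝ] EFib H lam mu x := schurMap (V := H) (W := TangentSpace 𝓘(ℝ, H) x)
      (fromModel x x) (toModel x x)
    have h1 : ContDiffAt ℝ n (fun ξ => L (G (P ξ))) ξ₀ :=
      L.contDiff.contDiffAt.comp ξ₀ (ContDiffAt.comp ξ₀ (g := G) (f := P) hG P.contDiff.contDiffAt)
    have h2 : ContDiffAt ℝ n (fun ξ : TangentSpace 𝓘(ℝ, H) x => χ (‖ξ‖ / ε)) ξ₀ :=
      ((contDiff_cutoff hχ hχ1 hε).of_le (by exact_mod_cast le_top)).contDiffAt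
    refine (h2.smul h1).congr_of_eventuallyEq ?_
    filter_upwards [P.continuous.continuousAt.eventually hev] with ξ hξ
    rcases le_or_gt ‖ξ‖ (2 * ε) with h' | h'
    · have h3 := hξ ξ rfl (hεD h')
      have h4 := schurMap_fromModel_toModel (mem_extChartAt_source (I := 𝓘(ℝ, H)) x)
        (transport x ξ (u (expMap x ξ)))
      rw [h3] at h4
      exact congrArg (χ (‖ξ‖ / ε) • ·) h4.symm
    · rw [cutoffTransport_eq_zero hχ0 hε u h'.le]
      change 0 = χ (‖ξ‖ / ε) • L (G (P ξ))
      rw [hχ0 _ ((le_div_iff₀ hε).2 h'.le), zero_smul]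
  · refine (contDiffAt_const (c := (0 : EFib H lam mu x))).congr_of_eventuallyEq ?_
    filter_upwards [(isOpen_lt continuous_const continuous_norm).mem_nhds h] with ξ hξ
    exact cutoffTransport_eq_zero hχ0 hε u (le_of_lt hξ)

/-- The derivatives at the origin of the transported section are the covariant derivatives, on the
diagonal. -/
theorem iteratedFDeriv_cutoffTransport {χ : ℝ → ℝ} (hχ : ContDiffOn ℝ ∞ χ (Ici 0))
    (hχ1 : ∀ t ∈ Icc (0 : ℝ) 1, χ t = 1) (hχ0 : ∀ t, 2 ≤ t → χ t = 0) {ε : ℝ} (hε : 0 < ε)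
    {u : ∀ x : X, EFib H lam mu x} (hu : IsSmoothSection u) {x : X}
    (hεD : {ξ : TangentSpace 𝓘(ℝ, H) x | ‖ξ‖ ≤ 2 * ε} ⊆ expDomain x) {k : ℕ} (hk : k ≤ 2)
    (v : TangentSpace 𝓘(ℝ, H) x) :
    (nablaIter u k x fun _ => v) = iteratedFDeriv ℝ k (cutoffTransport χ ε u x) 0 fun _ => v := by
  have hf := contDiff_cutoffTransport hχ hχ1 hχ0 hε hu hεD
  obtain ⟨δ, hδ, h, h', e0, e1, e2, e3, e4⟩ := exists_radial_expansion hu x v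
  have hI : Ioo (-δ) δ ∈ 𝓝 (0 : ℝ) := Ioo_mem_nhds (by linarith) hδ
  have hv : ∀ᶠ t : ℝ in 𝓝 0, ‖t • v‖ < ε := by
    have hc : Continuous fun t : ℝ => ‖t • v‖ := (continuous_id.smul continuous_const).norm
    exact hc.continuousAt.eventually_lt continuousAt_const (by simpa using hε)
  have h0 : ∀ᶠ t : ℝ in 𝓝 0, eToModel lam mu x x (cutoffTransport χ ε u x (t • v)) = h t := by
    filter_upwards [hI, hv] with t ht htv
    rw [cutoffTransport, hχ1 _ ⟨by positivity, (div_le_one hε).2 htv.le⟩, one_smul]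
    exact e0 t ht (hεD (by change ‖t • v‖ ≤ 2 * ε; linarith))
  obtain ⟨d0, d1, d2⟩ := map_iteratedFDeriv_diagonal hf (eToModel lam mu x x) h0
    (eventually_of_mem hI e1) e2
  refine eToModel_injective (mem_extChartAt_source (I := 𝓘(ℝ, H)) x) ?_
  interval_cases k
  · exact (d0.trans e4).symm
  · exact (d1.trans e3).symm
  · exact d2.symm

/-- The cut-off vanishes outside a ball contained in `D_x`, so the shape of `D_x` does not enter the
integral. -/
theorem fourierTransform_eq {χ : ℝ → ℝ} (hχ0 : ∀ t, 2 ≤ t → χ t = 0) {ε : ℝ} (hε : 0 < ε)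
    (u : ∀ x : X, EFib H lam mu x) {x : X}
    (hεD : {ξ : TangentSpace 𝓘(ℝ, H) x | ‖ξ‖ ≤ 2 * ε} ⊆ injDomain x)
    (η : StrongDual ℝ (TangentSpace 𝓘(ℝ, H) x)) :
    fourierTransform χ ε u x η =
      ∫ ξ, Complex.exp (-2 * Real.pi * Complex.I * (η ξ : ℝ)) • cutoffTransport χ ε u x ξ := by
  rw [fourierTransform, setIntegral_eq_integral_of_forall_compl_eq_zero]
  · simp only [fourierIntegrand_eq]
  · intro ξ hξ
    rw [fourierIntegrand_eq, cutoffTransport_eq_zero hχ0 hε u, smul_zero]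
    exact (not_le.1 fun h => hξ (hεD h)).le

theorem integrableOn_fourierIntegrand {χ : ℝ → ℝ} (hχ : ContDiffOn ℝ ∞ χ (Ici 0))
    (hχ1 : ∀ t ∈ Icc (0 : ℝ) 1, χ t = 1) (hχ0 : ∀ t, 2 ≤ t → χ t = 0) {ε : ℝ} (hε : 0 < ε)
    {u : ∀ x : X, EFib H lam mu x} (hu : IsSmoothSection u) {x : X}
    (hεD : {ξ : TangentSpace 𝓘(ℝ, H) x | ‖ξ‖ ≤ 2 * ε} ⊆ expDomain x)
    (η : StrongDual ℝ (TangentSpace 𝓘(ℝ, H) x)) (s : Set (TangentSpace 𝓘(ℝ, H) x)) :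
    IntegrableOn (fourierIntegrand χ ε u x η) s := by
  have hf := (contDiff_cutoffTransport hχ hχ1 hχ0 hε hu hεD).continuous
  have hc : Continuous fun ξ : TangentSpace 𝓘(ℝ, H) x =>
      Complex.exp (-2 * Real.pi * Complex.I * (η ξ : ℝ)) :=
    Complex.continuous_exp.comp (continuous_const.mul (Complex.continuous_ofReal.comp η.continuous))
  have h1 : Integrable fun ξ => Complex.exp (-2 * Real.pi * Complex.I * (η ξ : ℝ)) •
      cutoffTransport χ ε u x ξ :=
    (hc.smul hf).integrable_of_hasCompactSupport
      ((hasCompactSupport_cutoffTransport hχ0 hε u x).smul_left)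
  exact (h1.congr (Eventually.of_forall fun ξ => (fourierIntegrand_eq χ ε u x η ξ).symm)).integrableOn

variable {FF : Type*} [NormedAddCommGroup FF] [NormedSpace ℝ FF]
  {F : X → Type*} [TopologicalSpace (Bundle.TotalSpace FF F)] [∀ x, NormedAddCommGroup (F x)]
  [∀ x, NormedSpace ℝ (F x)] [FiberBundle FF F] [VectorBundle ℝ FF F] {p : ℕ}

/-- The Fourier inversion formula for differential operators of order at most two. -/
theorem DiffOp.fourier_inversion (hp : p ≤ 2) (A : DiffOp H lam mu FF F p) {χ : ℝ → ℝ}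
    (hχ : ContDiffOn ℝ ∞ χ (Ici 0))
    (hχ1 : ∀ t ∈ Icc (0 : ℝ) 1, χ t = 1) (hχ0 : ∀ t, 2 ≤ t → χ t = 0) {ε : ℝ} (hε : 0 < ε)
    {u : ∀ x : X, EFib H lam mu x} (hu : IsSmoothSection u) {x : X} [CompleteSpace (F x)]
    (hεD : {ξ : TangentSpace 𝓘(ℝ, H) x | ‖ξ‖ ≤ 2 * ε} ⊆ injDomain x) :
    Integrable (fun η => A.symbol x η (fourierTransform χ ε u x η)) (dualVolume x) ∧
      A.apply u x = ∫ η, A.symbol x η (fourierTransform χ ε u x η) ∂(dualVolume x) := by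
  have hεD' := hεD.trans (injDomain_subset_expDomain x)
  have hf := contDiff_cutoffTransport hχ hχ1 hχ0 hε hu hεD'
  have hc := hasCompactSupport_cutoffTransport hχ0 hε u x
  have hcs : CompleteSpace (EFib H lam mu x) := FiniteDimensional.complete ℝ _
  have key := fun r : Fin (p + 1) => fourier_inversion_coeff (V := TangentSpace 𝓘(ℝ, H) x)
    (S := EFib H lam mu x) hf hc (p - r) (A.coeff r x)
  have hT := fourierTransform_eq hχ0 hε u hεD
  have hsym : ∀ η, A.symbol x η (fourierTransform χ ε u x η) = ∑ r : Fin (p + 1), A.coeff r x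
      (powTensor (p - r) η ((2 * Real.pi * Complex.I) ^ (p - r : ℕ) •
        ∫ ξ, Complex.exp (-2 * Real.pi * Complex.I * (η ξ : ℝ)) • cutoffTransport χ ε u x ξ)) :=
    fun η => by rw [hT]; rfl
  simp only [hsym]
  refine ⟨integrable_finsetSum _ fun r _ => (key r).1, ?_⟩
  refine Eq.trans ?_ (integral_finsetSum _ fun r _ => (key r).1).symm
  refine Finset.sum_congr rfl fun r _ => ?_
  refine Eq.trans ?_ (key r).2.symm
  have hk : p - (r : ℕ) ≤ 2 := by omega
  -- `∇^k u(x)` and the `k`-th derivative at 0 agree on diagonals, not necessarily as tensors; the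
  -- symmetry of the coefficient makes this enough.
  exact eq_of_diagonal_eq hk (A.coeff r x : _ →ₗ[ℝ] F x) (fun σ M => A.symm r x σ M)
    (iteratedFDeriv_cutoffTransport hχ hχ1 hχ0 hε hu hεD' hk)

end Inversion

end Geometry

end FourierInversion

theorem mainTheorem1
    {H : Type*} [NormedAddCommGroup H] [NormedSpace ℝ H] [FiniteDimensional ℝ H]
    {X : Type*} [TopologicalSpace X] [T2Space X] [ChartedSpace H X] [IsManifold 𝓘(ℝ, H) ∞ X]
    [Bundle.RiemannianBundle (fun x : X => TangentSpace 𝓘(ℝ, H) x)]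
    [IsContMDiffRiemannianBundle 𝓘(ℝ, H) ∞ H (fun x : X => TangentSpace 𝓘(ℝ, H) x)]
    (lam mu : YoungDiagram)
    {FF : Type*} [NormedAddCommGroup FF] [NormedSpace ℂ FF] [FiniteDimensional ℂ FF]
    {F : X → Type*} [TopologicalSpace (Bundle.TotalSpace FF F)]
    [∀ x, NormedAddCommGroup (F x)] [∀ x, InnerProductSpace ℂ (F x)]
    [FiberBundle FF F] [VectorBundle ℂ FF F] [VectorBundle ℝ FF F]
    [ContMDiffVectorBundle ∞ FF F 𝓘(ℝ, H)]
    (_hF : FourierInversion.IsSmoothHermitian H FF F)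
    {p : ℕ} (hp : p ≤ 2) (A : FourierInversion.DiffOp H lam mu FF F p)
    (u : ∀ x : X, FourierInversion.EFib H lam mu x) (hu : FourierInversion.IsSmoothSection u)
    (χ : ℝ → ℝ) (hχ : ContDiffOn ℝ ∞ χ (Set.Ici 0)) (hχ01 : ∀ t, 0 ≤ t → χ t ∈ Set.Icc (0 : ℝ) 1)
    (hχ1 : ∀ t ∈ Set.Icc (0 : ℝ) 1, χ t = 1) (hχ0 : ∀ t, 2 ≤ t → χ t = 0)
    (x : X) (ε : ℝ) (hε : 0 < ε)
    (hεD : {ξ : TangentSpace 𝓘(ℝ, H) x | ‖ξ‖ ≤ 2 * ε} ⊆ FourierInversion.injDomain x) :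
    (∀ η, MeasureTheory.IntegrableOn (FourierInversion.fourierIntegrand χ ε u x η)
        (FourierInversion.injDomain x)) ∧
      MeasureTheory.Integrable
        (fun η => A.symbol x η (FourierInversion.fourierTransform χ ε u x η))
        (FourierInversion.dualVolume x) ∧
      A.apply u x = ∫ η, A.symbol x η (FourierInversion.fourierTransform χ ε u x η)
        ∂(FourierInversion.dualVolume x) := by
  -- The vector-valued integral requires a complete target; `F x` inherits finite dimension from the
  -- model fibre through a trivialization.
  have hFF : FiniteDimensional ℝ FF := FiniteDimensional.complexToReal FF
  have hFx : FiniteDimensional ℝ (F x) :=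
    ((trivializationAt FF F x).linearEquivAt ℝ x
      (FiberBundle.mem_baseSet_trivializationAt' x)).symm.finiteDimensional
  have hcomplete : CompleteSpace (F x) := FiniteDimensional.complete ℝ (F x)
  exact ⟨fun η => FourierInversion.integrableOn_fourierIntegrand hχ hχ1 hχ0 hε hu
      (hεD.trans (FourierInversion.injDomain_subset_expDomain x)) η _,
    A.fourier_inversion hp hχ hχ1 hχ0 hε hu hεD⟩
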